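/- Let $\mathfrak g=\mathfrak g_{\bar 0}\oplus\mathfrak g_{\bar 1}$ be a finite-dimensional complex Lie superalgebra with reductive even part, and let $\chi\in\mathfrak g_{\bar 0}^*\subset\mathfrak g^*$ be nilpotent (the closure of the coadjoint $G_{\bar 0}$-orbit of $\chi$ in $\mathfrak g_{\bar 0}^*$ contains $0$). Put $\mathfrak g^\chi=\{x\in\mathfrak g:\chi([x,\mathfrak g])=0\}$. Let $\mathfrak g=\bigoplus_{j\in\mathbb Z}\mathfrak g_j$ be a good $\mathbb Z$-grading for $\chi$, i.e. a grading of the Lie superalgebra $\mathfrak g$ with $\chi(\mathfrak g_j)=0$ for $j\ne-2$ and $\mathfrak g^\chi\subseteq\bigoplus_{j\ge0}\mathfrak g_j$. Let $\mathfrak l\subseteq\mathfrak g_{-1}$ be a maximal isotropic subspace (subspaces of $\mathfrak g_{-1}$ are understood to be $\mathbb Z/2$-graded) for the form $\chi([\cdot,\cdot])$, and let $\mathfrak l'\subseteq\mathfrak g_{-1}$ be a subspace with $\mathfrak g_{-1}=\mathfrak l\oplus\mathfrak l'$ that contains a maximal isotropic subspace. Put $\mathfrak m=\bigoplus_{j\le-2}\mathfrak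 g_j\oplus\mathfrak l$ and $\mathfrak p=\bigoplus_{j\ge0}\mathfrak g_j$. Let $I_\chi$ be the left ideal of $U(\mathfrak g)$ generated by all $a-\chi(a)$, $a\in\mathfrak m$, let $\pi:U(\mathfrak g)\to U(\mathfrak g)/I_\chi$ be the projection, and let $W_\chi=\mathrm{End}_{U(\mathfrak g)}(U(\mathfrak g)/I_\chi)^{op}$, which is embedded in $U(\mathfrak g)/I_\chi$ by evaluation at $\pi(1)$. The Kazhdan filtration on $U(\mathfrak g)$, in which $x\in\mathfrak g_j$ has degree $j+2$, induces filtrations on $U(\mathfrak g)/I_\chi$ and on $W_\chi$; let $\mathrm{Gr}_K$ denote the associated graded spaces, so that $\mathrm{Gr}_KW_\chi\subseteq\mathrm{Gr}_K(U(\mathfrak g)/I_\chi)$. Let $S(\cdot)$ denote the supersymmetric algebra. The linear map $S(\mathfrak p\oplus\mathfrak l')\to\mathrm{Gr}_K(U(\mathfrak g)/I_\chi)$ that sends a product $x_1\cdots x_n$ with $x_i\in\mathfrak g_{j_i}$ to the class of $\pi(x_1\cdots x_n)$ in degree $\sum_i(j_i+2)$ is a bijection. Identify the two spaces by it, and for $X\in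 S(\mathfrak p\oplus\mathfrak l')$ let $\bar X$ be the component of $X$ of highest degree for the grading of $S(\mathfrak p\oplus\mathfrak l')$ induced by the good grading of $\mathfrak g$ (with $\bar 0=0$). Then: (a) If $\dim(\mathfrak g_{-1})_{\bar 1}$ is even and $X\in\mathrm{Gr}_KW_\chi$, then $\bar X\in S(\mathfrak g^\chi)$. (b) If $\dim(\mathfrak g_{-1})_{\bar 1}$ is odd, $\theta\in\mathfrak l'$ satisfies $\chi([\mathfrak l,\theta])=0$ and $\chi([\theta,\theta])=2$, and $X\in\mathrm{Gr}_KW_\chi$, then $\bar X\in S(\mathfrak g^\chi\oplus\mathbb C\theta)$. -/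

import Mathlib

open scoped DirectSum

noncomputable section

/-- The Koszul sign `(-1)^(i j)` for parities `i`, `j`. -/
def koszulSign (i j : ZMod 2) : ℂ := if i = 1 ∧ j = 1 then -1 else 1

/-- The structure of a complex Lie superalgebra on the vector space `g`. -/
structure LieSuperalgebra (g : Type*) [AddCommGroup g] [Module ℂ g] where
  /-- the even part `parity 0` and the odd part `parity 1` -/
  parity : ZMod 2 → Submodule ℂ g
  isInternal : DirectSum.IsInternal parity
  /-- the superbracket -/
  bracket : g →ₗ[ℂ] g →ₗ[ℂ] g
  bracket_mem : ∀ i j : ZMod 2, ∀ x ∈ parity i, ∀ y ∈ parity j, bracket x y ∈ parity (i + j)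
  skew : ∀ i j : ZMod 2, ∀ x ∈ parity i, ∀ y ∈ parity j,
    bracket x y = -(koszulSign i j • bracket y x)
  jacobi : ∀ i j : ZMod 2, ∀ x ∈ parity i, ∀ y ∈ parity j, ∀ z : g,
    bracket x (bracket y z) = bracket (bracket x y) z + koszulSign i j • bracket y (bracket x z)

/-! ### Components with respect to a direct sum decomposition -/

section Components

variable {ι M : Type*} [DecidableEq ι] [AddCommGroup M] [Module ℂ M]
  {A : ι → Submodule ℂ M}

theorem bijective_of_isInternal (h : DirectSum.IsInternal A) :
    Function.Bijective (DirectSum.coeLinearMap A) := h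

/-- The decomposition of vectors given by an internal direct sum. -/
def internalEquiv (h : DirectSum.IsInternal A) : M ≃ₗ[ℂ] ⨁ i, A i :=
  (LinearEquiv.ofBijective (DirectSum.coeLinearMap A) (bijective_of_isInternal h)).symm

/-- The projection to the component of index `i` of an internal direct sum. -/
def internalProj (h : DirectSum.IsInternal A) (i : ι) : M →ₗ[ℂ] M :=
  (A i).subtype ∘ₗ DirectSum.component ℂ ι (fun i => A i) i ∘ₗ (internalEquiv h).toLinearMap

theorem internalEquiv_of_mem (h : DirectSum.IsInternal A) {i : ι} {x : M} (hx : x ∈ A i) :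
    internalEquiv h x = DirectSum.lof ℂ ι (fun i => A i) i ⟨x, hx⟩ := by
  rw [internalEquiv, LinearEquiv.symm_apply_eq]
  simp

theorem internalProj_apply (h : DirectSum.IsInternal A) (i : ι) (x : M) :
    internalProj h i x = (internalEquiv h x i : M) := rfl

theorem internalProj_mem (h : DirectSum.IsInternal A) (i : ι) (x : M) :
    internalProj h i x ∈ A i := (internalEquiv h x i).2

theorem internalProj_same (h : DirectSum.IsInternal A) {i : ι} {x : M} (hx : x ∈ A i) :
    internalProj h i x = x := by
  rw [internalProj_apply, internalEquiv_of_mem h hx, DirectSum.lof_apply]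

theorem internalProj_ne (h : DirectSum.IsInternal A) {i j : ι} (hij : i ≠ j) {x : M}
    (hx : x ∈ A i) : internalProj h j x = 0 := by
  rw [internalProj_apply, internalEquiv_of_mem h hx, DirectSum.lof_eq_of,
    DirectSum.of_eq_of_ne _ _ _ (Ne.symm hij)]
  rfl

theorem internalProj_finite (h : DirectSum.IsInternal A) (x : M) :
    {i | internalProj h i x ≠ 0}.Finite := by
  classical
  refine (DFinsupp.support (internalEquiv h x)).finite_toSet.subset ?_
  intro i hi
  simp only [Finset.mem_coe, DFinsupp.mem_support_toFun]
  intro h0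
  exact hi (by rw [internalProj_apply, h0]; rfl)

theorem internalProj_sum (h : DirectSum.IsInternal A) (x : M) (s : Finset ι)
    (hs : ∀ i, internalProj h i x ≠ 0 → i ∈ s) : ∑ i ∈ s, internalProj h i x = x := by
  classical
  have h1 : x = (internalEquiv h).symm (internalEquiv h x) := by simp
  conv_rhs => rw [h1]
  rw [internalEquiv, LinearEquiv.symm_symm, LinearEquiv.ofBijective_apply,
    DirectSum.coeLinearMap_eq_dfinsuppSum, DFinsupp.sum]
  symm
  refine Finset.sum_subset ?_ ?_
  · intro i hi
    refine hs i fun h0 => (DFinsupp.mem_support_iff.mp hi) ?_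
    rw [internalProj_apply] at h0
    exact Subtype.ext h0
  · intro i _ hi
    exact congrArg Subtype.val (not_not.mp fun h0 => hi (DFinsupp.mem_support_iff.mpr h0))

theorem exists_internalProj_sum (h : DirectSum.IsInternal A) (x : M) :
    ∃ s : Finset ι, ∑ i ∈ s, internalProj h i x = x :=
  ⟨(internalProj_finite h x).toFinset, internalProj_sum h x _ fun i hi => by simpa using hi⟩

theorem internalProj_comm (h : DirectSum.IsInternal A) (f : M →ₗ[ℂ] M)
    (hf : ∀ i, ∀ x ∈ A i, f x ∈ A i) (i : ι) (x : M) :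
    internalProj h i (f x) = f (internalProj h i x) := by
  obtain ⟨s, hs⟩ := exists_internalProj_sum h x
  rw [← hs]
  simp only [map_sum]
  refine Finset.sum_congr rfl fun j _ => ?_
  have hj := internalProj_mem h j x
  by_cases hij : j = i
  · subst hij
    rw [internalProj_same h hj, internalProj_same h (hf _ _ hj)]
  · rw [internalProj_ne h hij hj, internalProj_ne h hij (hf _ _ hj), map_zero]

theorem supercomm_of_homogeneous (h : DirectSum.IsInternal A) {B : Type*} [Semiring B] [Algebra ℂ B]
    (f : M →ₗ[ℂ] B) (c : ℂ) (x y : M)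
    (hf : ∀ d e, f (internalProj h d x) * f (internalProj h e y) =
      c • (f (internalProj h e y) * f (internalProj h d x))) :
    f x * f y = c • (f y * f x) := by
  obtain ⟨s, hs⟩ := exists_internalProj_sum h x
  obtain ⟨t, ht⟩ := exists_internalProj_sum h y
  rw [← hs, ← ht, map_sum, map_sum, Finset.sum_mul_sum, Finset.sum_mul_sum, Finset.sum_comm,
    Finset.smul_sum]
  refine Finset.sum_congr rfl fun e _ => ?_
  rw [Finset.smul_sum]
  exact Finset.sum_congr rfl fun d _ => hf d e

end Components

/-! ### The supersymmetric algebra -/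

section SuperSym

variable {V : Type*} [AddCommGroup V] [Module ℂ V] (P : ZMod 2 → Submodule ℂ V)

/-- `x ⊗ y = (-1)^(|x||y|) y ⊗ x` for parity homogeneous `x`, `y`. -/
inductive SuperSymRel : TensorAlgebra ℂ V → TensorAlgebra ℂ V → Prop
  | comm (i j : ZMod 2) (x y : V) (hx : x ∈ P i) (hy : y ∈ P j) :
      SuperSymRel (TensorAlgebra.ι ℂ x * TensorAlgebra.ι ℂ y)
        (koszulSign i j • (TensorAlgebra.ι ℂ y * TensorAlgebra.ι ℂ x))

/-- The supersymmetric algebra `S(V)` of a vector superspace `V = P 0 ⊕ P 1`. -/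
def SuperSym : Type _ := RingQuot (SuperSymRel P)

instance : Ring (SuperSym P) := inferInstanceAs (Ring (RingQuot (SuperSymRel P)))

instance : Algebra ℂ (SuperSym P) := inferInstanceAs (Algebra ℂ (RingQuot (SuperSymRel P)))

/-- The quotient map `T(V) → S(V)`. -/
def SuperSym.mk : TensorAlgebra ℂ V →ₐ[ℂ] SuperSym P := RingQuot.mkAlgHom ℂ (SuperSymRel P)

/-- The canonical map `V → S(V)`. -/
def SuperSym.ι : V →ₗ[ℂ] SuperSym P :=
  (SuperSym.mk P).toLinearMap ∘ₗ TensorAlgebra.ι ℂ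

theorem SuperSym.ι_comm {i j : ZMod 2} {x y : V} (hx : x ∈ P i) (hy : y ∈ P j) :
    SuperSym.ι P x * SuperSym.ι P y =
      koszulSign i j • (SuperSym.ι P y * SuperSym.ι P x) := by
  have : SuperSym.mk P _ = SuperSym.mk P _ :=
    RingQuot.mkAlgHom_rel ℂ (SuperSymRel.comm (P := P) i j x y hx hy)
  simpa [SuperSym.ι] using this

variable {P}

/-- The universal property of `S(V)`. -/
def SuperSym.lift {B : Type*} [Semiring B] [Algebra ℂ B] (f : V →ₗ[ℂ] B)
    (hf : ∀ (i j : ZMod 2) (x y : V), x ∈ P i → y ∈ P j →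
      f x * f y = koszulSign i j • (f y * f x)) : SuperSym P →ₐ[ℂ] B :=
  RingQuot.liftAlgHom ℂ ⟨TensorAlgebra.lift ℂ f, by
    intro a b hab
    cases hab with
    | comm i j x y hx hy => simpa using hf i j x y hx hy⟩

end SuperSym

/-! ### The associated graded space of a filtration -/

section Graded

variable {M : Type*} [AddCommGroup M] [Module ℂ M]

/-- `⨁ₖ F k / F (k - 1)` -/
def AssocGraded (F : ℤ → Submodule ℂ M) : Type _ :=
  ⨁ k : ℤ, (F k ⧸ (F (k - 1)).submoduleOf (F k))

instance (F : ℤ → Submodule ℂ M) : AddCommGroup (AssocGraded F) :=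
  inferInstanceAs (AddCommGroup (⨁ k : ℤ, (F k ⧸ (F (k - 1)).submoduleOf (F k))))

instance (F : ℤ → Submodule ℂ M) : Module ℂ (AssocGraded F) :=
  inferInstanceAs (Module ℂ (⨁ k : ℤ, (F k ⧸ (F (k - 1)).submoduleOf (F k))))

variable (F : ℤ → Submodule ℂ M)

/-- The inclusion of the component of degree `k`. -/
def AssocGraded.of (k : ℤ) : (F k ⧸ (F (k - 1)).submoduleOf (F k)) →ₗ[ℂ] AssocGraded F :=
  DirectSum.lof ℂ ℤ (fun k : ℤ => F k ⧸ (F (k - 1)).submoduleOf (F k)) k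

/-- The projection to the component of degree `k`. -/
def AssocGraded.component (k : ℤ) : AssocGraded F →ₗ[ℂ] (F k ⧸ (F (k - 1)).submoduleOf (F k)) :=
  DirectSum.component ℂ ℤ (fun k : ℤ => F k ⧸ (F (k - 1)).submoduleOf (F k)) k

/-- Linear maps out of the associated graded space are given by their values on components. -/
def AssocGraded.toModule {N : Type*} [AddCommMonoid N] [Module ℂ N]
    (f : ∀ k : ℤ, (F k ⧸ (F (k - 1)).submoduleOf (F k)) →ₗ[ℂ] N) : AssocGraded F →ₗ[ℂ] N :=
  DirectSum.toModule ℂ ℤ N f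

theorem AssocGraded.toModule_of {N : Type*} [AddCommMonoid N] [Module ℂ N]
    (f : ∀ k : ℤ, (F k ⧸ (F (k - 1)).submoduleOf (F k)) →ₗ[ℂ] N) (k : ℤ)
    (q : F k ⧸ (F (k - 1)).submoduleOf (F k)) :
    AssocGraded.toModule F f (AssocGraded.of F k q) = f k q :=
  DirectSum.toModule_lof (R := ℂ) (φ := f) k q

/-- The class of `q ∈ F k` in `F k / F (k - 1)`, in the associated graded space. -/
def grClass (k : ℤ) (q : F k) : AssocGraded F :=
  AssocGraded.of F k (Submodule.Quotient.mk q)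

theorem grClass_congr {k k' : ℤ} (hk : k = k') (q : M) (h : q ∈ F k) (h' : q ∈ F k') :
    grClass F k ⟨q, h⟩ = grClass F k' ⟨q, h'⟩ := by
  subst hk; rfl

theorem grClass_eq_zero {k : ℤ} (q : F k) (h : (q : M) ∈ F (k - 1)) : grClass F k q = 0 := by
  have : (Submodule.Quotient.mk q : F k ⧸ (F (k - 1)).submoduleOf (F k)) = 0 := by
    rw [Submodule.Quotient.mk_eq_zero]; exact h
  rw [grClass, this, map_zero]

theorem grClass_add {k : ℤ} (q q' : F k) :
    grClass F k (q + q') = grClass F k q + grClass F k q' := by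
  simp [grClass]

theorem grClass_smul {k : ℤ} (c : ℂ) (q : F k) :
    grClass F k (c • q) = c • grClass F k q := by
  simp [grClass]

variable {F}

theorem assocGraded_hom_ext {N : Type*} [AddCommMonoid N] [Module ℂ N]
    {f f' : AssocGraded F →ₗ[ℂ] N} (h : ∀ k q, f (grClass F k q) = f' (grClass F k q)) :
    f = f' := by
  refine DirectSum.linearMap_ext ℂ fun k => ?_
  refine LinearMap.ext fun q => ?_
  obtain ⟨q, rfl⟩ := Submodule.Quotient.mk_surjective _ q
  exact h k q

/-- The operator of degree `d` on the associated graded space that is induced by an operator `a`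
with `a (F k) ⊆ F (k + d)` for all `k`. -/
def grOperator (a : M →ₗ[ℂ] M) (d : ℤ) (ha : ∀ k, ∀ q ∈ F k, a q ∈ F (k + d)) :
    AssocGraded F →ₗ[ℂ] AssocGraded F :=
  AssocGraded.toModule F fun k =>
    AssocGraded.of F (k + d) ∘ₗ
      Submodule.mapQ _ _ (a.restrict (ha k)) (by
        intro q hq
        have h1 : (q : M) ∈ F (k - 1) := hq
        have h2 := ha (k - 1) q h1
        have h3 : k - 1 + d = k + d - 1 := by ring
        rw [h3] at h2
        exact h2)

theorem grOperator_grClass (a : M →ₗ[ℂ] M) (d : ℤ) (ha : ∀ k, ∀ q ∈ F k, a q ∈ F (k + d))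
    (k : ℤ) (q : F k) :
    grOperator a d ha (grClass F k q) = grClass F (k + d) ⟨a q, ha k q q.2⟩ := by
  simp only [grOperator, grClass, AssocGraded.toModule_of]
  rfl

end Graded

namespace LieSuperalgebra

variable {g : Type*} [AddCommGroup g] [Module ℂ g] (L : LieSuperalgebra g)

/-! ### The even part -/

instance evenLieRing : LieRing (L.parity 0) where
  bracket x y := ⟨L.bracket x y, by
    have := L.bracket_mem 0 0 x x.2 y y.2
    rwa [add_zero] at this⟩
  add_lie x y z := by ext; simp
  lie_add x y z := by ext; simp
  lie_self x := by
    have h := L.skew 0 0 x x.2 x x.2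
    simp only [koszulSign, zero_ne_one, and_self, if_false, one_smul] at h
    ext
    have h2 : (2 : ℂ) • L.bracket x x = 0 := by
      rw [two_smul]; nth_rewrite 1 [h]; exact neg_add_cancel _
    exact (smul_eq_zero.mp h2).resolve_left two_ne_zero
  leibniz_lie x y z := by
    have h := L.jacobi 0 0 x x.2 y y.2 z
    simp only [koszulSign, zero_ne_one, and_self, if_false, one_smul] at h
    ext
    exact h

instance evenLieAlgebra : LieAlgebra ℂ (L.parity 0) where
  lie_smul c x y := by ext; simp [Bracket.bracket]

/-- The Lie algebra `g_0` is reductive: its radical is its center. -/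
def IsEvenReductive : Prop :=
  LieAlgebra.radical ℂ (L.parity 0) = LieAlgebra.center ℂ (L.parity 0)

/-- `L.CoadjointOrbit φ ψ`: the functional `ψ` on `g_0` lies in the orbit of `φ` under the
connected group with Lie algebra `g_0`, which is generated by exponentials. In `step`, the
functional `ψ' = ψ ∘ exp (ad x)` is given by the exponential series. -/
inductive CoadjointOrbit (φ : Module.Dual ℂ (L.parity 0)) : Module.Dual ℂ (L.parity 0) → Prop
  | refl : CoadjointOrbit φ φ
  | step (ψ ψ' : Module.Dual ℂ (L.parity 0)) (x : L.parity 0) (h : CoadjointOrbit φ ψ)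
      (hx : ∀ y : L.parity 0, HasSum (fun n : ℕ =>
        ((n.factorial : ℂ))⁻¹ * ψ (((LieAlgebra.ad ℂ (L.parity 0) x) ^ n) y)) (ψ' y)) :
      CoadjointOrbit φ ψ'

/-- The functional `χ` is even, that is, it vanishes on the odd part. -/
def IsEvenFunctional (χ : Module.Dual ℂ g) : Prop := ∀ x ∈ L.parity 1, χ x = 0

/-- The closure of the coadjoint orbit of `χ` in the dual space of `g_0` contains zero. The
topology of the (finite-dimensional) dual space is that of pointwise convergence. -/
def IsNilpotentFunctional (χ : Module.Dual ℂ g) : Prop :=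
  (0 : L.parity 0 → ℂ) ∈
    closure {f : L.parity 0 → ℂ | ∃ ψ : Module.Dual ℂ (L.parity 0), L.CoadjointOrbit (χ ∘ₗ (L.parity 0).subtype) ψ ∧
      ∀ y, f y = ψ y}

/-- A subspace that is the direct sum of its even and odd parts. -/
def IsSubsuperspace (N : Submodule ℂ g) : Prop := N = ⨆ i : ZMod 2, N ⊓ L.parity i

/-- `g^χ = {x | χ([x, g]) = 0}` -/
def annihilator (χ : Module.Dual ℂ g) : Submodule ℂ g where
  carrier := {x | ∀ y, χ (L.bracket x y) = 0}
  add_mem' ha hb y := by simp [ha y, hb y]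
  zero_mem' y := by simp
  smul_mem' c x hx y := by simp [hx y]

/-- A good `ℤ`-grading of the Lie superalgebra `g` for `χ`. -/
structure GoodGrading (χ : Module.Dual ℂ g) where
  /-- the homogeneous components `g_j` -/
  deg : ℤ → Submodule ℂ g
  isInternal : DirectSum.IsInternal deg
  isSubsuperspace : ∀ j, L.IsSubsuperspace (deg j)
  bracket_mem : ∀ i j : ℤ, ∀ x ∈ deg i, ∀ y ∈ deg j, L.bracket x y ∈ deg (i + j)
  apply_eq_zero : ∀ j : ℤ, j ≠ -2 → ∀ x ∈ deg j, χ x = 0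
  annihilator_le : L.annihilator χ ≤ ⨆ (j : ℤ) (_ : 0 ≤ j), deg j

/-! ### The universal enveloping algebra -/

/-- `x ⊗ y - (-1)^(|x||y|) y ⊗ x = [x, y]` for parity homogeneous `x`, `y`. -/
inductive UEnvRel : TensorAlgebra ℂ g → TensorAlgebra ℂ g → Prop
  | comm (i j : ZMod 2) (x y : g) (hx : x ∈ L.parity i) (hy : y ∈ L.parity j) :
      UEnvRel (TensorAlgebra.ι ℂ x * TensorAlgebra.ι ℂ y)
        (koszulSign i j • (TensorAlgebra.ι ℂ y * TensorAlgebra.ι ℂ x)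
          + TensorAlgebra.ι ℂ (L.bracket x y))

/-- The universal enveloping algebra `U(g)` of a Lie superalgebra. -/
def UEnv : Type _ := RingQuot L.UEnvRel

instance : Ring L.UEnv := inferInstanceAs (Ring (RingQuot L.UEnvRel))

instance : Algebra ℂ L.UEnv := inferInstanceAs (Algebra ℂ (RingQuot L.UEnvRel))

/-- The quotient map `T(g) → U(g)`. -/
def mkU : TensorAlgebra ℂ g →ₐ[ℂ] L.UEnv := RingQuot.mkAlgHom ℂ L.UEnvRel

/-- The canonical map `g → U(g)`. -/
def toU : g →ₗ[ℂ] L.UEnv :=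
  L.mkU.toLinearMap ∘ₗ TensorAlgebra.ι ℂ

theorem toU_comm {i j : ZMod 2} {x y : g} (hx : x ∈ L.parity i) (hy : y ∈ L.parity j) :
    L.toU x * L.toU y = koszulSign i j • (L.toU y * L.toU x) + L.toU (L.bracket x y) := by
  have : L.mkU _ = L.mkU _ := RingQuot.mkAlgHom_rel ℂ (UEnvRel.comm (L := L) i j x y hx hy)
  simpa [toU] using this

namespace GoodGrading

variable {L} {χ : Module.Dual ℂ g} (Γ : L.GoodGrading χ)

/-! ### Isotropic subspaces, the subalgebra `m`, the module `Q_χ` and the algebra `W_χ` -/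

/-- A subsuperspace of `g_{-1}` that is isotropic for the form `χ([x, y])`. -/
def IsIsotropic (l : Submodule ℂ g) : Prop :=
  l ≤ Γ.deg (-1) ∧ L.IsSubsuperspace l ∧ ∀ x ∈ l, ∀ y ∈ l, χ (L.bracket x y) = 0

/-- `m = (⨁_{j ≤ -2} g_j) ⊕ l` -/
def nilSub (l : Submodule ℂ g) : Submodule ℂ g := (⨆ (j : ℤ) (_ : j ≤ -2), Γ.deg j) ⊔ l

/-- The left ideal `I_χ` of `U(g)` generated by the elements `a - χ(a)` for `a ∈ m`. -/
def whittakerIdeal (l : Submodule ℂ g) : Submodule L.UEnv L.UEnv :=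
  Submodule.span L.UEnv
    {u | ∃ a ∈ Γ.nilSub l, u = L.toU a - algebraMap ℂ L.UEnv (χ a)}

/-- The generalized Whittaker module `Q_χ = U(g) / I_χ`. -/
abbrev WhittakerModule (l : Submodule ℂ g) : Type _ := L.UEnv ⧸ Γ.whittakerIdeal l

/-- The projection `π : U(g) → U(g) / I_χ`. -/
def proj (l : Submodule ℂ g) : L.UEnv →ₗ[L.UEnv] Γ.WhittakerModule l :=
  (Γ.whittakerIdeal l).mkQ

/-- The finite `W`-algebra `W_χ = End_{U(g)} (Q_χ)^op`. -/
abbrev FiniteW (l : Submodule ℂ g) : Type _ :=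
  (Module.End L.UEnv (Γ.WhittakerModule l))ᵐᵒᵖ

/-- The embedding `W_χ ⊆ U(g) / I_χ`, which sends an endomorphism `f` to `f (π 1)`. Its image
consists of all `π(y)` such that `(a - χ(a)) y ∈ I_χ` for all `a ∈ m`. -/
def toQ (l : Submodule ℂ g) (w : Γ.FiniteW l) : Γ.WhittakerModule l :=
  w.unop (Γ.proj l 1)

/-! ### The Kazhdan filtration -/

/-- The Kazhdan filtration on `U(g)`: the degree of `x ∈ g_j` is `j + 2`. -/
def kazhdanU (k : ℤ) : Submodule ℂ L.UEnv :=
  Submodule.span ℂ {u | ∃ s : List (ℤ × g), (∀ p ∈ s, p.2 ∈ Γ.deg p.1) ∧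
    (s.map fun p => p.1 + 2).sum ≤ k ∧ u = (s.map fun p => L.toU p.2).prod}

/-- The Kazhdan filtration on `U(g) / I_χ`. -/
def kazhdanQ (l : Submodule ℂ g) (k : ℤ) : Submodule ℂ (Γ.WhittakerModule l) :=
  (Γ.kazhdanU k).map ((Γ.proj l).restrictScalars ℂ)

/-- `Gr_K (U(g) / I_χ)` -/
abbrev GrQ (l : Submodule ℂ g) : Type _ := AssocGraded (Γ.kazhdanQ l)

/-- `Gr_K W_χ` for the induced filtration on `W_χ`, as a subspace of `Gr_K (U(g) / I_χ)`: the
elements whose component in each degree `k` is the class of an element of `W_χ` that lies in the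
`k`-th term of the Kazhdan filtration. -/
def grW (l : Submodule ℂ g) : Set (Γ.GrQ l) :=
  {X | ∀ k : ℤ, ∃ (w : Γ.FiniteW l) (hw : Γ.toQ l w ∈ Γ.kazhdanQ l k),
    AssocGraded.component (Γ.kazhdanQ l) k X = Submodule.Quotient.mk ⟨Γ.toQ l w, hw⟩}

theorem kazhdanU_mono {k k' : ℤ} (h : k ≤ k') : Γ.kazhdanU k ≤ Γ.kazhdanU k' := by
  refine Submodule.span_mono ?_
  rintro u ⟨s, h1, h2, h3⟩
  exact ⟨s, h1, h2.trans h, h3⟩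

theorem one_mem_kazhdanU : (1 : L.UEnv) ∈ Γ.kazhdanU 0 :=
  Submodule.subset_span ⟨[], by simp, by simp, by simp⟩

theorem mul_mem_kazhdanU {j : ℤ} {x : g} (hx : x ∈ Γ.deg j) {k : ℤ} {u : L.UEnv}
    (hu : u ∈ Γ.kazhdanU k) : L.toU x * u ∈ Γ.kazhdanU (k + (j + 2)) := by
  induction hu using Submodule.span_induction with
  | mem u hu =>
    obtain ⟨s, h1, h2, rfl⟩ := hu
    refine Submodule.subset_span ⟨(j, x) :: s, ?_, ?_, by simp⟩
    · intro p hp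
      rcases List.mem_cons.mp hp with rfl | hp
      · exact hx
      · exact h1 p hp
    · simp only [List.map_cons, List.sum_cons]
      linarith
  | zero => simp
  | add u v _ _ hu hv => rw [mul_add]; exact add_mem hu hv
  | smul c u _ hu => rw [mul_smul_comm]; exact Submodule.smul_mem _ _ hu

theorem kazhdanQ_mono (l : Submodule ℂ g) {k k' : ℤ} (h : k ≤ k') :
    Γ.kazhdanQ l k ≤ Γ.kazhdanQ l k' :=
  Submodule.map_mono (Γ.kazhdanU_mono h)

/-- The action of `x ∈ g` on `U(g) / I_χ`. -/
def actQ (l : Submodule ℂ g) (x : g) : Γ.WhittakerModule l →ₗ[ℂ] Γ.WhittakerModule l :=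
  Algebra.lsmul ℂ ℂ (Γ.WhittakerModule l) (L.toU x)

theorem actQ_apply (l : Submodule ℂ g) (x : g) (q : Γ.WhittakerModule l) :
    Γ.actQ l x q = L.toU x • q := rfl

theorem actQ_mem (l : Submodule ℂ g) {j : ℤ} {x : g} (hx : x ∈ Γ.deg j) (k : ℤ) :
    ∀ q ∈ Γ.kazhdanQ l k, Γ.actQ l x q ∈ Γ.kazhdanQ l (k + (j + 2)) := by
  rintro _ ⟨u, hu, rfl⟩
  refine ⟨L.toU x * u, Γ.mul_mem_kazhdanU hx hu, ?_⟩
  simp only [LinearMap.coe_restrictScalars, actQ_apply]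
  rw [← smul_eq_mul, map_smul]

/-- The symbol action of `g_j`: an element of `g_j` acts on `Gr_K (U(g) / I_χ)` by an operator of
degree `j + 2`. -/
def grActDeg (l : Submodule ℂ g) (j : ℤ) : Γ.deg j →ₗ[ℂ] Module.End ℂ (Γ.GrQ l) where
  toFun x := grOperator (Γ.actQ l x) (j + 2) (Γ.actQ_mem l x.2)
  map_add' x y := by
    refine assocGraded_hom_ext (F := Γ.kazhdanQ l) (N := Γ.GrQ l) fun k q => ?_
    rw [LinearMap.add_apply, grOperator_grClass, grOperator_grClass, grOperator_grClass,
      ← grClass_add]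
    congr 1
    ext
    simp [actQ_apply, add_smul]
  map_smul' c x := by
    refine assocGraded_hom_ext (F := Γ.kazhdanQ l) (N := Γ.GrQ l) fun k q => ?_
    rw [LinearMap.smul_apply, RingHom.id_apply, grOperator_grClass, grOperator_grClass,
      ← grClass_smul]
    congr 1
    ext
    simp [actQ_apply]

/-- The symbol action of `g` on `Gr_K (U(g) / I_χ)`. -/
def grAct (l : Submodule ℂ g) : g →ₗ[ℂ] Module.End ℂ (Γ.GrQ l) :=
  DirectSum.toModule ℂ ℤ _ (Γ.grActDeg l) ∘ₗ (internalEquiv Γ.isInternal).toLinearMap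

theorem grAct_of_mem (l : Submodule ℂ g) {j : ℤ} {x : g} (hx : x ∈ Γ.deg j) :
    Γ.grAct l x = grOperator (Γ.actQ l x) (j + 2) (Γ.actQ_mem l hx) := by
  rw [grAct, LinearMap.comp_apply, LinearEquiv.coe_coe, internalEquiv_of_mem _ hx,
    DirectSum.toModule_lof]
  rfl

theorem proj_mem_parity {i : ZMod 2} {x : g} (hx : x ∈ L.parity i) (d : ℤ) :
    internalProj Γ.isInternal d x ∈ L.parity i := by
  have h1 : ∀ e, ∀ y ∈ Γ.deg e, internalProj L.isInternal i y ∈ Γ.deg e := by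
    intro e y hy
    rw [Γ.isSubsuperspace e] at hy
    induction hy using Submodule.iSup_induction' with
    | mem i' y hy =>
      by_cases h : i' = i
      · subst h
        rw [internalProj_same _ hy.2]; exact hy.1
      · rw [internalProj_ne _ h hy.2]; exact zero_mem _
    | zero => rw [map_zero]; exact zero_mem _
    | add y z _ _ hy hz => rw [map_add]; exact add_mem hy hz
  have h2 := internalProj_comm Γ.isInternal (internalProj L.isInternal i) h1 d x
  rw [internalProj_same _ hx] at h2
  rw [h2]
  exact internalProj_mem _ _ _

theorem grAct_comm_of_mem (l : Submodule ℂ g) {i j : ZMod 2} {d e : ℤ} {x y : g}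
    (hx : x ∈ L.parity i) (hy : y ∈ L.parity j) (hxd : x ∈ Γ.deg d) (hye : y ∈ Γ.deg e) :
    Γ.grAct l x * Γ.grAct l y = koszulSign i j • (Γ.grAct l y * Γ.grAct l x) := by
  refine assocGraded_hom_ext (F := Γ.kazhdanQ l) (N := Γ.GrQ l) fun k q => ?_
  rw [LinearMap.smul_apply, Module.End.mul_apply, Module.End.mul_apply,
    Γ.grAct_of_mem l hxd, Γ.grAct_of_mem l hye, grOperator_grClass, grOperator_grClass,
    grOperator_grClass, grOperator_grClass]
  have hk : k + (d + 2) + (e + 2) = k + (e + 2) + (d + 2) := by ring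
  have hb := Γ.actQ_mem l hye _ _ (Γ.actQ_mem l hxd k q q.2)
  rw [grClass_congr (Γ.kazhdanQ l) hk _ hb (hk ▸ hb), ← grClass_smul]
  have hc : Γ.actQ l (L.bracket x y) (q : Γ.WhittakerModule l)
      ∈ Γ.kazhdanQ l (k + (e + 2) + (d + 2) - 1) :=
    Γ.kazhdanQ_mono l (by linarith)
      (Γ.actQ_mem l (Γ.bracket_mem d e x hxd y hye) k q q.2)
  have hc' := Γ.kazhdanQ_mono l (by linarith : k + (e + 2) + (d + 2) - 1 ≤ k + (e + 2) + (d + 2)) hc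
  rw [← add_zero (grClass _ _ (koszulSign i j • _)),
    ← grClass_eq_zero (Γ.kazhdanQ l) ⟨_, hc'⟩ hc, ← grClass_add]
  congr 1
  ext
  simp only [actQ_apply, Submodule.coe_add, Submodule.coe_smul]
  rw [← mul_smul, ← mul_smul, L.toU_comm hx hy, add_smul, smul_assoc]

/-- `Gr_K U(g)` is supercommutative. -/
theorem grAct_comm (l : Submodule ℂ g) (i j : ZMod 2) (x y : g)
    (hx : x ∈ L.parity i) (hy : y ∈ L.parity j) :
    Γ.grAct l x * Γ.grAct l y = koszulSign i j • (Γ.grAct l y * Γ.grAct l x) :=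
  supercomm_of_homogeneous (B := Module.End ℂ (Γ.GrQ l)) Γ.isInternal (Γ.grAct l) (koszulSign i j) x y fun d e =>
    Γ.grAct_comm_of_mem l (Γ.proj_mem_parity hx d) (Γ.proj_mem_parity hy e)
      (internalProj_mem _ _ _) (internalProj_mem _ _ _)

/-- The map `S(g) = Gr_K U(g) → Gr_K (U(g) / I_χ)`. It sends a product `x₁ ⋯ xₙ` with `xᵢ ∈ g_{jᵢ}`
to the class of `π(x₁ ⋯ xₙ)` in degree `k = ∑ (jᵢ + 2)`. -/
def symbolMap (l : Submodule ℂ g) : SuperSym L.parity →ₗ[ℂ] Γ.GrQ l :=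
  LinearMap.applyₗ (grClass (Γ.kazhdanQ l) 0 ⟨Γ.proj l 1, 1, Γ.one_mem_kazhdanU, rfl⟩) ∘ₗ
    (SuperSym.lift (B := Module.End ℂ (Γ.GrQ l)) (Γ.grAct l) (Γ.grAct_comm l)).toLinearMap

/-! ### The good grading on the supersymmetric algebra -/

/-- The linear map `g → S(g)[T, T⁻¹]` with `x ↦ x T^j` for `x ∈ g_j`. -/
def gradeι : g →ₗ[ℂ] AddMonoidAlgebra (SuperSym L.parity) ℤ :=
  DirectSum.toModule ℂ ℤ (AddMonoidAlgebra (SuperSym L.parity) ℤ) (fun j : ℤ =>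
    AddMonoidAlgebra.lsingle j ∘ₗ SuperSym.ι L.parity ∘ₗ (Γ.deg j).subtype) ∘ₗ
    (internalEquiv Γ.isInternal).toLinearMap

theorem gradeι_of_mem {j : ℤ} {x : g} (hx : x ∈ Γ.deg j) :
    Γ.gradeι x = AddMonoidAlgebra.single j (SuperSym.ι L.parity x) := by
  rw [gradeι, LinearMap.comp_apply, LinearEquiv.coe_coe, internalEquiv_of_mem _ hx,
    DirectSum.toModule_lof]
  rfl

theorem gradeι_comm (i j : ZMod 2) (x y : g) (hx : x ∈ L.parity i) (hy : y ∈ L.parity j) :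
    Γ.gradeι x * Γ.gradeι y = koszulSign i j • (Γ.gradeι y * Γ.gradeι x) := by
  refine supercomm_of_homogeneous Γ.isInternal Γ.gradeι (koszulSign i j) x y fun d e => ?_
  rw [Γ.gradeι_of_mem (internalProj_mem _ _ _), Γ.gradeι_of_mem (internalProj_mem _ _ _),
    AddMonoidAlgebra.single_mul_single, AddMonoidAlgebra.single_mul_single,
    SuperSym.ι_comm _ (Γ.proj_mem_parity hx d) (Γ.proj_mem_parity hy e),
    AddMonoidAlgebra.smul_single, add_comm]

/-- The algebra homomorphism `S(g) → S(g)[T, T⁻¹]` with `x ↦ x T^j` for `x ∈ g_j`. The coefficient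
of `T^d` in the image of `X` is the component of `X` of degree `d` in the grading of `S(g)` that is
induced by the good grading of `g`. -/
def gradeHom : SuperSym L.parity →ₐ[ℂ] AddMonoidAlgebra (SuperSym L.parity) ℤ :=
  SuperSym.lift Γ.gradeι Γ.gradeι_comm

open Classical in
/-- The component `X̄` of highest degree of `X` in the good grading (zero for `X = 0`). -/
def topComponent (X : SuperSym L.parity) : SuperSym L.parity :=
  if h : (Γ.gradeHom X).coeff.support.Nonempty then
    (Γ.gradeHom X).coeff ((Γ.gradeHom X).coeff.support.max' h)
  else 0

/-- `p ⊕ l'`, where `p = ⨁_{j ≥ 0} g_j` -/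
def posSub (l' : Submodule ℂ g) : Submodule ℂ g := (⨆ (j : ℤ) (_ : 0 ≤ j), Γ.deg j) ⊔ l'

end GoodGrading

/-- For a subsuperspace `N` of `g`, the supersymmetric algebra `S(N)` as a subalgebra of `S(g)`. -/
def symSub (N : Submodule ℂ g) : Subalgebra ℂ (SuperSym L.parity) :=
  Algebra.adjoin ℂ (SuperSym.ι L.parity '' (N : Set g))

end LieSuperalgebra

end

/-! Everything happens on symbols. An element of `W_χ` gives a vector of `U(g)/I_χ` killed by `a -
χ(a)` for all `a ∈ m`. For `a ∈ g_j` this operator raises the Kazhdan degree by `j` only, not by `j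
+ 2`, because it kills `π(1)`; on the associated graded space it is induced by the superderivation
`ad a` of `S(g)` (`grOperator_whittakerOp_symbolMap`). Reducing `S(g)` to `S(p ⊕ l')` by `x ↦ pr x +
χ(x)` turns `ad a` into `D + B`, where `D` is the contraction with `χ([a, ·])` and `B` is the
superderivation extending `pr ∘ ad a`. In the good grading `D` has degree `j + 2` and `B` has degree
`j`, so the top part of `(D + B) X = 0` reads `D X̄ = 0` (`contraction_topComponent`).

In characteristic zero the kernel on `S(N)` of the contraction with `ξ` is `S(N ∩ ker ξ)`
(`mem_symSub_inf_ker`). Hence `X̄ ∈ S(N)` for some `N ⊆ p ⊕ l'` orthogonal to `m`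
(`exists_topComponent_mem`). For `x ∈ N`, removing the component of degree `-1` leaves an element of
`g^χ` (`sub_mem_annihilator`), and the removed component is a vector of `l'` orthogonal to `l`.
Maximality of `l` makes the space of such vectors odd and anisotropic, hence at most a line over
`ℂ`: `θ` spans it in case (b) (`exists_smul_of_orthogonal`), while a nonzero vector would make `dim
(g_{-1})_1` odd, which excludes it in case (a) (`eq_zero_of_orthogonal_of_even`).

The identification of `S(p ⊕ l')` with the graded module is a Poincaré-Birkhoff-Witt theorem.
Surjectivity is elementary. For injectivity one needs a representation `ρ` of `g` on `S(g)` whose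
leading term is multiplication by `pr x + χ(x)` and for which `ρ(a) 1 = χ(a)` on `m`; the symbol of
`u ↦ ρ(u) 1` is then a left inverse (`exists_leftInverse`). Such a `ρ` is a limit of approximations
in the polynomial degree. The obstruction in degree `n` is a curvature; by the Bianchi identity and
Euler's formula, an explicit contraction of this curvature, divided by `n + 1` or `n + 2`, removes
it (`Approx.exists_succ`, `PBWData.exists_rep`). -/

noncomputable section

/-! ### Koszul signs -/

theorem koszulSign_comm (i j : ZMod 2) : koszulSign i j = koszulSign j i := by
  simp [koszulSign, and_comm]

theorem zmod_two_cases (i : ZMod 2) : i = 0 ∨ i = 1 := by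
  revert i; decide

@[simp] theorem koszulSign_zero_left (j : ZMod 2) : koszulSign 0 j = 1 := by
  simp [koszulSign]

@[simp] theorem koszulSign_zero_right (j : ZMod 2) : koszulSign j 0 = 1 := by
  simp [koszulSign]

@[simp] theorem koszulSign_one_one : koszulSign 1 1 = -1 := by
  simp [koszulSign]

theorem koszulSign_mul_self (i j : ZMod 2) : koszulSign i j * koszulSign i j = 1 := by
  unfold koszulSign; split <;> norm_num

theorem koszulSign_add_left (i j k : ZMod 2) :
    koszulSign (i + j) k = koszulSign i k * koszulSign j k := by
  rcases zmod_two_cases i with rfl | rfl <;> rcases zmod_two_cases j with rfl | rfl <;>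
    rcases zmod_two_cases k with rfl | rfl <;>
    simp [show (1 + 1 : ZMod 2) = 0 from rfl]

/-! ### Internal direct sums: reduction to components -/

section Internal

variable {ι M : Type*} [DecidableEq ι] [AddCommGroup M] [Module ℂ M] {A : ι → Submodule ℂ M}

omit [DecidableEq ι] in
theorem mem_of_iSup_eq_top (h : ⨆ i, A i = ⊤) (p : Submodule ℂ M)
    (hp : ∀ i, ∀ x ∈ A i, x ∈ p) (x : M) : x ∈ p := by
  have : ⨆ i, A i ≤ p := iSup_le hp
  rw [h] at this
  exact this trivial

/-- A submodule that contains all components of an internal direct sum is everything. -/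
theorem mem_of_internal (h : DirectSum.IsInternal A) (p : Submodule ℂ M)
    (hp : ∀ i, ∀ x ∈ A i, x ∈ p) (x : M) : x ∈ p := by
  obtain ⟨s, hs⟩ := exists_internalProj_sum h x
  rw [← hs]
  exact sum_mem fun i _ => hp i _ (internalProj_mem h i x)

theorem eq_zero_of_internalProj (h : DirectSum.IsInternal A) {x : M}
    (hx : ∀ i, internalProj h i x = 0) : x = 0 := by
  obtain ⟨s, hs⟩ := exists_internalProj_sum h x
  rw [← hs]
  exact Finset.sum_eq_zero fun i _ => hx i

theorem mem_of_internalProj (h : DirectSum.IsInternal A) (p : Submodule ℂ M) {x : M}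
    (hx : ∀ i, internalProj h i x ∈ p) : x ∈ p := by
  obtain ⟨s, hs⟩ := exists_internalProj_sum h x
  rw [← hs]
  exact sum_mem fun i _ => hx i

end Internal

/-! ### Induction on products -/

section Adjoin

variable {V B : Type*} [AddCommGroup V] [Module ℂ V] [Ring B] [Algebra ℂ B]

/-- A subspace that contains `1` and is stable under left multiplication by the generators
contains the subalgebra. -/
theorem adjoin_subset_of_mul_mem {s : Set B} (p : Submodule ℂ B) (h1 : (1 : B) ∈ p)
    (hm : ∀ x ∈ s, ∀ u ∈ p, x * u ∈ p) {u : B} (hu : u ∈ Algebra.adjoin ℂ s) : u ∈ p := by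
  suffices h : ∀ v ∈ p, u * v ∈ p by simpa using h 1 h1
  induction hu using Algebra.adjoin_induction with
  | mem x hx => exact hm x hx
  | algebraMap r => intro v hv; rw [← Algebra.smul_def]; exact p.smul_mem r hv
  | add x y _ _ hx hy => intro v hv; rw [add_mul]; exact add_mem (hx v hv) (hy v hv)
  | mul x y _ _ hx hy => intro v hv; rw [mul_assoc]; exact hx _ (hy v hv)

end Adjoin

/-! ### Induction and extensionality for the supersymmetric algebra -/

section SuperSymTools

variable {V : Type*} [AddCommGroup V] [Module ℂ V] (P : ZMod 2 → Submodule ℂ V)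

theorem SuperSym.mk_surjective : Function.Surjective (SuperSym.mk P) :=
  RingQuot.mkAlgHom_surjective ℂ _

theorem TensorAlgebra.mem_adjoin_range_ι (t : TensorAlgebra ℂ V) :
    t ∈ Algebra.adjoin ℂ (Set.range (TensorAlgebra.ι ℂ : V → TensorAlgebra ℂ V)) := by
  rw [TensorAlgebra.adjoin_range_ι]; trivial

variable {P} in
/-- Induction on the supersymmetric algebra. -/
theorem SuperSym.mem_of_mul_mem (p : Submodule ℂ (SuperSym P)) (h1 : (1 : SuperSym P) ∈ p)
    (hm : ∀ x, ∀ u ∈ p, SuperSym.ι P x * u ∈ p) (u : SuperSym P) : u ∈ p := by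
  obtain ⟨t, rfl⟩ := SuperSym.mk_surjective P u
  have := adjoin_subset_of_mul_mem (p.comap (SuperSym.mk P).toLinearMap) (by simpa using h1)
    (s := Set.range (TensorAlgebra.ι ℂ : V → TensorAlgebra ℂ V)) (by
      rintro _ ⟨x, rfl⟩ u hu
      simp only [Submodule.mem_comap, AlgHom.toLinearMap_apply, map_mul] at hu ⊢
      exact hm x _ hu) (TensorAlgebra.mem_adjoin_range_ι t)
  exact this

variable {P} in
theorem SuperSym.lift_ι {B : Type*} [Semiring B] [Algebra ℂ B] (f : V →ₗ[ℂ] B)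
    (hf : ∀ (i j : ZMod 2) (x y : V), x ∈ P i → y ∈ P j →
      f x * f y = koszulSign i j • (f y * f x)) (x : V) :
    SuperSym.lift f hf (SuperSym.ι P x) = f x := by
  have : SuperSym.lift f hf (SuperSym.mk P (TensorAlgebra.ι ℂ x)) =
      TensorAlgebra.lift ℂ f (TensorAlgebra.ι ℂ x) := RingQuot.liftAlgHom_mkAlgHom_apply ..
  simpa [SuperSym.ι] using this

variable {P} in
theorem SuperSym.linearMap_ext {T : Type*} [AddCommGroup T] [Module ℂ T]
    {f f' : SuperSym P →ₗ[ℂ] T} (h1 : f 1 = f' 1)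
    (hm : ∀ x u, f u = f' u → f (SuperSym.ι P x * u) = f' (SuperSym.ι P x * u)) : f = f' := by
  refine LinearMap.ext fun u => ?_
  exact SuperSym.mem_of_mul_mem (LinearMap.eqLocus f f') h1 hm u

variable {P} in
/-- Induction on the supersymmetric algebra, with factors from subspaces that span. -/
theorem SuperSym.mem_of_homogeneous_mul_mem {κ : Type*} {A : κ → Submodule ℂ V}
    (hA : ⨆ w, A w = ⊤) (p : Submodule ℂ (SuperSym P)) (h1 : (1 : SuperSym P) ∈ p)
    (hm : ∀ w, ∀ x ∈ A w, ∀ u ∈ p, SuperSym.ι P x * u ∈ p) (u : SuperSym P) : u ∈ p :=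
  SuperSym.mem_of_mul_mem p h1 (fun x u hu => mem_of_iSup_eq_top hA
    (p.comap (((LinearMap.mul ℂ (SuperSym P)).flip u) ∘ₗ SuperSym.ι P))
    (fun w x hx => hm w x hx u hu) x) u

end SuperSymTools

/-! ### Parity projections and sign twists -/

namespace LieSuperalgebra

variable {g : Type*} [AddCommGroup g] [Module ℂ g] (L : LieSuperalgebra g)

theorem mem_of_parity (p : Submodule ℂ g) (hp : ∀ i, ∀ x ∈ L.parity i, x ∈ p) (x : g) : x ∈ p :=
  mem_of_internal L.isInternal p hp x

theorem sum_internalProj_parity (x : g) :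
    internalProj L.isInternal 0 x + internalProj L.isInternal 1 x = x := by
  have := internalProj_sum L.isInternal x Finset.univ (by simp)
  rwa [show (Finset.univ : Finset (ZMod 2)) = {0, 1} from rfl,
    Finset.sum_pair (by decide)] at this

/-- The map `x ↦ (-1)^(p |x|) x`. -/
def twist (p : ZMod 2) : g →ₗ[ℂ] g :=
  internalProj L.isInternal 0 + koszulSign p 1 • internalProj L.isInternal 1

theorem twist_of_mem {p j : ZMod 2} {x : g} (hx : x ∈ L.parity j) :
    L.twist p x = koszulSign p j • x := by
  rcases zmod_two_cases j with rfl | rfl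
  · simp [twist, internalProj_same _ hx, internalProj_ne _ (show (0 : ZMod 2) ≠ 1 by decide) hx]
  · simp [twist, internalProj_same _ hx, internalProj_ne _ (show (1 : ZMod 2) ≠ 0 by decide) hx]

theorem twist_mem {N : Submodule ℂ g} (hN : ∀ i, ∀ x ∈ N, internalProj L.isInternal i x ∈ N)
    (p : ZMod 2) {x : g} (hx : x ∈ N) : L.twist p x ∈ N := by
  simp only [twist, LinearMap.add_apply, LinearMap.smul_apply]
  exact add_mem (hN _ _ hx) (N.smul_mem _ (hN _ _ hx))

theorem IsSubsuperspace.internalProj_mem {N : Submodule ℂ g} (hN : L.IsSubsuperspace N)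
    (i : ZMod 2) {x : g} (hx : x ∈ N) : internalProj L.isInternal i x ∈ N := by
  rw [hN] at hx
  induction hx using Submodule.iSup_induction' with
  | mem i' y hy =>
    by_cases h : i' = i
    · subst h
      rw [internalProj_same _ hy.2]; exact hy.1
    · rw [internalProj_ne _ h hy.2]; exact zero_mem _
  | zero => rw [map_zero]; exact zero_mem _
  | add y z _ _ hy hz => rw [map_add]; exact add_mem hy hz

theorem isSubsuperspace_of_internalProj_mem {N : Submodule ℂ g}
    (hN : ∀ i, ∀ x ∈ N, internalProj L.isInternal i x ∈ N) : L.IsSubsuperspace N := by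
  refine le_antisymm (fun x hx => ?_) (iSup_le fun i => inf_le_left)
  refine mem_of_internalProj L.isInternal _ fun i => ?_
  exact Submodule.mem_iSup_of_mem i ⟨hN i x hx, _root_.internalProj_mem _ _ _⟩

/-! ### Superderivations of the supersymmetric algebra -/

/-- Superderivations of parity `p` of `S(g)` with prescribed values on `g`. -/
theorem exists_superDer (p : ZMod 2) (d : g →ₗ[ℂ] SuperSym L.parity)
    (hd : ∀ (i j : ZMod 2) (x y : g), x ∈ L.parity i → y ∈ L.parity j →
      d x * SuperSym.ι L.parity y = koszulSign (i + p) j • (SuperSym.ι L.parity y * d x)) :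
    ∃ D : SuperSym L.parity →ₗ[ℂ] SuperSym L.parity, D 1 = 0 ∧ ∀ x u,
      D (SuperSym.ι L.parity x * u) = d x * u + SuperSym.ι L.parity (L.twist p x) * D u := by
  let S := SuperSym L.parity
  let σ := SuperSym.ι L.parity
  -- Lower triangular matrices with `y` and its twist on the diagonal and `d y` below it. They
  -- supercommute by `hd`, so they extend to `S(g)`; the lower left entry of the extension is the
  -- superderivation.
  let f : g →ₗ[ℂ] Module.End ℂ (S × S) :=
    { toFun := fun y => LinearMap.prod (LinearMap.mulLeft ℂ (σ y) ∘ₗ LinearMap.fst ℂ S S)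
        (LinearMap.mulLeft ℂ (d y) ∘ₗ LinearMap.fst ℂ S S +
          LinearMap.mulLeft ℂ (σ (L.twist p y)) ∘ₗ LinearMap.snd ℂ S S)
      map_add' := fun x y => by
        refine LinearMap.ext fun u => Prod.ext ?_ ?_
        · simp [add_mul]
        · simp only [map_add, LinearMap.prod_apply, Function.prod, LinearMap.add_apply,
            LinearMap.comp_apply, LinearMap.mulLeft_apply, add_mul, LinearMap.fst_apply,
            LinearMap.snd_apply, Prod.snd_add]
          abel
      map_smul' := fun c x => by
        refine LinearMap.ext fun u => Prod.ext ?_ ?_ <;> simp }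
  have hf1 : ∀ y u, (f y u).1 = σ y * u.1 := fun y u => rfl
  have hf2 : ∀ y u, (f y u).2 = d y * u.1 + σ (L.twist p y) * u.2 := fun y u => rfl
  have hf : ∀ (i j : ZMod 2) (x y : g), x ∈ L.parity i → y ∈ L.parity j →
      f x * f y = koszulSign i j • (f y * f x) := by
    intro i j x y hx hy
    have hσ : σ x * σ y = koszulSign i j • (σ y * σ x) := SuperSym.ι_comm _ hx hy
    have h1 := hd i j x y hx hy
    have h2 := hd j i y x hy hx
    refine LinearMap.ext fun u => Prod.ext ?_ ?_
    · simp only [Module.End.mul_apply, LinearMap.smul_apply, Prod.smul_fst, hf1]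
      rw [← mul_assoc, ← mul_assoc, hσ, smul_mul_assoc]
    · simp only [Module.End.mul_apply, LinearMap.smul_apply, Prod.smul_snd, hf1, hf2,
        L.twist_of_mem hx, L.twist_of_mem hy, map_smul]
      have e1 : d x * (σ y * u.1) = koszulSign (i + p) j • (σ y * (d x * u.1)) := by
        rw [← mul_assoc, h1, smul_mul_assoc, mul_assoc]
      have e2 : d y * (σ x * u.1) = koszulSign (j + p) i • (σ x * (d y * u.1)) := by
        rw [← mul_assoc, h2, smul_mul_assoc, mul_assoc]
      have e3 : σ x * (σ y * u.2) = koszulSign i j • (σ y * (σ x * u.2)) := by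
        rw [← mul_assoc, hσ, smul_mul_assoc, mul_assoc]
      simp only [mul_add, smul_mul_assoc, mul_smul_comm, e1, e2, e3, smul_add, smul_smul,
        koszulSign_add_left]
      have k1 := koszulSign_mul_self i j
      rw [koszulSign_comm j i]
      have k2 : koszulSign i j * (koszulSign i j * koszulSign p i) = koszulSign p i := by
        rw [← mul_assoc, k1, one_mul]
      have k3 : koszulSign i j * koszulSign p j = koszulSign p j * koszulSign i j := mul_comm _ _
      rw [k2, k3]
      have k4 : koszulSign p i * koszulSign p j * koszulSign i j =
        koszulSign i j * koszulSign p j * koszulSign p i := by ring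
      module
  let H := SuperSym.lift f hf
  have hH : ∀ x, H (σ x) = f x := SuperSym.lift_ι f hf
  -- The first coordinate only sees multiplication, so the image of `(1, 0)` is `(u, D u)`.
  have hfst : ∀ u, (H u (1, 0)).1 = u := by
    intro u
    have : LinearMap.fst ℂ S S ∘ₗ LinearMap.applyₗ ((1, 0) : S × S) ∘ₗ H.toLinearMap =
        LinearMap.id := by
      refine SuperSym.linearMap_ext (by simp) fun x u hu => ?_
      simp only [LinearMap.comp_apply, AlgHom.toLinearMap_apply, map_mul, LinearMap.applyₗ_apply_apply,
        LinearMap.fst_apply, LinearMap.id_apply, Module.End.mul_apply] at hu ⊢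
      rw [hH, hf1, hu]
    exact LinearMap.congr_fun this u
  refine ⟨LinearMap.snd ℂ S S ∘ₗ LinearMap.applyₗ ((1, 0) : S × S) ∘ₗ H.toLinearMap, by simp, ?_⟩
  intro x u
  simp only [LinearMap.comp_apply, AlgHom.toLinearMap_apply, map_mul, LinearMap.applyₗ_apply_apply,
    LinearMap.snd_apply, Module.End.mul_apply]
  rw [hH, hf2, hfst]

/-! ### Homogeneous components of elements of the supersymmetric algebra -/

section Components

variable {L}
variable (h : SuperSym L.parity →ₐ[ℂ] AddMonoidAlgebra (SuperSym L.parity) ℤ)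

/-- The coefficient of `T^k` in the image under `h : S(g) → S(g)[T, T⁻¹]`. -/
def symComp (k : ℤ) : SuperSym L.parity →ₗ[ℂ] SuperSym L.parity where
  toFun u := (h u).coeff k
  map_add' u v := by simp
  map_smul' c u := by simp

theorem symComp_apply (k : ℤ) (u : SuperSym L.parity) : symComp h k u = (h u).coeff k := rfl

theorem symComp_one (k : ℤ) : symComp h k 1 = if k = 0 then 1 else 0 := by
  rw [symComp_apply, map_one, AddMonoidAlgebra.one_def, AddMonoidAlgebra.coeff_single,
    Finsupp.single_apply]
  simp [eq_comm]

variable {h} in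
theorem symComp_mul {w : ℤ} {x : g}
    (hx : h (SuperSym.ι L.parity x) = AddMonoidAlgebra.single w (SuperSym.ι L.parity x)) (k : ℤ)
    (u : SuperSym L.parity) :
    symComp h k (SuperSym.ι L.parity x * u) =
      SuperSym.ι L.parity x * symComp h (k - w) u := by
  rw [symComp_apply, map_mul, hx]
  have := AddMonoidAlgebra.coeff_single_mul_apply (h u) (SuperSym.ι L.parity x) w k
  rw [this, symComp_apply, neg_add_eq_sub]

/-- A superderivation of degree `s` shifts components by `s`. -/
theorem symComp_superDer {A : ℤ → Submodule ℂ g} (hA : ⨆ w, A w = ⊤)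
    (hh : ∀ w, ∀ x ∈ A w, h (SuperSym.ι L.parity x) =
      AddMonoidAlgebra.single w (SuperSym.ι L.parity x))
    (hpar : ∀ w i, ∀ x ∈ A w, internalProj L.isInternal i x ∈ A w)
    {p : ZMod 2} {s : ℤ} {d : g →ₗ[ℂ] SuperSym L.parity}
    {D : SuperSym L.parity →ₗ[ℂ] SuperSym L.parity} (h1 : D 1 = 0)
    (hD : ∀ x u, D (SuperSym.ι L.parity x * u) =
      d x * u + SuperSym.ι L.parity (L.twist p x) * D u)
    (hd : ∀ w, ∀ x ∈ A w, ∀ k u, symComp h k (d x * u) = d x * symComp h (k - w - s) u)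
    (k : ℤ) (u : SuperSym L.parity) : symComp h k (D u) = D (symComp h (k - s) u) := by
  suffices H : ∀ u : SuperSym L.parity,
      u ∈ ⨅ k, LinearMap.eqLocus (symComp h k ∘ₗ D) (D ∘ₗ symComp h (k - s)) by
    have := H u
    rw [Submodule.mem_iInf] at this
    exact this k
  refine SuperSym.mem_of_homogeneous_mul_mem hA _ ?_ ?_
  · rw [Submodule.mem_iInf]
    intro k
    simp only [LinearMap.mem_eqLocus, LinearMap.comp_apply, h1, map_zero, symComp_one]
    split <;> simp [h1]
  · intro w x hx u hu
    rw [Submodule.mem_iInf] at hu ⊢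
    intro k
    have hk := hu (k - w)
    simp only [LinearMap.mem_eqLocus, LinearMap.comp_apply] at hk ⊢
    rw [hD, map_add, hd w x hx, symComp_mul (hh _ _ (L.twist_mem (hpar w) p hx)), hk,
      symComp_mul (hh _ _ hx), hD, show k - w - s = k - s - w by ring]

/-- The components of elements of `S(N)` lie in `S(N)` for graded `N`. -/
theorem symComp_mem_symSub {A : ℤ → Submodule ℂ g} (hA : DirectSum.IsInternal A)
    (hh : ∀ w, ∀ x ∈ A w, h (SuperSym.ι L.parity x) =
      AddMonoidAlgebra.single w (SuperSym.ι L.parity x))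
    {N : Submodule ℂ g} (hN : ∀ w, ∀ x ∈ N, internalProj hA w x ∈ N)
    {u : SuperSym L.parity} (hu : u ∈ L.symSub N) (k : ℤ) : symComp h k u ∈ L.symSub N := by
  suffices H : u ∈ ⨅ k, (Subalgebra.toSubmodule (L.symSub N)).comap (symComp h k) by
    rw [Submodule.mem_iInf] at H
    exact H k
  refine adjoin_subset_of_mul_mem _ ?_ ?_ hu
  · rw [Submodule.mem_iInf]
    intro k
    rw [Submodule.mem_comap, symComp_one]
    split
    · exact one_mem (L.symSub N)
    · exact zero_mem (L.symSub N)
  · rintro _ ⟨x, hx, rfl⟩ u hu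
    rw [Submodule.mem_iInf] at hu ⊢
    intro k
    obtain ⟨s, hs⟩ := exists_internalProj_sum hA x
    rw [← hs, map_sum, Finset.sum_mul]
    refine sum_mem fun w _ => ?_
    rw [Submodule.mem_comap, symComp_mul (hh w _ (internalProj_mem hA w x))]
    exact (L.symSub N).mul_mem (Algebra.subset_adjoin ⟨_, hN w x hx, rfl⟩) (hu (k - w))

/-- The sum of the coefficients. -/
def coeffSum (L : LieSuperalgebra g) :
    AddMonoidAlgebra (SuperSym L.parity) ℤ →ₗ[ℂ] SuperSym L.parity where
  toFun u := u.coeff.sum fun _ v => v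
  map_add' u v := by
    rw [AddMonoidAlgebra.coeff_add, Finsupp.sum_add_index' (fun _ => rfl) (fun _ _ _ => rfl)]
  map_smul' c u := by
    rw [AddMonoidAlgebra.coeff_smul, Finsupp.sum_smul_index' (fun _ => rfl), Finsupp.smul_sum,
      RingHom.id_apply]

theorem coeffSum_single (w : ℤ) (s : SuperSym L.parity) :
    L.coeffSum (AddMonoidAlgebra.single w s) = s := by
  change Finsupp.sum (AddMonoidAlgebra.coeff (AddMonoidAlgebra.single w s)) (fun _ v => v) = s
  rw [AddMonoidAlgebra.coeff_single]
  exact Finsupp.sum_single_index rfl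

/-- Summing the coefficients is evaluation at `T = 1`. -/
theorem coeffSum_single_mul (w : ℤ) (s : SuperSym L.parity)
    (u : AddMonoidAlgebra (SuperSym L.parity) ℤ) :
    L.coeffSum (AddMonoidAlgebra.single w s * u) = s * L.coeffSum u := by
  induction u using AddMonoidAlgebra.induction_linear with
  | zero => simp
  | add u v hu hv => rw [mul_add, map_add, hu, hv, map_add, mul_add]
  | single k t => rw [AddMonoidAlgebra.single_mul_single, coeffSum_single, coeffSum_single]

/-- An element all of whose components vanish is zero. -/
theorem eq_zero_of_symComp {A : ℤ → Submodule ℂ g} (hA : ⨆ w, A w = ⊤)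
    (hh : ∀ w, ∀ x ∈ A w, h (SuperSym.ι L.parity x) =
      AddMonoidAlgebra.single w (SuperSym.ι L.parity x))
    {u : SuperSym L.parity} (hu : ∀ k, symComp h k u = 0) : u = 0 := by
  -- Since `h` sends `x` to `x T^w`, evaluation at `T = 1` recovers `u` from its components.
  have key : ∀ u, L.coeffSum (h u) = u := by
    intro u
    refine SuperSym.mem_of_homogeneous_mul_mem hA
      (LinearMap.eqLocus (L.coeffSum ∘ₗ h.toLinearMap) LinearMap.id) ?_ ?_ u
    · rw [LinearMap.mem_eqLocus, LinearMap.comp_apply, AlgHom.toLinearMap_apply, map_one,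
        AddMonoidAlgebra.one_def, coeffSum_single, LinearMap.id_apply]
    · intro w x hx u hu
      simp only [LinearMap.mem_eqLocus, LinearMap.comp_apply, AlgHom.toLinearMap_apply,
        LinearMap.id_apply] at hu ⊢
      rw [map_mul, hh w x hx, coeffSum_single_mul, hu]
  have h0 : h u = 0 := AddMonoidAlgebra.ext (Finsupp.ext fun k => hu k)
  rw [← key u, h0, map_zero]

/-- The elements whose components of degree greater than `k` vanish. -/
def symFil (k : ℤ) : Submodule ℂ (SuperSym L.parity) :=
  ⨅ l : ℤ, ⨅ _ : k < l, LinearMap.ker (symComp h l)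

variable {h} in
theorem mem_symFil {k : ℤ} {u : SuperSym L.parity} :
    u ∈ symFil h k ↔ ∀ l, k < l → symComp h l u = 0 := by
  simp [symFil]

theorem symFil_mono {k k' : ℤ} (hk : k ≤ k') : symFil h k ≤ symFil h k' := fun _ hu =>
  mem_symFil.mpr fun l hl => mem_symFil.mp hu l (hk.trans_lt hl)

theorem one_mem_symFil : (1 : SuperSym L.parity) ∈ symFil h 0 :=
  mem_symFil.mpr fun l hl => by rw [symComp_one, if_neg hl.ne']

theorem exists_mem_symFil (u : SuperSym L.parity) : ∃ n : ℕ, u ∈ symFil h n := by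
  obtain ⟨n, hn⟩ := (h u).coeff.support.exists_le
  refine ⟨n.toNat, mem_symFil.mpr fun l hl => ?_⟩
  by_contra h0
  have := hn l (Finsupp.mem_support_iff.mpr h0)
  omega

variable {h} in
theorem mem_symFil_of_shift {T : SuperSym L.parity → SuperSym L.parity} (hT0 : T 0 = 0) {s : ℤ}
    (hT : ∀ k u, symComp h k (T u) = T (symComp h (k - s) u)) {k : ℤ} {u : SuperSym L.parity}
    (hu : u ∈ symFil h k) : T u ∈ symFil h (k + s) :=
  mem_symFil.mpr fun l hl => by rw [hT, mem_symFil.mp hu _ (by omega), hT0]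

end Components

end LieSuperalgebra

namespace LieSuperalgebra

variable {g : Type*} [AddCommGroup g] [Module ℂ g]

/-! ### Curvature of a linear map from a Lie superalgebra to operators -/

section Curvature

variable {M : Type*} [AddCommGroup M] [Module ℂ M]

/-- The failure of `ρ` to be compatible with the bracket of `x` and `y`, where `s` is the Koszul
sign of the pair. -/
def curv (L : LieSuperalgebra g) (ρ : g →ₗ[ℂ] Module.End ℂ M) (s : ℂ) (x y : g) :
    Module.End ℂ M :=
  ρ x * ρ y - s • (ρ y * ρ x) - ρ (L.bracket x y)

variable (L : LieSuperalgebra g) (ρ : g →ₗ[ℂ] Module.End ℂ M)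

theorem curv_apply (s : ℂ) (x y : g) (f : M) :
    L.curv ρ s x y f = ρ x (ρ y f) - s • ρ y (ρ x f) - ρ (L.bracket x y) f := rfl

theorem curv_add_left (s : ℂ) (x x' y : g) :
    L.curv ρ s (x + x') y = L.curv ρ s x y + L.curv ρ s x' y := by
  simp only [curv, map_add, add_mul, mul_add, smul_add, LinearMap.add_apply]
  abel

theorem curv_add_right (s : ℂ) (x y y' : g) :
    L.curv ρ s x (y + y') = L.curv ρ s x y + L.curv ρ s x y' := by
  simp only [curv, map_add, add_mul, mul_add, smul_add]
  abel

theorem curv_smul_right (s c : ℂ) (x y : g) :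
    L.curv ρ s x (c • y) = c • L.curv ρ s x y := by
  simp only [curv, map_smul, mul_smul_comm, smul_mul_assoc, smul_sub]
  rw [smul_comm s c]

theorem curv_sum_right {β : Type*} (t : Finset β) (s : ℂ) (x : g) (y : β → g) :
    L.curv ρ s x (∑ b ∈ t, y b) = ∑ b ∈ t, L.curv ρ s x (y b) := by
  classical
  induction t using Finset.induction_on with
  | empty => simp [curv]
  | insert a t ha ih => rw [Finset.sum_insert ha, Finset.sum_insert ha, curv_add_right, ih]

variable {L}

theorem curv_swap {i j : ZMod 2} {x y : g} (hx : x ∈ L.parity i) (hy : y ∈ L.parity j) :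
    L.curv ρ (koszulSign j i) y x = -(koszulSign i j • L.curv ρ (koszulSign i j) x y) := by
  have h := koszulSign_mul_self i j
  simp only [curv, koszulSign_comm j i, L.skew j i y hy x hx, map_neg, map_smul, smul_sub, smul_smul,
    h, one_smul]
  abel

/-- The Bianchi identity. -/
theorem curv_bianchi {i j k : ZMod 2} {x y z : g} (hx : x ∈ L.parity i) (hy : y ∈ L.parity j)
    (hz : z ∈ L.parity k) :
    koszulSign k i • (L.curv ρ (koszulSign i j) x y * ρ z -
        (koszulSign i k * koszulSign j k) • (ρ z * L.curv ρ (koszulSign i j) x y) +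
        L.curv ρ (koszulSign (i + j) k) (L.bracket x y) z) +
      koszulSign i j • (L.curv ρ (koszulSign j k) y z * ρ x -
        (koszulSign j i * koszulSign k i) • (ρ x * L.curv ρ (koszulSign j k) y z) +
        L.curv ρ (koszulSign (j + k) i) (L.bracket y z) x) +
      koszulSign j k • (L.curv ρ (koszulSign k i) z x * ρ y -
        (koszulSign k j * koszulSign i j) • (ρ y * L.curv ρ (koszulSign k i) z x) +
        L.curv ρ (koszulSign (k + i) j) (L.bracket z x) y) = 0 := by
  -- The Jacobi identity in cyclic form. It is the only property of the bracket besides skewness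
  -- that the identity needs.
  have jac : koszulSign k i • L.bracket (L.bracket x y) z +
      koszulSign i j • L.bracket (L.bracket y z) x +
      koszulSign j k • L.bracket (L.bracket z x) y = 0 := by
    have h1 := L.jacobi i j x hx y hy z
    have h2 := L.skew _ _ _ (L.bracket_mem j k y hy z hz) x hx
    have h3 := L.skew _ _ _ (L.bracket_mem k i z hz x hx) y hy
    have h4 := L.skew k i z hz x hx
    rw [h2, h3, h4]
    simp only [map_neg, map_smul]
    rw [h1]
    simp only [koszulSign_add_left, koszulSign_comm k i, koszulSign_comm j i, koszulSign_comm k j]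
    rcases zmod_two_cases i with rfl | rfl <;> rcases zmod_two_cases j with rfl | rfl <;>
      rcases zmod_two_cases k with rfl | rfl <;> simp
  have jac' := congrArg ρ jac
  simp only [map_add, map_smul, map_zero] at jac'
  -- Triple products cancel cyclically and the mixed products cancel in pairs; what is left is minus
  -- `ρ` of the Jacobi sum.
  refine Eq.trans ?_ (neg_eq_zero.mpr jac')
  simp only [curv, koszulSign_add_left, koszulSign_comm k i, koszulSign_comm j i,
    koszulSign_comm k j]
  rcases zmod_two_cases i with rfl | rfl <;> rcases zmod_two_cases j with rfl | rfl <;>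
      rcases zmod_two_cases k with rfl | rfl <;>
      simp only [koszulSign_one_one, koszulSign_zero_left, koszulSign_zero_right, one_smul, neg_smul,
        mul_one, mul_neg, neg_neg] <;>
      noncomm_ring

/-- If `ρ` has the leading term `Λ` and leading terms commute, the curvature is of lower order. -/
theorem curv_mem_of_leading (G : ℤ → Submodule ℂ M) (Λ : g → Module.End ℂ M) {a b : ℤ}
    {x y : g} {s : ℂ} (hax : ∀ k, ∀ f ∈ G k, Λ x f ∈ G (k + a))
    (hby : ∀ k, ∀ f ∈ G k, Λ y f ∈ G (k + b))
    (hrx : ∀ k, ∀ f ∈ G k, ρ x f - Λ x f ∈ G (k + a - 1))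
    (hry : ∀ k, ∀ f ∈ G k, ρ y f - Λ y f ∈ G (k + b - 1))
    (hmono : ∀ k, G (k - 1) ≤ G k)
    (hcomm : ∀ f, Λ x (Λ y f) = s • Λ y (Λ x f))
    (hxy : ∀ k, ∀ f ∈ G k, ρ (L.bracket x y) f ∈ G (k + a + b - 1)) {k : ℤ} {f : M}
    (hf : f ∈ G k) : L.curv ρ s x y f ∈ G (k + a + b - 1) := by
  -- Expanding `ρ = Λ + (ρ - Λ)` in both factors, every term except `Λ x Λ y` loses at least one
  -- degree.
  have key : ∀ (x y : g) (a b : ℤ) (_ : ∀ k, ∀ f ∈ G k, Λ x f ∈ G (k + a))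
      (_ : ∀ k, ∀ f ∈ G k, Λ y f ∈ G (k + b)) (_ : ∀ k, ∀ f ∈ G k, ρ x f - Λ x f ∈ G (k + a - 1))
      (_ : ∀ k, ∀ f ∈ G k, ρ y f - Λ y f ∈ G (k + b - 1)),
      ρ x (ρ y f) - Λ x (Λ y f) ∈ G (k + a + b - 1) := by
    intro x y a b hax hby hrx hry
    have h1 := hrx _ _ (hby k f hf)
    have h2 := hrx _ _ (hry k f hf)
    have h3 := hax _ _ (hry k f hf)
    rw [show k + b + a - 1 = k + a + b - 1 by ring] at h1
    rw [show k + b - 1 + a = k + a + b - 1 by ring] at h2 h3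
    have h4 := add_mem (add_mem h1 (hmono _ h2)) h3
    simp only [map_sub] at h4
    convert h4 using 1
    abel
  have h1 := key x y a b hax hby hrx hry
  have h2 := key y x b a hby hax hry hrx
  rw [show k + b + a - 1 = k + a + b - 1 by ring] at h2
  have h3 := sub_mem (sub_mem h1 ((G _).smul_mem s h2)) (hxy k f hf)
  rw [hcomm] at h3
  rw [curv_apply]
  convert h3 using 1
  rw [smul_sub]
  abel

end Curvature

/-! ### The Poincaré-Birkhoff-Witt theorem -/

/-- The data for the construction of a `g`-module with given leading terms: a projection `pr` of `g`
whose kernel is a subalgebra with character `χ`, multiplication operators and contraction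
operators on `M`, the filtration `F` by the polynomial degree and a second filtration `K`. -/
structure PBWData (L : LieSuperalgebra g) (χ : Module.Dual ℂ g) (M : Type*) [AddCommGroup M]
    [Module ℂ M] (β : Type*) [Fintype β] where
  /-- the projection -/
  pr : g →ₗ[ℂ] g
  pr_parity : ∀ i, ∀ x ∈ L.parity i, pr x ∈ L.parity i
  pr_pr : ∀ x, pr (pr x) = pr x
  pr_bracket : ∀ x y, pr x = 0 → pr y = 0 → pr (L.bracket x y) = 0
  χ_bracket : ∀ x y, pr x = 0 → pr y = 0 → χ (L.bracket x y) = 0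
  χ_odd : ∀ x ∈ L.parity 1, χ x = 0
  /-- multiplication operators -/
  mulL : g →ₗ[ℂ] Module.End ℂ M
  mulL_comm : ∀ i j, ∀ x ∈ L.parity i, ∀ y ∈ L.parity j, ∀ f,
    mulL x (mulL y f) = koszulSign i j • mulL y (mulL x f)
  /-- a spanning set of the image of `pr` -/
  e : β → g
  /-- parities -/
  par : β → ZMod 2
  e_mem : ∀ b, e b ∈ L.parity (par b)
  pr_e : ∀ b, pr (e b) = e b
  /-- coordinates -/
  c : β → Module.Dual ℂ g
  c_parity : ∀ b j, ∀ y ∈ L.parity j, j ≠ par b → c b y = 0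
  sum_c : ∀ y, ∑ b, c b y • e b = pr y
  /-- contraction operators -/
  contr : β → Module.End ℂ M
  contr_mulL : ∀ b j, ∀ y ∈ L.parity j, ∀ f,
    contr b (mulL y f) = c b y • f + koszulSign (par b) j • mulL y (contr b f)
  /-- the filtration by polynomial degree -/
  F : ℤ → Submodule ℂ M
  F_mono : ∀ k, F (k - 1) ≤ F k
  F_neg : F (-1) = ⊥
  F_mulL : ∀ k x, ∀ f ∈ F k, mulL (pr x) f ∈ F (k + 1)
  F_contr : ∀ k b, ∀ f ∈ F k, contr b f ∈ F (k - 1)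
  F_euler : ∀ k, ∀ f ∈ F k, ∑ b, mulL (e b) (contr b f) - (k : ℂ) • f ∈ F (k - 1)
  F_exists : ∀ f, ∃ n : ℕ, f ∈ F n
  /-- weights in `g` -/
  A : ℤ → Submodule ℂ g
  A_parity : ∀ w i, ∀ x ∈ A w, internalProj L.isInternal i x ∈ A w
  A_bracket : ∀ w w', ∀ x ∈ A w, ∀ y ∈ A w', L.bracket x y ∈ A (w + w' - 2)
  χ_A : ∀ w, w ≠ 0 → ∀ x ∈ A w, χ x = 0
  /-- weights of the spanning set -/
  wt : β → ℤ
  e_wt : ∀ b, e b ∈ A (wt b)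
  /-- the second filtration -/
  K : ℤ → Submodule ℂ M
  K_mono : ∀ k, K (k - 1) ≤ K k
  K_mulL : ∀ k w, ∀ x ∈ A w, ∀ f ∈ K k, mulL (pr x) f ∈ K (k + w)
  K_contr : ∀ k b, ∀ f ∈ K k, contr b f ∈ K (k - wt b)

namespace PBWData

variable {L : LieSuperalgebra g} {χ : Module.Dual ℂ g} {M : Type*} [AddCommGroup M] [Module ℂ M]
  {β : Type*} [Fintype β] (D : L.PBWData χ M β)

/-- Approximate representations: the curvature vanishes in degrees less than `n`. -/
structure Approx (n : ℕ) (ρ : g →ₗ[ℂ] Module.End ℂ M) : Prop where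
  low : ∀ k x, ∀ f ∈ D.F k, ρ x f - D.mulL (D.pr x) f ∈ D.F k
  kaz : ∀ k w, ∀ x ∈ D.A w, ∀ f ∈ D.K k, ρ x f - (D.mulL (D.pr x) f + χ x • f) ∈ D.K (k + w - 1)
  curv_eq_zero : ∀ i j, ∀ x ∈ L.parity i, ∀ y ∈ L.parity j, ∀ f ∈ D.F (n - 1),
    L.curv ρ (koszulSign i j) x y f = 0
  base : ∀ x, ∀ f ∈ D.F 0, ρ x f = D.mulL (D.pr x) f + χ x • f

/-- The leading term. -/
def lead : g →ₗ[ℂ] Module.End ℂ M := D.mulL ∘ₗ D.pr + χ.smulRight (1 : Module.End ℂ M)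

theorem lead_apply (x : g) (f : M) : D.lead x f = D.mulL (D.pr x) f + χ x • f := by
  simp [lead]

theorem koszulSign_mul_χ (D : L.PBWData χ M β) {i j : ZMod 2} {x : g} (hx : x ∈ L.parity i) :
    koszulSign i j * χ x = χ x := by
  rcases zmod_two_cases i with rfl | rfl
  · simp
  · simp [D.χ_odd x hx]

theorem lead_comm {i j : ZMod 2} {x y : g} (hx : x ∈ L.parity i) (hy : y ∈ L.parity j) (f : M) :
    D.lead x (D.lead y f) = koszulSign i j • D.lead y (D.lead x f) := by
  have h1 := D.mulL_comm i j _ (D.pr_parity i x hx) _ (D.pr_parity j y hy) f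
  have h2 := D.koszulSign_mul_χ (j := j) hx
  have h3 := D.koszulSign_mul_χ (j := i) hy
  rw [koszulSign_comm] at h3
  simp only [lead_apply, map_add, map_smul, smul_add, smul_smul, h1, h2, h3, ← mul_assoc]
  rw [mul_comm (χ y)]
  abel

theorem lead_K {k w : ℤ} {x : g} (hx : x ∈ D.A w) {f : M} (hf : f ∈ D.K k) :
    D.lead x f ∈ D.K (k + w) := by
  rw [lead_apply]
  refine add_mem (D.K_mulL k w x hx f hf) ?_
  by_cases h : w = 0
  · subst h; rw [add_zero]; exact Submodule.smul_mem _ _ hf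
  · rw [D.χ_A w h x hx, zero_smul]; exact zero_mem _

/-- The start of the approximation: `F (-1) = 0`, so no condition is imposed on the curvature yet.
-/
theorem approx_zero : D.Approx 0 D.lead where
  low k x f hf := by
    rw [lead_apply, add_sub_cancel_left]; exact Submodule.smul_mem _ _ hf
  kaz k w x _ f _ := by rw [lead_apply, sub_self]; exact zero_mem _
  curv_eq_zero i j x _ y _ f hf := by
    have : f = 0 := by
      simpa [D.F_neg] using hf
    rw [this, map_zero]
  base x f _ := D.lead_apply x f

variable {D} {n : ℕ} {ρ : g →ₗ[ℂ] Module.End ℂ M}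

namespace Approx

variable (h : D.Approx n ρ)

include h

theorem mem_F {k : ℤ} {x : g} {f : M} (hf : f ∈ D.F k) : ρ x f ∈ D.F (k + 1) := by
  have h1 := D.F_mono (k + 1)
  rw [add_sub_cancel_right] at h1
  have := add_mem (h1 (h.low k x f hf)) (D.F_mulL k x f hf)
  rwa [sub_add_cancel] at this

theorem mem_K {k w : ℤ} {x : g} (hx : x ∈ D.A w) {f : M} (hf : f ∈ D.K k) :
    ρ x f ∈ D.K (k + w) := by
  have := add_mem (D.K_mono _ (h.kaz k w x hx f hf)) (D.lead_K hx hf)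
  rwa [lead_apply, sub_add_cancel] at this

theorem curv_mem_F {i j : ZMod 2} {x y : g} (hx : x ∈ L.parity i) (hy : y ∈ L.parity j) {k : ℤ}
    {f : M} (hf : f ∈ D.F k) : L.curv ρ (koszulSign i j) x y f ∈ D.F (k + 1) := by
  have := curv_mem_of_leading (L := L) ρ D.F (D.mulL ∘ₗ D.pr) (a := 1) (b := 1) (x := x) (y := y)
    (s := koszulSign i j)
    (fun k f hf => D.F_mulL k x f hf) (fun k f hf => D.F_mulL k y f hf)
    (fun k f hf => by simpa using h.low k x f hf) (fun k f hf => by simpa using h.low k y f hf)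
    D.F_mono (fun f => D.mulL_comm i j _ (D.pr_parity i x hx) _ (D.pr_parity j y hy) f)
    (fun k f hf => by simpa using h.mem_F hf) hf
  simpa using this

theorem curv_mem_K {i j : ZMod 2} {x y : g} (hx : x ∈ L.parity i) (hy : y ∈ L.parity j)
    {w w' : ℤ} (hxw : x ∈ D.A w) (hyw : y ∈ D.A w') {k : ℤ}
    {f : M} (hf : f ∈ D.K k) : L.curv ρ (koszulSign i j) x y f ∈ D.K (k + w + w' - 1) := by
  refine curv_mem_of_leading (L := L) ρ D.K D.lead
    (fun k f hf => D.lead_K hxw hf) (fun k f hf => D.lead_K hyw hf)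
    (fun k f hf => by rw [lead_apply]; exact h.kaz k w x hxw f hf)
    (fun k f hf => by rw [lead_apply]; exact h.kaz k w' y hyw f hf)
    D.K_mono (fun f => D.lead_comm hx hy f) (fun k f hf => ?_) hf
  -- The bracket has weight `w + w' - 2`, one less than is needed here.
  simpa using D.K_mono _ (by
    simpa only [show k + (w + w' - 2) = k + w + w' - 1 - 1 by ring] using
      h.mem_K (D.A_bracket w w' x hxw y hyw) hf)

/-- The Bianchi identity applied to `f` of degree `n - 1`: every curvature acting directly on `f`
vanishes, and `ρ z f` may be replaced by its leading term because the difference stays in degree `n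
- 1`. -/
theorem curv_cyclic {i j k : ZMod 2} {x y z : g} (hx : x ∈ L.parity i) (hy : y ∈ L.parity j)
    (hz : z ∈ L.parity k) {f : M} (hf : f ∈ D.F (n - 1)) :
    koszulSign k i • L.curv ρ (koszulSign i j) x y (D.mulL (D.pr z) f) +
      koszulSign i j • L.curv ρ (koszulSign j k) y z (D.mulL (D.pr x) f) +
      koszulSign j k • L.curv ρ (koszulSign k i) z x (D.mulL (D.pr y) f) = 0 := by
  have key : ∀ (i j : ZMod 2) (x y z : g) (_ : x ∈ L.parity i) (_ : y ∈ L.parity j),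
      L.curv ρ (koszulSign i j) x y (ρ z f) =
        L.curv ρ (koszulSign i j) x y (D.mulL (D.pr z) f) := by
    intro i j x y z hx hy
    rw [← sub_eq_zero, ← map_sub]
    exact h.curv_eq_zero i j x hx y hy _ (h.low _ z f hf)
  have hb := LinearMap.congr_fun (curv_bianchi ρ hx hy hz) f
  simp only [LinearMap.add_apply, LinearMap.smul_apply, LinearMap.sub_apply,
    Module.End.mul_apply, LinearMap.zero_apply] at hb
  rw [h.curv_eq_zero i j x hx y hy f hf, h.curv_eq_zero j k y hy z hz f hf,
    h.curv_eq_zero k i z hz x hx f hf,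
    h.curv_eq_zero _ _ _ (L.bracket_mem i j x hx y hy) _ hz f hf,
    h.curv_eq_zero _ _ _ (L.bracket_mem j k y hy z hz) _ hx f hf,
    h.curv_eq_zero _ _ _ (L.bracket_mem k i z hz x hx) _ hy f hf,
    key i j x y z hx hy, key j k y z x hy hz, key k i z x y hz hx] at hb
  simpa using hb

/-- By Euler's formula the sum of the `e b · contr b` acts on `F n` as `n` up to `F (n - 1)`, which
the curvature kills. -/
theorem curv_euler {i j : ZMod 2} {x y : g} (hx : x ∈ L.parity i) (hy : y ∈ L.parity j)
    {f : M} (hf : f ∈ D.F n) :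
    ∑ b, L.curv ρ (koszulSign i j) x y (D.mulL (D.e b) (D.contr b f)) =
      (n : ℂ) • L.curv ρ (koszulSign i j) x y f := by
  rw [← map_sum, ← map_smul, ← sub_eq_zero, ← map_sub]
  refine h.curv_eq_zero i j x hx y hy _ ?_
  simpa using D.F_euler n f hf

end Approx

variable (D ρ) in
/-- `x ↦ [ρ x, ρ (e b)] - ρ [x, e b]` -/
def curvE (b : β) : g →ₗ[ℂ] Module.End ℂ M :=
  LinearMap.mulRight ℂ (ρ (D.e b)) ∘ₗ ρ -
    LinearMap.mulLeft ℂ (ρ (D.e b)) ∘ₗ ρ ∘ₗ L.twist (D.par b) - ρ ∘ₗ L.bracket.flip (D.e b)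

/-- The twist encodes the Koszul sign, which depends on the parity of `x`; this is what allows
`curvE` to be linear in `x`. -/
theorem curvE_of_mem (b : β) {i : ZMod 2} {x : g} (hx : x ∈ L.parity i) :
    D.curvE ρ b x = L.curv ρ (koszulSign i (D.par b)) x (D.e b) := by
  simp [curvE, curv, L.twist_of_mem hx, koszulSign_comm i]

variable (D ρ) in
/-- The contraction of the curvature with the contraction operators. -/
def homotopy : g →ₗ[ℂ] Module.End ℂ M :=
  ∑ b, LinearMap.mulRight ℂ (D.contr b) ∘ₗ D.curvE ρ b

theorem homotopy_apply (x : g) (f : M) :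
    D.homotopy ρ x f = ∑ b, D.curvE ρ b x (D.contr b f) := by
  simp [homotopy, LinearMap.sum_apply]

/-- The Leibniz rule for the contractions: the terms in which `y` itself is contracted add up to `pr
y`. -/
theorem homotopy_mulL {i j : ZMod 2} {x y : g} (hx : x ∈ L.parity i) (hy : y ∈ L.parity j)
    (f : M) : D.homotopy ρ x (D.mulL y f) = L.curv ρ (koszulSign i j) x (D.pr y) f +
      ∑ b, koszulSign (D.par b) j •
        L.curv ρ (koszulSign i (D.par b)) x (D.e b) (D.mulL y (D.contr b f)) := by
  rw [homotopy_apply, ← D.sum_c y, curv_sum_right, LinearMap.sum_apply, ← Finset.sum_add_distrib]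
  refine Finset.sum_congr rfl fun b _ => ?_
  rw [curvE_of_mem b hx, D.contr_mulL b j y hy, map_add, map_smul, map_smul, curv_smul_right,
    LinearMap.smul_apply]
  by_cases hj : j = D.par b
  · rw [hj]
  · rw [D.c_parity b j y hy hj]; simp

namespace Approx

variable (h : D.Approx n ρ)

include h

/-- Contracting the new factor gives the curvature twice, once from each term. The remaining terms
combine by `curv_cyclic` into curvatures applied to `e b · contr b f`, and these sum to `n` times
the curvature by `curv_euler`. -/
theorem homotopy_of_pr {i j : ZMod 2} {x y : g} (hx : x ∈ L.parity i) (hy : y ∈ L.parity j)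
    (hpx : D.pr x = x) (hpy : D.pr y = y) {f : M} (hf : f ∈ D.F n) :
    D.homotopy ρ x (D.mulL y f) - koszulSign i j • D.homotopy ρ y (D.mulL x f) =
      ((n : ℂ) + 2) • L.curv ρ (koszulSign i j) x y f := by
  rw [homotopy_mulL hx hy, homotopy_mulL hy hx, hpx, hpy, curv_swap ρ hx hy, add_smul,
    ← h.curv_euler hx hy hf]
  have key : ∀ b, L.curv ρ (koszulSign i j) x y (D.mulL (D.e b) (D.contr b f)) =
      koszulSign (D.par b) j •
        L.curv ρ (koszulSign i (D.par b)) x (D.e b) (D.mulL y (D.contr b f)) -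
      koszulSign i j • (koszulSign (D.par b) i •
        L.curv ρ (koszulSign j (D.par b)) y (D.e b) (D.mulL x (D.contr b f))) := by
    intro b
    have hc := h.curv_cyclic hx hy (D.e_mem b) (D.F_contr n b f hf)
    rw [hpx, hpy, D.pr_e, curv_swap ρ hx (D.e_mem b)] at hc
    have h1 := koszulSign_mul_self (D.par b) i
    have hc' := congrArg (koszulSign (D.par b) i • ·) hc
    simp only [smul_add, smul_smul, h1, one_smul, smul_zero, LinearMap.neg_apply,
      LinearMap.smul_apply, smul_neg] at hc'
    rw [koszulSign_comm i (D.par b), koszulSign_comm j (D.par b)] at *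
    rw [show koszulSign (D.par b) i * (koszulSign (D.par b) j * koszulSign (D.par b) i) =
      koszulSign (D.par b) j by rw [mul_left_comm, h1, mul_one]] at hc'
    rw [← sub_eq_zero, ← hc', smul_smul, mul_comm (koszulSign i j)]
    abel
  rw [Finset.sum_congr rfl fun b _ => key b, Finset.sum_sub_distrib, ← Finset.smul_sum]
  simp only [LinearMap.neg_apply, LinearMap.smul_apply, smul_add, smul_neg, smul_smul,
    koszulSign_mul_self]
  module

/-- The same computation with `pr x = 0`: the symmetric counterpart is absent, so the curvature
arises `1 + n` times instead of `2 + n` times. -/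
theorem homotopy_of_ker {i j : ZMod 2} {x y : g} (hx : x ∈ L.parity i) (hy : y ∈ L.parity j)
    (hpx : D.pr x = 0) (hpy : D.pr y = y) {f : M} (hf : f ∈ D.F n) :
    D.homotopy ρ x (D.mulL y f) = ((n : ℂ) + 1) • L.curv ρ (koszulSign i j) x y f := by
  rw [homotopy_mulL hx hy, hpy, add_smul, ← h.curv_euler hx hy hf, one_smul, add_comm]
  congr 1
  refine Finset.sum_congr rfl fun b _ => ?_
  have hc := h.curv_cyclic hx hy (D.e_mem b) (D.F_contr n b f hf)
  rw [hpx, hpy, D.pr_e, curv_swap ρ hx (D.e_mem b)] at hc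
  have h1 := koszulSign_mul_self (D.par b) i
  have hc' := congrArg (koszulSign (D.par b) i • ·) hc
  simp only [smul_add, smul_smul, h1, one_smul, smul_zero, LinearMap.neg_apply,
    LinearMap.smul_apply, smul_neg, map_zero, LinearMap.zero_apply, add_zero] at hc'
  rw [koszulSign_comm i (D.par b), koszulSign_comm j (D.par b)] at *
  rw [show koszulSign (D.par b) i * (koszulSign (D.par b) j * koszulSign (D.par b) i) =
    koszulSign (D.par b) j by rw [mul_left_comm, h1, mul_one]] at hc'
  rw [← sub_eq_zero, ← neg_eq_zero, ← hc']
  abel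

/-- Between two elements of the kernel there is nothing to correct. In degree `0` both act by the
character `χ`, which vanishes on brackets of kernel elements; in degree `n > 0` only one term of the
cyclic identity survives, so Euler's formula shows that `n` times the curvature is zero. -/
theorem curv_of_ker {i j : ZMod 2} {x y : g} (hx : x ∈ L.parity i) (hy : y ∈ L.parity j)
    (hpx : D.pr x = 0) (hpy : D.pr y = 0) {f : M} (hf : f ∈ D.F n) :
    L.curv ρ (koszulSign i j) x y f = 0 := by
  rcases Nat.eq_zero_or_pos n with rfl | hn
  · have hf0 : f ∈ D.F 0 := by simpa using hf
    have hb : ∀ x, D.pr x = 0 → ρ x f = χ x • f := fun x hx => by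
      rw [h.base x f hf0, hx]; simp
    rw [curv_apply, hb y hpy, hb x hpx, map_smul, map_smul, hb x hpx, hb y hpy,
      hb _ (D.pr_bracket x y hpx hpy), D.χ_bracket x y hpx hpy, smul_smul, smul_smul, smul_smul,
      D.koszulSign_mul_χ (j := j) hx, mul_comm (χ y)]
    simp
  · have h1 := h.curv_euler hx hy hf
    have h2 : ∀ b, L.curv ρ (koszulSign i j) x y (D.mulL (D.e b) (D.contr b f)) = 0 := by
      intro b
      have hc := h.curv_cyclic hx hy (D.e_mem b) (D.F_contr n b f hf)
      rw [hpx, hpy, D.pr_e] at hc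
      have hc' := congrArg (koszulSign (D.par b) i • ·) hc
      simpa only [smul_add, smul_smul, koszulSign_mul_self, one_smul, smul_zero, map_zero,
        LinearMap.zero_apply, add_zero] using hc'
    rw [Finset.sum_eq_zero fun b _ => h2 b] at h1
    exact (smul_eq_zero.mp h1.symm).resolve_left (Nat.cast_ne_zero.mpr hn.ne')

end Approx

end PBWData

end LieSuperalgebra

/-! ### The improvement step and the limit of the approximations -/

namespace LieSuperalgebra

variable {g : Type*} [AddCommGroup g] [Module ℂ g]

namespace PBWData

variable {L : LieSuperalgebra g} {χ : Module.Dual ℂ g} {M : Type*} [AddCommGroup M] [Module ℂ M]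
  {β : Type*} [Fintype β] {D : L.PBWData χ M β} {n : ℕ} {ρ : g →ₗ[ℂ] Module.End ℂ M}

namespace Approx

variable (h : D.Approx n ρ)

include h

/-- Contraction drops `f` to degree `n - 1`, where the curvature already vanishes. Hence a
correction by the homotopy does not disturb what has been achieved. -/
theorem homotopy_eq_zero (x : g) {f : M} (hf : f ∈ D.F n) : D.homotopy ρ x f = 0 := by
  rw [homotopy_apply]
  refine Finset.sum_eq_zero fun b _ => ?_
  refine L.mem_of_parity (LinearMap.ker (LinearMap.applyₗ (D.contr b f) ∘ₗ D.curvE ρ b)) ?_ x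
  intro i x hx
  rw [LinearMap.mem_ker, LinearMap.comp_apply, LinearMap.applyₗ_apply_apply, curvE_of_mem b hx]
  exact h.curv_eq_zero _ _ x hx _ (D.e_mem b) _ (D.F_contr n b f hf)

theorem homotopy_mem_F (x : g) {k : ℤ} {f : M} (hf : f ∈ D.F k) : D.homotopy ρ x f ∈ D.F k := by
  rw [homotopy_apply]
  refine sum_mem fun b _ => ?_
  refine L.mem_of_parity ((D.F k).comap (LinearMap.applyₗ (D.contr b f) ∘ₗ D.curvE ρ b)) ?_ x
  intro i x hx
  rw [Submodule.mem_comap, LinearMap.comp_apply, LinearMap.applyₗ_apply_apply, curvE_of_mem b hx]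
  simpa using h.curv_mem_F hx (D.e_mem b) (D.F_contr k b f hf)

/-- The contraction lowers the weight by `wt b`, the curvature raises it by at most `w + wt b - 1`;
so the correction keeps the leading term for the filtration `K`. -/
theorem homotopy_mem_K {w : ℤ} {x : g} (hx : x ∈ D.A w) {k : ℤ} {f : M} (hf : f ∈ D.K k) :
    D.homotopy ρ x f ∈ D.K (k + w - 1) := by
  have key : ∀ i, ∀ x ∈ D.A w, x ∈ L.parity i → D.homotopy ρ x f ∈ D.K (k + w - 1) := by
    intro i x hxw hx
    rw [homotopy_apply]
    refine sum_mem fun b _ => ?_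
    rw [curvE_of_mem b hx]
    have := h.curv_mem_K hx (D.e_mem b) hxw (D.e_wt b) (D.K_contr k b f hf)
    rwa [show k - D.wt b + w + D.wt b - 1 = k + w - 1 by ring] at this
  rw [← L.sum_internalProj_parity x, map_add, LinearMap.add_apply]
  exact add_mem (key 0 _ (D.A_parity w 0 x hx) (_root_.internalProj_mem _ _ _))
    (key 1 _ (D.A_parity w 1 x hx) (_root_.internalProj_mem _ _ _))

/-- An approximate representation can be improved. -/
theorem exists_succ (hpA : ∀ w, ∀ x ∈ D.A w, D.pr x ∈ D.A w) :
    ∃ ρ' : g →ₗ[ℂ] Module.End ℂ M, D.Approx (n + 1) ρ' ∧ ∀ x, ∀ f ∈ D.F n, ρ' x f = ρ x f := by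
  -- The factors invert the constants of `homotopy_of_pr` and `homotopy_of_ker`: `n + 2` on the
  -- image of `pr`, `n + 1` on its kernel.
  let a : g →ₗ[ℂ] g := ((n : ℂ) + 2)⁻¹ • D.pr + ((n : ℂ) + 1)⁻¹ • (LinearMap.id - D.pr)
  let ρ' : g →ₗ[ℂ] Module.End ℂ M := ρ - D.homotopy ρ ∘ₗ a
  have hρ' : ∀ x f, ρ' x f = ρ x f - D.homotopy ρ (a x) f := fun x f => rfl
  have haA : ∀ w, ∀ x ∈ D.A w, a x ∈ D.A w := fun w x hx =>
    add_mem (Submodule.smul_mem _ _ (hpA w x hx))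
      (Submodule.smul_mem _ _ (sub_mem hx (hpA w x hx)))
  have hF : ∀ x, ∀ f ∈ D.F n, ρ' x f = ρ x f := fun x f hf => by
    rw [hρ', h.homotopy_eq_zero _ hf, sub_zero]
  have hF0 : ∀ k : ℕ, D.F 0 ≤ D.F k := by
    intro k
    induction k with
    | zero => simp
    | succ k ih => exact ih.trans (by simpa using D.F_mono (k + 1))
  refine ⟨ρ', ⟨?_, ?_, ?_, ?_⟩, hF⟩
  · intro k x f hf
    rw [hρ', sub_right_comm]
    exact sub_mem (h.low k x f hf) (h.homotopy_mem_F _ hf)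
  · intro k w x hx f hf
    rw [hρ', sub_right_comm]
    exact sub_mem (h.kaz k w x hx f hf) (h.homotopy_mem_K (haA w x hx) hf)
  · intro i j x hx y hy f hf
    have hf : f ∈ D.F n := by simpa using hf
    have h1 : ∀ x y, ρ' x (ρ' y f) = ρ x (ρ y f) - D.homotopy ρ (a x) (D.mulL (D.pr y) f) := by
      intro x y
      rw [hF y f hf, hρ', ← sub_add_cancel (ρ y f) (D.mulL (D.pr y) f), map_add (D.homotopy ρ (a x)),
        h.homotopy_eq_zero (a x) (h.low n y f hf), zero_add, sub_add_cancel]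
    -- On `F n` the curvature changes only by the homotopy applied to the leading terms of `ρ y f`
    -- and `ρ x f`.
    have h2 : L.curv ρ' (koszulSign i j) x y f = L.curv ρ (koszulSign i j) x y f -
        (D.homotopy ρ (a x) (D.mulL (D.pr y) f) -
          koszulSign i j • D.homotopy ρ (a y) (D.mulL (D.pr x) f)) := by
      rw [curv_apply, h1, h1, hF _ f hf, curv_apply, smul_sub]
      abel
    have hd : ∀ x, x = D.pr x + (x - D.pr x) := fun x => by abel
    have hk : ∀ x, D.pr (x - D.pr x) = 0 := fun x => by rw [map_sub, D.pr_pr, sub_self]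
    have hpx := D.pr_parity i x hx
    have hpy := D.pr_parity j y hy
    have e1 := h.homotopy_of_pr hpx hpy (D.pr_pr x) (D.pr_pr y) hf
    have e2 := h.homotopy_of_ker (sub_mem hx hpx) hpy (hk x) (D.pr_pr y) hf
    have e3 := h.homotopy_of_ker (sub_mem hy hpy) hpx (hk y) (D.pr_pr x) hf
    have e4 := h.curv_of_ker (sub_mem hx hpx) (sub_mem hy hpy) (hk x) (hk y) hf
    rw [curv_swap ρ hpx (sub_mem hy hpy)] at e3
    have n1 : (n : ℂ) + 1 ≠ 0 := Nat.cast_add_one_ne_zero n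
    have n2 : (n : ℂ) + 2 ≠ 0 := by exact_mod_cast Nat.succ_ne_zero (n + 1)
    have ha : ∀ x f, D.homotopy ρ (a x) f = ((n : ℂ) + 2)⁻¹ • D.homotopy ρ (D.pr x) f +
        ((n : ℂ) + 1)⁻¹ • D.homotopy ρ (x - D.pr x) f := fun x f => by
      simp [a]
    have e1' : D.homotopy ρ (D.pr x) (D.mulL (D.pr y) f) =
      koszulSign i j • D.homotopy ρ (D.pr y) (D.mulL (D.pr x) f) +
        ((n : ℂ) + 2) • L.curv ρ (koszulSign i j) (D.pr x) (D.pr y) f := by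
      rw [← e1]; abel
    rw [h2, ha, ha, e1', e2, e3]
    nth_rewrite 1 [hd x, hd y]
    simp only [curv_add_left, curv_add_right, LinearMap.add_apply, e4, LinearMap.neg_apply,
      LinearMap.smul_apply, smul_add, smul_smul, smul_neg, inv_mul_cancel₀ n1, inv_mul_cancel₀ n2]
    have s1 : koszulSign i j * (((n : ℂ) + 1)⁻¹ * (((n : ℂ) + 1) * koszulSign i j)) = 1 := by
      rw [← mul_assoc _ _ (koszulSign i j), inv_mul_cancel₀ n1, one_mul, koszulSign_mul_self]
    rw [s1, mul_comm _ (koszulSign i j)]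
    module
  · intro x f hf
    rw [hF x f (hF0 n hf), h.base x f hf]

end Approx

/-- The Poincaré-Birkhoff-Witt theorem: there is a `g`-module with the given leading terms. -/
theorem exists_rep (D : L.PBWData χ M β) (hpA : ∀ w, ∀ x ∈ D.A w, D.pr x ∈ D.A w) :
    ∃ ρ : g →ₗ[ℂ] Module.End ℂ M,
      (∀ i j, ∀ x ∈ L.parity i, ∀ y ∈ L.parity j,
        ρ x * ρ y = koszulSign i j • (ρ y * ρ x) + ρ (L.bracket x y)) ∧
      (∀ k w, ∀ x ∈ D.A w, ∀ f ∈ D.K k,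
        ρ x f - (D.mulL (D.pr x) f + χ x • f) ∈ D.K (k + w - 1)) ∧
      (∀ x, ∀ f ∈ D.F 0, ρ x f = D.mulL (D.pr x) f + χ x • f) := by
  have hstep : ∀ n : ℕ, ∀ r : {ρ : g →ₗ[ℂ] Module.End ℂ M // D.Approx n ρ},
      ∃ r' : {ρ : g →ₗ[ℂ] Module.End ℂ M // D.Approx (n + 1) ρ},
        ∀ x, ∀ f ∈ D.F n, r'.1 x f = r.1 x f := by
    rintro n ⟨ρ, h⟩
    obtain ⟨ρ', h1, h2⟩ := h.exists_succ hpA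
    exact ⟨⟨ρ', h1⟩, h2⟩
  choose next hnext using hstep
  let r : ∀ n : ℕ, {ρ : g →ₗ[ℂ] Module.End ℂ M // D.Approx n ρ} := fun n =>
    Nat.rec ⟨D.lead, D.approx_zero⟩ next n
  have hr : ∀ (n : ℕ) x, ∀ f ∈ D.F n, (r (n + 1)).1 x f = (r n).1 x f := fun n => hnext n (r n)
  have hFm : ∀ {n m : ℕ}, n ≤ m → D.F n ≤ D.F m := by
    intro n m hnm
    induction hnm with
    | refl => exact le_rfl
    | @step m _ ih => exact ih.trans (by simpa using D.F_mono (m + 1))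
  have hstab : ∀ {n m : ℕ}, n ≤ m → ∀ x, ∀ f ∈ D.F n, (r m).1 x f = (r n).1 x f := by
    intro n m hnm
    induction hnm with
    | refl => intros; rfl
    | step h ih => intro x f hf; rw [hr _ x f (hFm h hf), ih x f hf]
  choose N hN using D.F_exists
  -- The limit does not depend on the chosen level `N f`, which is what makes it linear in `f`.
  have hlim : ∀ f, ∀ n, f ∈ D.F (n : ℕ) → ∀ x, (r (N f)).1 x f = (r n).1 x f := by
    intro f n hn x
    rcases le_total (N f) n with h | h
    · rw [hstab h x f (hN f)]
    · rw [hstab h x f hn]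
  let ρ : g →ₗ[ℂ] Module.End ℂ M :=
    { toFun := fun x =>
        { toFun := fun f => (r (N f)).1 x f
          map_add' := fun f f' => by
            have h1 := hFm (le_max_left (N f) (N f')) (hN f)
            have h2 := hFm (le_max_right (N f) (N f')) (hN f')
            rw [hlim f _ h1, hlim f' _ h2, hlim _ _ (add_mem h1 h2), map_add]
          map_smul' := fun c f => by
            rw [hlim _ _ ((D.F (N f)).smul_mem c (hN f)), map_smul, RingHom.id_apply] }
      map_add' := fun x y => by ext f; simp
      map_smul' := fun c x => by ext f; simp }
  have hρ : ∀ n : ℕ, ∀ x, ∀ f ∈ D.F n, ρ x f = (r n).1 x f := fun n x f hf => hlim f n hf x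
  refine ⟨ρ, ?_, ?_, ?_⟩
  · intro i j x hx y hy
    refine LinearMap.ext fun f => ?_
    have hf := hFm (Nat.le_succ (N f)) (hN f)
    have h := (r (N f + 1)).2
    -- Applying `ρ` raises the degree by one, so the level is taken large enough for both `f` and
    -- its images; `r (N f + 2)` computes `ρ` on all of them.
    have hm : ∀ x, (r (N f + 1)).1 x f ∈ D.F ((N f + 2 : ℕ) : ℤ) := fun x => by
      have := h.mem_F (x := x) hf
      convert this using 2
      push_cast; ring
    simp only [LinearMap.add_apply, LinearMap.smul_apply, Module.End.mul_apply]
    rw [hρ _ x f hf, hρ _ y f hf, hρ _ _ f hf, hρ _ x _ (hm y), hρ _ y _ (hm x)]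
    have h' : ∀ x y, (r (N f + 2)).1 x ((r (N f + 1)).1 y f) =
        (r (N f + 2)).1 x ((r (N f + 2)).1 y f) := fun x y => by
      rw [hstab (Nat.le_succ (N f + 1)) y f hf]
    have hc := (r (N f + 2)).2.curv_eq_zero i j x hx y hy f (by
      have := hFm (Nat.le_succ (N f)) (hN f)
      convert this using 2
      push_cast; ring)
    rw [curv_apply] at hc
    rw [h', h', ← hstab (Nat.le_succ (N f + 1)) _ f hf]
    rw [sub_sub, sub_eq_zero] at hc
    exact hc
  · intro k w x hx f hf
    rw [hρ _ x f (hN f)]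
    exact (r (N f)).2.kaz k w x hx f hf
  · intro x f hf
    rw [hρ 0 x f (by simpa using hf)]
    exact (r 0).2.base x f hf

end PBWData

end LieSuperalgebra

/-! ### The decomposition of `g` into `p ⊕ l'` and `m` -/

namespace LieSuperalgebra

variable {g : Type*} [AddCommGroup g] [Module ℂ g] {L : LieSuperalgebra g}
  {χ : Module.Dual ℂ g}

namespace GoodGrading

variable (Γ : L.GoodGrading χ)

theorem deg_parity (w : ℤ) (i : ZMod 2) {x : g} (hx : x ∈ Γ.deg w) :
    internalProj L.isInternal i x ∈ Γ.deg w :=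
  IsSubsuperspace.internalProj_mem L (Γ.isSubsuperspace w) i hx

theorem mem_of_homogeneous (p : Submodule ℂ g)
    (hp : ∀ j i, ∀ x ∈ Γ.deg j, x ∈ L.parity i → x ∈ p) (x : g) : x ∈ p := by
  refine mem_of_internal Γ.isInternal p (fun j x hx => ?_) x
  exact mem_of_internalProj L.isInternal p fun i =>
    hp j i _ (Γ.deg_parity j i hx) (internalProj_mem _ _ _)

/-- A homogeneous projection of `g` onto `p ⊕ l'` along `m`. -/
structure Splitting (l l' : Submodule ℂ g) where
  /-- the projection -/
  pr : g →ₗ[ℂ] g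
  pr_eq_zero : ∀ x, pr x = 0 ↔ x ∈ Γ.nilSub l
  pr_mem : ∀ x, pr x ∈ Γ.posSub l'
  pr_eq_self : ∀ x ∈ Γ.posSub l', pr x = x
  pr_parity : ∀ i, ∀ x ∈ L.parity i, pr x ∈ L.parity i
  pr_deg : ∀ j, ∀ x ∈ Γ.deg j, pr x ∈ Γ.deg j

section Stable

variable {Γ} {l l' : Submodule ℂ g}

theorem nilSub_le {p : Submodule ℂ g} (h1 : ∀ j, j ≤ -2 → Γ.deg j ≤ p) (h2 : l ≤ p) :
    Γ.nilSub l ≤ p :=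
  sup_le (iSup_le fun j => iSup_le fun hj => h1 j hj) h2

theorem posSub_le {p : Submodule ℂ g} (h1 : ∀ j, 0 ≤ j → Γ.deg j ≤ p) (h2 : l' ≤ p) :
    Γ.posSub l' ≤ p :=
  sup_le (iSup_le fun j => iSup_le fun hj => h1 j hj) h2

theorem deg_le_nilSub {j : ℤ} (hj : j ≤ -2) : Γ.deg j ≤ Γ.nilSub l :=
  le_sup_of_le_left (le_iSup₂_of_le j hj le_rfl)

theorem deg_le_posSub {j : ℤ} (hj : 0 ≤ j) : Γ.deg j ≤ Γ.posSub l' :=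
  le_sup_of_le_left (le_iSup₂_of_le j hj le_rfl)

theorem nilSub_parity (hl : L.IsSubsuperspace l) (i : ZMod 2) {x : g} (hx : x ∈ Γ.nilSub l) :
    internalProj L.isInternal i x ∈ Γ.nilSub l :=
  nilSub_le (p := (Γ.nilSub l).comap (internalProj L.isInternal i))
    (fun j hj _ hx => deg_le_nilSub hj (Γ.deg_parity j i hx))
    (fun _ hx => le_sup_right (a := ⨆ (j : ℤ) (_ : j ≤ -2), Γ.deg j)
      (IsSubsuperspace.internalProj_mem L hl i hx)) hx

theorem posSub_parity (hl : L.IsSubsuperspace l') (i : ZMod 2) {x : g} (hx : x ∈ Γ.posSub l') :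
    internalProj L.isInternal i x ∈ Γ.posSub l' :=
  posSub_le (p := (Γ.posSub l').comap (internalProj L.isInternal i))
    (fun j hj _ hx => deg_le_posSub hj (Γ.deg_parity j i hx))
    (fun _ hx => le_sup_right (a := ⨆ (j : ℤ) (_ : 0 ≤ j), Γ.deg j)
      (IsSubsuperspace.internalProj_mem L hl i hx)) hx

theorem internalProj_mem_of_le_deg {p : Submodule ℂ g} {j : ℤ} (hp : p ≤ Γ.deg j) (k : ℤ) {x : g}
    (hx : x ∈ p) : internalProj Γ.isInternal k x ∈ p := by
  by_cases h : j = k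
  · subst h; rwa [internalProj_same _ (hp hx)]
  · rw [internalProj_ne _ h (hp hx)]; exact zero_mem _

theorem nilSub_deg (hl : l ≤ Γ.deg (-1)) (k : ℤ) {x : g} (hx : x ∈ Γ.nilSub l) :
    internalProj Γ.isInternal k x ∈ Γ.nilSub l :=
  nilSub_le (p := (Γ.nilSub l).comap (internalProj Γ.isInternal k))
    (fun _ hj _ hx => deg_le_nilSub hj (internalProj_mem_of_le_deg le_rfl k hx))
    (fun _ hx => le_sup_right (a := ⨆ (j : ℤ) (_ : j ≤ -2), Γ.deg j)
      (internalProj_mem_of_le_deg hl k hx)) hx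

theorem posSub_deg (hl : l' ≤ Γ.deg (-1)) (k : ℤ) {x : g} (hx : x ∈ Γ.posSub l') :
    internalProj Γ.isInternal k x ∈ Γ.posSub l' :=
  posSub_le (p := (Γ.posSub l').comap (internalProj Γ.isInternal k))
    (fun _ hj _ hx => deg_le_posSub hj (internalProj_mem_of_le_deg le_rfl k hx))
    (fun _ hx => le_sup_right (a := ⨆ (j : ℤ) (_ : 0 ≤ j), Γ.deg j)
      (internalProj_mem_of_le_deg hl k hx)) hx

/-- The components of elements of `m`. -/
theorem internalProj_nilSub (hl : l ≤ Γ.deg (-1)) (k : ℤ) (hk : -1 ≤ k) {x : g}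
    (hx : x ∈ Γ.nilSub l) : internalProj Γ.isInternal k x ∈ if k = -1 then l else ⊥ := by
  refine nilSub_le (p := (if k = -1 then l else ⊥ : Submodule ℂ g).comap
    (internalProj Γ.isInternal k)) (fun j hj x hx => ?_) (fun x hx => ?_) hx
  · rw [Submodule.mem_comap, internalProj_ne _ (by omega) hx]; exact zero_mem _
  · rw [Submodule.mem_comap]
    split
    · next h => subst h; rwa [internalProj_same _ (hl hx)]
    · next h => rw [internalProj_ne _ (Ne.symm h) (hl hx)]; exact zero_mem _

/-- The components of elements of `p ⊕ l'`. -/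
theorem internalProj_posSub (hl : l' ≤ Γ.deg (-1)) (k : ℤ) (hk : k ≤ -1) {x : g}
    (hx : x ∈ Γ.posSub l') : internalProj Γ.isInternal k x ∈ if k = -1 then l' else ⊥ := by
  refine posSub_le (p := (if k = -1 then l' else ⊥ : Submodule ℂ g).comap
    (internalProj Γ.isInternal k)) (fun j hj x hx => ?_) (fun x hx => ?_) hx
  · rw [Submodule.mem_comap, internalProj_ne _ (by omega) hx]; exact zero_mem _
  · rw [Submodule.mem_comap]
    split
    · next h => subst h; rwa [internalProj_same _ (hl hx)]
    · next h => rw [internalProj_ne _ (Ne.symm h) (hl hx)]; exact zero_mem _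

variable (hl : L.IsSubsuperspace l) (hl' : L.IsSubsuperspace l') (hsup : l ⊔ l' = Γ.deg (-1))
  (hdisj : Disjoint l l')

include hsup hdisj

theorem isCompl_posSub_nilSub : IsCompl (Γ.posSub l') (Γ.nilSub l) := by
  have hl1 : l ≤ Γ.deg (-1) := hsup ▸ le_sup_left
  have hl2 : l' ≤ Γ.deg (-1) := hsup ▸ le_sup_right
  constructor
  · rw [Submodule.disjoint_def]
    intro x hp hm
    refine eq_zero_of_internalProj Γ.isInternal fun k => ?_
    rcases lt_trichotomy k (-1) with h | h | h
    · have := internalProj_posSub hl2 k h.le hp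
      rwa [if_neg h.ne, Submodule.mem_bot] at this
    · have h1 := internalProj_posSub hl2 k h.le hp
      have h2 := internalProj_nilSub hl1 k h.ge hm
      rw [if_pos h] at h1 h2
      exact Submodule.disjoint_def.mp hdisj _ h2 h1
    · have := internalProj_nilSub hl1 k h.le hm
      rwa [if_neg h.ne', Submodule.mem_bot] at this
  · rw [codisjoint_iff, eq_top_iff]
    intro x _
    refine mem_of_internal Γ.isInternal _ (fun j x hx => ?_) x
    rcases lt_trichotomy j (-1) with h | h | h
    · exact le_sup_right (a := Γ.posSub l') (deg_le_nilSub (by omega) hx)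
    · subst h
      rw [← hsup] at hx
      refine (sup_le ?_ ?_ : l ⊔ l' ≤ Γ.posSub l' ⊔ Γ.nilSub l) hx
      · exact le_sup_of_le_right (le_sup_right)
      · exact le_sup_of_le_left (le_sup_right)
    · exact le_sup_left (b := Γ.nilSub l) (deg_le_posSub (by omega) hx)

include hl hl'

/-- Both summands are stable under the parity projections and the degree projections, so the
projection along `m` preserves parity and degree. -/
theorem exists_splitting : Nonempty (Γ.Splitting l l') := by
  have hl1 : l ≤ Γ.deg (-1) := hsup ▸ le_sup_left
  have hl2 : l' ≤ Γ.deg (-1) := hsup ▸ le_sup_right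
  have hc := isCompl_posSub_nilSub (Γ := Γ) hsup hdisj
  let pr := (Γ.posSub l').projection (Γ.nilSub l) hc
  have hcomm : ∀ Q : g →ₗ[ℂ] g, (∀ x ∈ Γ.posSub l', Q x ∈ Γ.posSub l') →
      (∀ x ∈ Γ.nilSub l, Q x ∈ Γ.nilSub l) → ∀ x, Q x = x → Q (pr x) = pr x := by
    intro Q h1 h2 x hx
    have h3 : pr x ∈ Γ.posSub l' := Submodule.projection_apply_mem hc x
    have h4 : x - pr x ∈ Γ.nilSub l := by
      rw [← Submodule.projection_apply_eq_zero_iff hc]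
      change pr (x - pr x) = 0
      rw [map_sub, sub_eq_zero]
      exact (Submodule.projection_apply_of_mem_left hc h3).symm
    have h5 : pr (Q (pr x)) = Q (pr x) := Submodule.projection_apply_of_mem_left hc (h1 _ h3)
    have h6 : pr (Q (x - pr x)) = 0 := Submodule.projection_apply_of_mem_right hc (h2 _ h4)
    rw [map_sub, map_sub, hx, h5, sub_eq_zero] at h6
    exact h6.symm
  refine ⟨⟨pr, fun x => Submodule.projection_apply_eq_zero_iff hc,
    Submodule.projection_apply_mem hc, fun x hx => Submodule.projection_apply_of_mem_left hc hx,
    ?_, ?_⟩⟩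
  · intro i x hx
    rw [← hcomm (internalProj L.isInternal i) (fun x hx => posSub_parity hl' i hx)
      (fun x hx => nilSub_parity hl i hx) x (internalProj_same _ hx)]
    exact internalProj_mem _ _ _
  · intro j x hx
    rw [← hcomm (internalProj Γ.isInternal j) (fun x hx => posSub_deg hl2 j hx)
      (fun x hx => nilSub_deg hl1 j hx) x (internalProj_same _ hx)]
    exact internalProj_mem _ _ _

end Stable

/-! ### The structure of `m` -/

section NilSub

variable {Γ} {l : Submodule ℂ g} (hl : Γ.IsIsotropic l)

include hl

/-- A statement additive in both arguments may be checked on components. Components in degree `-1`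
of elements of `m` lie in `l`, so the pair of degrees `(-1, -1)` is needed on `l` only. -/
theorem nilSub_induction {p : g → g → Prop}
    (hadd : ∀ x x' y, p x y → p x' y → p (x + x') y)
    (hadd' : ∀ x y y', p x y → p x y' → p x (y + y'))
    (h0 : ∀ y, p 0 y) (h0' : ∀ x, p x 0)
    (hp : ∀ i j, i ≤ -1 → j ≤ -1 → (i = -1 → j = -1 → False) → ∀ x ∈ Γ.deg i, ∀ y ∈ Γ.deg j, p x y)
    (hpl : ∀ x ∈ l, ∀ y ∈ l, p x y) {x y : g} (hx : x ∈ Γ.nilSub l) (hy : y ∈ Γ.nilSub l) :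
    p x y := by
  have hm : ∀ x ∈ Γ.nilSub l, ∃ s : Finset ℤ, (∀ k ∈ s, k ≤ -1) ∧
      (∀ k, k = -1 → internalProj Γ.isInternal k x ∈ l) ∧ ∑ k ∈ s, internalProj Γ.isInternal k x = x := by
    intro x hx
    refine ⟨(internalProj_finite Γ.isInternal x).toFinset, fun k hk => ?_, fun k hk => ?_,
      internalProj_sum _ _ _ fun i hi => by simpa using hi⟩
    · by_contra h
      have := internalProj_nilSub hl.1 k (by omega) hx
      rw [if_neg (by omega), Submodule.mem_bot] at this
      exact (by simpa using hk : internalProj Γ.isInternal k x ≠ 0) this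
    · have := internalProj_nilSub hl.1 k (by omega) hx
      rwa [if_pos hk] at this
  obtain ⟨s, hs, hsl, hsx⟩ := hm x hx
  obtain ⟨t, ht, htl, hty⟩ := hm y hy
  rw [← hsx, ← hty]
  refine Finset.sum_induction _ (fun x => p x _) (fun a b => hadd a b _) (h0 _) fun i hi => ?_
  refine Finset.sum_induction _ (fun y => p _ y) (fun a b => hadd' _ a b) (h0' _) fun j hj => ?_
  by_cases h : i = -1 ∧ j = -1
  · exact hpl _ (hsl i h.1) _ (htl j h.2)
  · exact hp i j (hs i hi) (ht j hj) (fun h1 h2 => h ⟨h1, h2⟩) _ (internalProj_mem _ _ _) _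
      (internalProj_mem _ _ _)

theorem bracket_mem_nilSub {x y : g} (hx : x ∈ Γ.nilSub l) (hy : y ∈ Γ.nilSub l) :
    L.bracket x y ∈ Γ.nilSub l := by
  refine nilSub_induction hl (p := fun x y => L.bracket x y ∈ Γ.nilSub l) ?_ ?_ ?_ ?_ ?_ ?_ hx hy
  · intro x x' y h h'; rw [map_add, LinearMap.add_apply]; exact add_mem h h'
  · intro x y y' h h'; rw [map_add]; exact add_mem h h'
  · intro y; simp
  · intro x; simp
  · intro i j hi hj _ x hx y hy
    exact deg_le_nilSub (by omega) (Γ.bracket_mem i j x hx y hy)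
  · intro x hx y hy
    exact deg_le_nilSub (j := -1 + -1) (by norm_num) (Γ.bracket_mem (-1) (-1) x (hl.1 hx) y (hl.1 hy))

/-- Since `χ` lives in degree `-2`, two components in degrees at most `-1` can pair only if both
have degree `-1`, and `l` is isotropic. Thus `χ` is a character of `m`. -/
theorem apply_bracket_nilSub {x y : g} (hx : x ∈ Γ.nilSub l) (hy : y ∈ Γ.nilSub l) :
    χ (L.bracket x y) = 0 := by
  refine nilSub_induction hl (p := fun x y => χ (L.bracket x y) = 0) ?_ ?_ ?_ ?_ ?_ ?_ hx hy
  · intro x x' y h h'; rw [map_add, LinearMap.add_apply, map_add, h, h', add_zero]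
  · intro x y y' h h'; rw [map_add, map_add, h, h', add_zero]
  · intro y; simp
  · intro x; simp
  · intro i j hi hj h x hx y hy
    exact Γ.apply_eq_zero (i + j) (fun e => h (by omega) (by omega)) _ (Γ.bracket_mem i j x hx y hy)
  · exact hl.2.2

end NilSub

/-- A homogeneous resolution of the identity. -/
theorem exists_homogeneous_resolution [FiniteDimensional ℂ g] :
    ∃ (n : ℕ) (e : Fin n → g) (f : Fin n → Module.Dual ℂ g) (par : Fin n → ZMod 2)
      (dg : Fin n → ℤ), (∀ b, e b ∈ L.parity (par b)) ∧ (∀ b, e b ∈ Γ.deg (dg b)) ∧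
      (∀ b j, ∀ x ∈ L.parity j, j ≠ par b → f b x = 0) ∧
      (∀ b j, ∀ x ∈ Γ.deg j, j ≠ dg b → f b x = 0) ∧ ∀ x, ∑ b, f b x • e b = x := by
  classical
  let v := Module.finBasis ℂ g
  let J : Finset ℤ := Finset.univ.biUnion fun c =>
    (internalProj_finite Γ.isInternal (v c)).toFinset
  have hJ : ∀ x, ∑ j ∈ J, internalProj Γ.isInternal j x = x := by
    have : ∑ j ∈ J, internalProj Γ.isInternal j = LinearMap.id := by
      refine v.ext fun c => ?_
      rw [LinearMap.sum_apply]
      exact internalProj_sum Γ.isInternal (v c) J fun i hi =>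
        Finset.mem_biUnion.mpr ⟨c, Finset.mem_univ _, by simpa using hi⟩
    intro x
    rw [← LinearMap.sum_apply, this, LinearMap.id_apply]
  -- The vectors are the bihomogeneous components of the basis vectors. They span without being
  -- independent; the functionals are the basis coordinates of the bihomogeneous components, and
  -- idempotency of these projections gives the resolution.
  let B := Fin (Module.finrank ℂ g) × (J × ZMod 2)
  let q : J × ZMod 2 → g →ₗ[ℂ] g := fun b =>
    internalProj Γ.isInternal b.1 ∘ₗ internalProj L.isInternal b.2
  have hq1 : ∀ b x, q b x ∈ L.parity b.2 := fun b x =>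
    Γ.proj_mem_parity (internalProj_mem _ _ _) _
  have hq2 : ∀ b x, q b x ∈ Γ.deg b.1 := fun b x => internalProj_mem _ _ _
  have hqq : ∀ b x, q b (q b x) = q b x := fun b x => by
    change internalProj Γ.isInternal b.1 (internalProj L.isInternal b.2 (q b x)) = q b x
    rw [internalProj_same _ (hq1 b x), internalProj_same _ (hq2 b x)]
  have hqs : ∀ x, ∑ b, q b x = x := by
    intro x
    rw [Fintype.sum_prod_type, Finset.sum_comm]
    have h1 : ∀ i : ZMod 2, ∑ j : J, q (j, i) x = internalProj L.isInternal i x := fun i => by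
      have := hJ (internalProj L.isInternal i x)
      rw [← Finset.sum_coe_sort] at this
      exact this
    rw [Finset.sum_congr rfl fun i _ => h1 i]
    exact internalProj_sum L.isInternal x Finset.univ (by simp)
  let E : B ≃ Fin (Fintype.card B) := Fintype.equivFin B
  refine ⟨Fintype.card B, fun b => q (E.symm b).2 (v (E.symm b).1),
    fun b => v.coord (E.symm b).1 ∘ₗ q (E.symm b).2, fun b => (E.symm b).2.2,
    fun b => (E.symm b).2.1, fun b => hq1 _ _, fun b => hq2 _ _, ?_, ?_, ?_⟩
  · intro b j x hx hj
    change v.coord _ (internalProj Γ.isInternal _ (internalProj L.isInternal _ x)) = 0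
    rw [internalProj_ne _ hj hx, map_zero, map_zero]
  · intro b j x hx hj
    change v.coord _ (internalProj Γ.isInternal _ (internalProj L.isInternal _ x)) = 0
    rw [internalProj_ne _ hj (Γ.deg_parity j _ hx), map_zero]
  · intro x
    rw [E.symm.sum_comp fun b => (v.coord b.1 ∘ₗ q b.2) x • q b.2 (v b.1), Fintype.sum_prod_type,
      Finset.sum_comm]
    have h1 : ∀ b, ∑ c, (v.coord c ∘ₗ q b) x • q b (v c) = q b x := by
      intro b
      conv_rhs => rw [← hqq, ← v.sum_repr (q b x), map_sum]
      simp
    rw [Finset.sum_congr rfl fun b _ => h1 b, hqs]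

end GoodGrading

end LieSuperalgebra

/-! ### Contractions and gradings on `S(g)`, and the model representation -/

namespace LieSuperalgebra

variable {g : Type*} [AddCommGroup g] [Module ℂ g] {L : LieSuperalgebra g}
  {χ : Module.Dual ℂ g}

/-- Contraction with a functional of parity `p`. -/
theorem exists_contraction (L : LieSuperalgebra g) (p : ZMod 2) (ξ : Module.Dual ℂ g)
    (hξ : ∀ j, ∀ x ∈ L.parity j, j ≠ p → ξ x = 0) :
    ∃ D : SuperSym L.parity →ₗ[ℂ] SuperSym L.parity, D 1 = 0 ∧ ∀ x u,
      D (SuperSym.ι L.parity x * u) = ξ x • u + SuperSym.ι L.parity (L.twist p x) * D u := by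
  obtain ⟨D, h1, h2⟩ := L.exists_superDer p (ξ.smulRight (1 : SuperSym L.parity)) (by
    -- Where `ξ x` can be nonzero, `i + p = 0` in `ZMod 2`, so the required sign is `1` and scalar
    -- values are allowed.
    intro i j x y hx _
    by_cases h : i = p
    · subst h
      simp [CharTwo.add_self_eq_zero]
    · simp [hξ i x hx h])
  exact ⟨D, h1, fun x u => by rw [h2]; simp⟩

namespace GoodGrading

variable (Γ : L.GoodGrading χ)

/-- The algebra homomorphism `S(g) → S(g)[T, T⁻¹]` with `x ↦ x T^(j + 2)` for `x ∈ g_j`. -/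
def kazhdanHom : SuperSym L.parity →ₐ[ℂ] AddMonoidAlgebra (SuperSym L.parity) ℤ :=
  SuperSym.lift (LinearMap.mulLeft ℂ (AddMonoidAlgebra.single 2 1) ∘ₗ Γ.gradeι) (by
    intro i j x y hx hy
    have hT : ∀ v : AddMonoidAlgebra (SuperSym L.parity) ℤ,
        v * AddMonoidAlgebra.single 2 1 = AddMonoidAlgebra.single 2 1 * v := fun v =>
      (LaurentPolynomial.commute_T 2 v).symm.eq
    simp only [LinearMap.comp_apply, LinearMap.mulLeft_apply]
    rw [mul_assoc, ← mul_assoc (Γ.gradeι x), hT, mul_assoc, mul_assoc _ (Γ.gradeι y),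
      ← mul_assoc (Γ.gradeι y), hT, mul_assoc, Γ.gradeι_comm i j x y hx hy, mul_smul_comm,
      mul_smul_comm])

theorem kazhdanHom_ι {w : ℤ} {x : g} (hx : x ∈ Γ.deg (w - 2)) :
    Γ.kazhdanHom (SuperSym.ι L.parity x) = AddMonoidAlgebra.single w (SuperSym.ι L.parity x) := by
  rw [kazhdanHom, SuperSym.lift_ι, LinearMap.comp_apply, Γ.gradeι_of_mem hx,
    LinearMap.mulLeft_apply, AddMonoidAlgebra.single_mul_single, one_mul]
  congr 1
  ring

theorem gradeHom_ι {w : ℤ} {x : g} (hx : x ∈ Γ.deg w) :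
    Γ.gradeHom (SuperSym.ι L.parity x) = AddMonoidAlgebra.single w (SuperSym.ι L.parity x) := by
  rw [gradeHom, SuperSym.lift_ι, Γ.gradeι_of_mem hx]

theorem iSup_deg : ⨆ w, Γ.deg w = ⊤ := Γ.isInternal.submodule_iSup_eq_top

theorem iSup_deg_sub_two : ⨆ w, Γ.deg (w - 2) = ⊤ :=
  eq_top_iff.mpr (Γ.iSup_deg ▸ iSup_le fun j =>
    le_iSup_of_le (j + 2) (by rw [add_sub_cancel_right]))

namespace Splitting

variable {Γ} {l l' : Submodule ℂ g} (T : Γ.Splitting l l')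

theorem pr_pr (x : g) : T.pr (T.pr x) = T.pr x := T.pr_eq_self _ (T.pr_mem x)

theorem pr_sub (x : g) : T.pr (x - T.pr x) = 0 := by rw [map_sub, T.pr_pr, sub_self]

/-- The algebra homomorphism `S(g) → S(g)[T, T⁻¹]` for the degree in `p ⊕ l'`. -/
def polyHom : SuperSym L.parity →ₐ[ℂ] AddMonoidAlgebra (SuperSym L.parity) ℤ :=
  SuperSym.lift (AddMonoidAlgebra.lsingle 1 ∘ₗ SuperSym.ι L.parity ∘ₗ T.pr +
      AddMonoidAlgebra.lsingle 0 ∘ₗ SuperSym.ι L.parity ∘ₗ (LinearMap.id - T.pr)) (by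
    intro i j x y hx hy
    have h1 := T.pr_parity i x hx
    have h2 := T.pr_parity j y hy
    have h3 := sub_mem hx h1
    have h4 := sub_mem hy h2
    simp only [LinearMap.comp_apply, LinearMap.add_apply, LinearMap.sub_apply, LinearMap.id_apply,
      AddMonoidAlgebra.lsingle_apply, add_mul, mul_add, AddMonoidAlgebra.single_mul_single,
      smul_add, SuperSym.ι_comm L.parity h1 h2, SuperSym.ι_comm L.parity h1 h4,
      SuperSym.ι_comm L.parity h3 h2, SuperSym.ι_comm L.parity h3 h4,
      AddMonoidAlgebra.smul_single]
    rw [add_comm (1 : ℤ) 0]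
    abel)

/-- The grading of `g` with `p ⊕ l'` in degree one and `m` in degree zero. -/
def polyDeg (_ : Γ.Splitting l l') (w : ℤ) : Submodule ℂ g :=
  if w = 1 then Γ.posSub l' else if w = 0 then Γ.nilSub l else ⊥

theorem polyDeg_cases {w : ℤ} {x : g} (hx : x ∈ T.polyDeg w) :
    (w = 1 ∧ T.pr x = x) ∨ (w = 0 ∧ T.pr x = 0) ∨ x = 0 := by
  unfold polyDeg at hx
  split at hx
  · next h => exact Or.inl ⟨h, T.pr_eq_self x hx⟩
  · split at hx
    · next h => exact Or.inr (Or.inl ⟨h, (T.pr_eq_zero x).mpr hx⟩)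
    · exact Or.inr (Or.inr ((Submodule.mem_bot ℂ).mp hx))

theorem iSup_polyDeg : ⨆ w, T.polyDeg w = ⊤ := by
  refine eq_top_iff.mpr fun x _ => ?_
  rw [← add_sub_cancel (T.pr x) x]
  refine add_mem (Submodule.mem_iSup_of_mem 1 ?_) (Submodule.mem_iSup_of_mem 0 ?_)
  · simpa [polyDeg] using T.pr_mem x
  · simpa [polyDeg] using (T.pr_eq_zero _).mp (T.pr_sub x)

theorem polyHom_ι (w : ℤ) (x : g) (hx : x ∈ T.polyDeg w) :
    T.polyHom (SuperSym.ι L.parity x) = AddMonoidAlgebra.single w (SuperSym.ι L.parity x) := by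
  rw [polyHom, SuperSym.lift_ι]
  rcases T.polyDeg_cases hx with ⟨rfl, h⟩ | ⟨rfl, h⟩ | rfl <;> simp_all

theorem symComp_polyHom_neg {k : ℤ} (hk : k < 0) (u : SuperSym L.parity) :
    symComp T.polyHom k u = 0 := by
  suffices H : ∀ u : SuperSym L.parity,
      u ∈ ⨅ k : ℤ, ⨅ _ : k < 0, LinearMap.ker (symComp T.polyHom k) by
    have := H u
    simp only [Submodule.mem_iInf, LinearMap.mem_ker] at this
    exact this k hk
  refine SuperSym.mem_of_homogeneous_mul_mem T.iSup_polyDeg _ ?_ ?_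
  · simp only [Submodule.mem_iInf, LinearMap.mem_ker]
    intro k hk
    rw [symComp_one, if_neg hk.ne]
  · intro w x hx u hu
    simp only [Submodule.mem_iInf, LinearMap.mem_ker] at hu ⊢
    intro k hk
    rw [symComp_mul (T.polyHom_ι w x hx)]
    rcases T.polyDeg_cases hx with ⟨rfl, h⟩ | ⟨rfl, h⟩ | rfl
    · rw [hu _ (by omega), mul_zero]
    · rw [hu _ (by omega), mul_zero]
    · simp

theorem mul_mem_symFil_poly (x : g) {k : ℤ} {u : SuperSym L.parity}
    (hu : u ∈ symFil T.polyHom k) :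
    SuperSym.ι L.parity (T.pr x) * u ∈ symFil T.polyHom (k + 1) :=
  mem_symFil_of_shift (T := (SuperSym.ι L.parity (T.pr x) * ·)) (mul_zero _)
    (symComp_mul (T.polyHom_ι 1 _ (by simpa [polyDeg] using T.pr_mem x))) hu

theorem mul_mem_symFil_kazhdan {w : ℤ} {x : g} (hx : x ∈ Γ.deg (w - 2)) {k : ℤ}
    {u : SuperSym L.parity} (hu : u ∈ symFil Γ.kazhdanHom k) :
    SuperSym.ι L.parity x * u ∈ symFil Γ.kazhdanHom (k + w) :=
  mem_symFil_of_shift (T := (SuperSym.ι L.parity x * ·)) (mul_zero _)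
    (symComp_mul (Γ.kazhdanHom_ι hx)) hu

/-- The representation of `g` on `S(g)` with leading terms the multiplication operators. -/
theorem exists_rep [FiniteDimensional ℂ g] (hχ : L.IsEvenFunctional χ) (hl : Γ.IsIsotropic l)
    (hl' : L.IsSubsuperspace l') :
    ∃ ρ : g →ₗ[ℂ] Module.End ℂ (SuperSym L.parity),
      (∀ i j, ∀ x ∈ L.parity i, ∀ y ∈ L.parity j,
        ρ x * ρ y = koszulSign i j • (ρ y * ρ x) + ρ (L.bracket x y)) ∧
      (∀ k w, ∀ x ∈ Γ.deg (w - 2), ∀ f ∈ symFil Γ.kazhdanHom k,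
        ρ x f - (SuperSym.ι L.parity (T.pr x) * f + χ x • f) ∈ symFil Γ.kazhdanHom (k + w - 1)) ∧
      (∀ x, ρ x 1 = SuperSym.ι L.parity (T.pr x) + χ x • 1) := by
  obtain ⟨n, e, f, par, dg, he1, he2, hf1, hf2, hef⟩ := Γ.exists_homogeneous_resolution
  have hc : ∀ b j, ∀ x ∈ L.parity j, j ≠ par b → (f b ∘ₗ T.pr) x = 0 := fun b j x hx hj =>
    hf1 b j _ (T.pr_parity j x hx) hj
  choose D hD1 hDm using fun b => L.exists_contraction (par b) (f b ∘ₗ T.pr) (hc b)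
  have hsum : ∀ y, ∑ b, (f b ∘ₗ T.pr) y • T.pr (e b) = T.pr y := fun y => by
    conv_rhs => rw [← T.pr_pr, ← hef (T.pr y), map_sum]
    simp
  -- The functional `f b ∘ pr` vanishes on `m`, so the contraction removes exactly one factor from
  -- `p ⊕ l'`.
  have hDP : ∀ b k u, symComp T.polyHom k (D b u) = D b (symComp T.polyHom (k - (-1)) u) := by
    intro b
    refine symComp_superDer (p := par b) (d := (f b ∘ₗ T.pr).smulRight 1) T.polyHom T.iSup_polyDeg T.polyHom_ι
      ?_ (hD1 b) (fun x u => ?_) ?_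
    · intro w i x hx
      unfold polyDeg at hx ⊢
      split
      · rw [if_pos (by assumption)] at hx; exact posSub_parity hl' i hx
      · rw [if_neg (by assumption)] at hx
        split
        · rw [if_pos (by assumption)] at hx; exact nilSub_parity hl.2.1 i hx
        · rw [if_neg (by assumption), Submodule.mem_bot] at hx
          rw [hx, map_zero]; exact zero_mem _
    · rw [hDm]; simp
    · intro w x hx k u
      rcases T.polyDeg_cases hx with ⟨rfl, h⟩ | ⟨rfl, h⟩ | rfl
      · rw [show k - 1 - -1 = k by ring]; simp
      · simp [h]
      · simp
  have hDK : ∀ b k u, symComp Γ.kazhdanHom k (D b u) =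
      D b (symComp Γ.kazhdanHom (k - (-(dg b + 2))) u) := by
    intro b
    refine symComp_superDer (p := par b) (d := (f b ∘ₗ T.pr).smulRight 1) Γ.kazhdanHom Γ.iSup_deg_sub_two
      (fun w x hx => Γ.kazhdanHom_ι hx) (fun w i x hx => Γ.deg_parity _ i hx) (hD1 b)
      (fun x u => by rw [hDm]; simp) ?_
    intro w x hx k u
    by_cases h : w - 2 = dg b
    · rw [show k - w - -(dg b + 2) = k by omega]; simp
    · have : f b (T.pr x) = 0 := hf2 b _ _ (T.pr_deg _ x hx) h
      simp [this]
  -- The Euler operator is the even derivation extending `pr`.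
  have hEm : ∀ x u, ∑ b, SuperSym.ι L.parity (T.pr (e b)) * D b (SuperSym.ι L.parity x * u) =
      SuperSym.ι L.parity (T.pr x) * u +
        SuperSym.ι L.parity x * ∑ b, SuperSym.ι L.parity (T.pr (e b)) * D b u := by
    intro x u
    let E : SuperSym L.parity →ₗ[ℂ] SuperSym L.parity :=
      ∑ b, LinearMap.mulLeft ℂ (SuperSym.ι L.parity (T.pr (e b))) ∘ₗ D b
    have hE : ∀ v, E v = ∑ b, SuperSym.ι L.parity (T.pr (e b)) * D b v := fun v => by
      simp [E, LinearMap.sum_apply]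
    rw [← hE, ← hE]
    let R := (LinearMap.mul ℂ (SuperSym L.parity)).flip
    have := L.mem_of_parity (LinearMap.eqLocus (E ∘ₗ R u ∘ₗ SuperSym.ι L.parity)
      (R u ∘ₗ SuperSym.ι L.parity ∘ₗ T.pr + R (E u) ∘ₗ SuperSym.ι L.parity)) ?_ x
    · exact this
    intro j x hx
    simp only [LinearMap.mem_eqLocus, LinearMap.comp_apply, LinearMap.add_apply, R,
      LinearMap.flip_apply, LinearMap.mul_apply', hE]
    rw [← hsum x, map_sum, Finset.sum_mul, Finset.mul_sum, ← Finset.sum_add_distrib]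
    refine Finset.sum_congr rfl fun b _ => ?_
    rw [hDm, L.twist_of_mem hx, map_smul, map_smul, mul_add, mul_smul_comm, smul_mul_assoc,
      smul_mul_assoc, mul_smul_comm, ← mul_assoc, ← mul_assoc,
      SuperSym.ι_comm L.parity (T.pr_parity _ _ (he1 b)) hx, smul_mul_assoc, smul_smul,
      koszulSign_mul_self, one_smul]
  have hEk : ∀ k u, ∑ b, SuperSym.ι L.parity (T.pr (e b)) * D b (symComp T.polyHom k u) =
      (k : ℂ) • symComp T.polyHom k u := by
    let E : SuperSym L.parity →ₗ[ℂ] SuperSym L.parity :=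
      ∑ b, LinearMap.mulLeft ℂ (SuperSym.ι L.parity (T.pr (e b))) ∘ₗ D b
    have hE : ∀ v, E v = ∑ b, SuperSym.ι L.parity (T.pr (e b)) * D b v := fun v => by
      simp [E, LinearMap.sum_apply]
    suffices H : ∀ u : SuperSym L.parity,
        u ∈ ⨅ k : ℤ, LinearMap.eqLocus (E ∘ₗ symComp T.polyHom k)
          ((k : ℂ) • symComp T.polyHom k) by
      intro k u
      have := H u
      simp only [Submodule.mem_iInf] at this
      rw [← hE]
      exact this k
    refine SuperSym.mem_of_homogeneous_mul_mem T.iSup_polyDeg _ ?_ ?_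
    · simp only [Submodule.mem_iInf, LinearMap.mem_eqLocus, LinearMap.comp_apply,
        LinearMap.smul_apply, symComp_one, hE]
      intro k
      split
      · next h => simp [h, hD1]
      · simp
    · intro w x hx u hu
      simp only [Submodule.mem_iInf, LinearMap.mem_eqLocus, LinearMap.comp_apply,
        LinearMap.smul_apply, hE] at hu ⊢
      intro k
      rw [symComp_mul (T.polyHom_ι w x hx), hEm, hu]
      rcases T.polyDeg_cases hx with ⟨rfl, h⟩ | ⟨rfl, h⟩ | rfl
      · rw [h, mul_smul_comm]
        push_cast
        module
      · rw [h, mul_smul_comm, map_zero, zero_mul, zero_add, sub_zero]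
      · simp
  -- The carrier is all of `S(g)` rather than `S(p ⊕ l')`: elements of `m` have polynomial degree
  -- zero and behave as constants for the contractions. The second filtration is the Kazhdan
  -- filtration.
  let P : L.PBWData χ (SuperSym L.parity) (Fin n) :=
    { pr := T.pr
      pr_parity := T.pr_parity
      pr_pr := T.pr_pr
      pr_bracket := fun x y hx hy => (T.pr_eq_zero _).mpr
        (bracket_mem_nilSub hl ((T.pr_eq_zero x).mp hx) ((T.pr_eq_zero y).mp hy))
      χ_bracket := fun x y hx hy =>
        apply_bracket_nilSub hl ((T.pr_eq_zero x).mp hx) ((T.pr_eq_zero y).mp hy)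
      χ_odd := hχ
      mulL := LinearMap.mul ℂ (SuperSym L.parity) ∘ₗ SuperSym.ι L.parity
      mulL_comm := fun i j x hx y hy u => by
        simp only [LinearMap.comp_apply, LinearMap.mul_apply']
        rw [← mul_assoc, ← mul_assoc, SuperSym.ι_comm L.parity hx hy, smul_mul_assoc]
      e := fun b => T.pr (e b)
      par := par
      e_mem := fun b => T.pr_parity _ _ (he1 b)
      pr_e := fun b => T.pr_pr _
      c := fun b => f b ∘ₗ T.pr
      c_parity := hc
      sum_c := hsum
      contr := D
      contr_mulL := fun b j y hy u => by
        simp only [LinearMap.comp_apply, LinearMap.mul_apply']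
        rw [hDm, L.twist_of_mem hy, map_smul, smul_mul_assoc]
        rfl
      F := symFil T.polyHom
      F_mono := fun k => symFil_mono _ (by omega)
      F_neg := by
        rw [eq_bot_iff]
        intro u hu
        refine eq_zero_of_symComp T.polyHom T.iSup_polyDeg T.polyHom_ι fun k => ?_
        rcases lt_or_ge k 0 with h | h
        · exact T.symComp_polyHom_neg h u
        · exact mem_symFil.mp hu k (by omega)
      F_mulL := fun k x u hu => T.mul_mem_symFil_poly x hu
      F_contr := fun k b u hu => mem_symFil_of_shift (map_zero _) (hDP b) hu
      F_euler := fun k u hu => by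
        refine mem_symFil.mpr fun m hm => ?_
        simp only [LinearMap.comp_apply, LinearMap.mul_apply']
        have h1 : ∀ b, symComp T.polyHom m (SuperSym.ι L.parity (T.pr (e b)) * D b u) =
            SuperSym.ι L.parity (T.pr (e b)) * D b (symComp T.polyHom m u) := fun b => by
          rw [symComp_mul (T.polyHom_ι 1 _ (by simpa [polyDeg] using T.pr_mem _)), hDP,
            show m - 1 - -1 = m by ring]
        rw [map_sub, map_sum, Finset.sum_congr rfl fun b _ => h1 b, hEk, map_smul, ← sub_smul]
        rcases eq_or_ne m k with rfl | h
        · simp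
        · rw [mem_symFil.mp hu m (by omega), smul_zero]
      F_exists := exists_mem_symFil T.polyHom
      A := fun w => Γ.deg (w - 2)
      A_parity := fun w i x hx => Γ.deg_parity _ i hx
      A_bracket := fun w w' x hx y hy => by
        have := Γ.bracket_mem _ _ x hx y hy
        rwa [show w - 2 + (w' - 2) = w + w' - 2 - 2 by ring] at this
      χ_A := fun w hw x hx => Γ.apply_eq_zero (w - 2) (by omega) x hx
      wt := fun b => dg b + 2
      e_wt := fun b => by rw [add_sub_cancel_right]; exact T.pr_deg _ _ (he2 b)
      K := symFil Γ.kazhdanHom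
      K_mono := fun k => symFil_mono _ (by omega)
      K_mulL := fun k w x hx u hu => mul_mem_symFil_kazhdan (T.pr_deg _ x hx) hu
      K_contr := fun k b u hu => mem_symFil_of_shift (map_zero _) (hDK b) hu }
  obtain ⟨ρ, h1, h2, h3⟩ := P.exists_rep fun w x hx => T.pr_deg _ x hx
  refine ⟨ρ, h1, h2, fun x => ?_⟩
  rw [h3 x 1 (one_mem_symFil T.polyHom)]
  change SuperSym.ι L.parity (T.pr x) * 1 + _ = _
  rw [mul_one]

end Splitting

end GoodGrading

end LieSuperalgebra

/-! ### Vanishing and membership in associated graded spaces -/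

section AssocGradedTools

variable {M : Type*} [AddCommGroup M] [Module ℂ M] {F : ℤ → Submodule ℂ M}

theorem AssocGraded.mem_of_grClass (p : Submodule ℂ (AssocGraded F))
    (hp : ∀ k q, grClass F k q ∈ p) (Y : AssocGraded F) : Y ∈ p := by
  have : p.mkQ = 0 := assocGraded_hom_ext fun k q => by simpa using hp k q
  simpa using LinearMap.congr_fun this Y

theorem AssocGraded.toModule_eq_zero {N : Type*} [AddCommGroup N] [Module ℂ N]
    (f : ∀ k : ℤ, (F k ⧸ (F (k - 1)).submoduleOf (F k)) →ₗ[ℂ] N) (Y : AssocGraded F)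
    (h : ∀ k, f k (AssocGraded.component F k Y) = 0) : AssocGraded.toModule F f Y = 0 := by
  classical
  have hs := DirectSum.sum_support_of (β := fun k : ℤ => F k ⧸ (F (k - 1)).submoduleOf (F k)) Y
  change DirectSum.toModule ℂ ℤ N f Y = 0
  rw [← hs, map_sum]
  refine Finset.sum_eq_zero fun k _ => ?_
  have := DirectSum.toModule_lof (R := ℂ) (φ := f) k (AssocGraded.component F k Y)
  rw [← h k, ← this]
  rfl

end AssocGradedTools

/-! ### The symbol map is bijective on `S(p ⊕ l')` -/

namespace LieSuperalgebra

variable {g : Type*} [AddCommGroup g] [Module ℂ g] {L : LieSuperalgebra g}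
  {χ : Module.Dual ℂ g}

/-- The homomorphism from `U(g)` that is given by a representation. -/
def UEnv.lift (L : LieSuperalgebra g) {B : Type*} [Ring B] [Algebra ℂ B] (ρ : g →ₗ[ℂ] B)
    (hρ : ∀ i j, ∀ x ∈ L.parity i, ∀ y ∈ L.parity j,
        ρ x * ρ y = koszulSign i j • (ρ y * ρ x) + ρ (L.bracket x y)) : L.UEnv →ₐ[ℂ] B :=
  RingQuot.liftAlgHom ℂ ⟨TensorAlgebra.lift ℂ ρ, by
    intro a b hab
    cases hab with
    | comm i j x y hx hy => simpa using hρ i j x hx y hy⟩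

theorem UEnv.lift_toU {B : Type*} [Ring B] [Algebra ℂ B] (ρ : g →ₗ[ℂ] B)
    (hρ : ∀ i j, ∀ x ∈ L.parity i, ∀ y ∈ L.parity j,
        ρ x * ρ y = koszulSign i j • (ρ y * ρ x) + ρ (L.bracket x y)) (x : g) :
    UEnv.lift L ρ hρ (L.toU x) = ρ x := by
  have : UEnv.lift L ρ hρ (L.mkU (TensorAlgebra.ι ℂ x)) =
      TensorAlgebra.lift ℂ ρ (TensorAlgebra.ι ℂ x) := RingQuot.liftAlgHom_mkAlgHom_apply ..
  simpa [toU] using this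

theorem toU_mul_toU {i : ZMod 2} {a : g} (ha : a ∈ L.parity i) (x : g) :
    L.toU a * L.toU x = L.toU (L.twist i x) * L.toU a + L.toU (L.bracket a x) := by
  refine L.mem_of_parity (LinearMap.eqLocus (LinearMap.mulLeft ℂ (L.toU a) ∘ₗ L.toU)
    (LinearMap.mulRight ℂ (L.toU a) ∘ₗ L.toU ∘ₗ L.twist i + L.toU ∘ₗ L.bracket a)) ?_ x
  intro j x hx
  simp only [LinearMap.mem_eqLocus, LinearMap.comp_apply, LinearMap.add_apply,
    LinearMap.mulLeft_apply, LinearMap.mulRight_apply, L.twist_of_mem hx, map_smul]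
  exact L.toU_comm ha hx

namespace GoodGrading

variable (Γ : L.GoodGrading χ) (l : Submodule ℂ g)

theorem symbolMap_one : Γ.symbolMap l 1 =
    grClass (Γ.kazhdanQ l) 0 ⟨Γ.proj l 1, 1, Γ.one_mem_kazhdanU, rfl⟩ := by
  simp [symbolMap]

theorem symbolMap_mul (x : g) (u : SuperSym L.parity) :
    Γ.symbolMap l (SuperSym.ι L.parity x * u) = Γ.grAct l x (Γ.symbolMap l u) := by
  simp only [symbolMap, LinearMap.comp_apply, AlgHom.toLinearMap_apply, map_mul,
    LinearMap.applyₗ_apply_apply, Module.End.mul_apply, SuperSym.lift_ι]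

theorem kazhdanQ_induction (k : ℤ) {p : Γ.WhittakerModule l → Prop} (h0 : p 0)
    (hadd : ∀ q q', p q → p q' → p (q + q')) (hsmul : ∀ (c : ℂ) q, p q → p (c • q))
    (hlist : ∀ s : List (ℤ × g), (∀ b ∈ s, b.2 ∈ Γ.deg b.1) →
      (s.map fun b => b.1 + 2).sum ≤ k → p (Γ.proj l (s.map fun b => L.toU b.2).prod))
    {q : Γ.WhittakerModule l} (hq : q ∈ Γ.kazhdanQ l k) : p q := by
  obtain ⟨u, hu, rfl⟩ := hq
  induction hu using Submodule.span_induction with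
  | mem u hu => obtain ⟨s, h1, h2, rfl⟩ := hu; exact hlist s h1 h2
  | zero => rw [map_zero]; exact h0
  | add u v _ _ hu hv => rw [map_add]; exact hadd _ _ hu hv
  | smul c u _ hu => rw [map_smul]; exact hsmul _ _ hu

theorem proj_prod_cons (b : ℤ × g) (s : List (ℤ × g)) :
    Γ.proj l ((b :: s).map fun b => L.toU b.2).prod =
      Γ.actQ l b.2 (Γ.proj l (s.map fun b => L.toU b.2).prod) := by
  rw [List.map_cons, List.prod_cons, actQ_apply, ← map_smul, smul_eq_mul]

/-- The filtration is spanned by ordered products of homogeneous elements. Those whose degree is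
exactly `k` have symbols of monomials as classes, the others have class zero. -/
theorem symbolMap_surjective : Function.Surjective (Γ.symbolMap l) := by
  intro Y
  have key : ∀ s : List (ℤ × g), (∀ b ∈ s, b.2 ∈ Γ.deg b.1) → ∀ k,
      k = (s.map fun b => b.1 + 2).sum →
      ∃ h : Γ.proj l (s.map fun b => L.toU b.2).prod ∈ Γ.kazhdanQ l k,
        grClass (Γ.kazhdanQ l) k ⟨_, h⟩ ∈ LinearMap.range (Γ.symbolMap l) := by
    intro s
    induction s with
    | nil =>
      rintro - k rfl
      exact ⟨⟨1, Γ.one_mem_kazhdanU, rfl⟩, 1, Γ.symbolMap_one l⟩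
    | cons b s ih =>
      rintro hs k rfl
      obtain ⟨h, v, hv⟩ := ih (fun c hc => hs c (List.mem_cons_of_mem _ hc)) _ rfl
      have hb := hs b List.mem_cons_self
      have hmem := Γ.actQ_mem l hb _ _ h
      have e : (s.map fun b => b.1 + 2).sum + (b.1 + 2) =
          ((b :: s).map fun b => b.1 + 2).sum := by
        rw [List.map_cons, List.sum_cons, add_comm]
      simp only [proj_prod_cons]
      refine ⟨e ▸ hmem, SuperSym.ι L.parity b.2 * v, ?_⟩
      rw [symbolMap_mul, hv, Γ.grAct_of_mem l hb, grOperator_grClass]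
      exact grClass_congr _ e _ _ _
  suffices H : ∀ k (q : Γ.kazhdanQ l k), grClass (Γ.kazhdanQ l) k q ∈
      LinearMap.range (Γ.symbolMap l) from AssocGraded.mem_of_grClass _ H Y
  rintro k ⟨q, hq⟩
  have : ∃ h : q ∈ Γ.kazhdanQ l k, grClass (Γ.kazhdanQ l) k ⟨q, h⟩ ∈
      LinearMap.range (Γ.symbolMap l) := by
    refine Γ.kazhdanQ_induction l k (p := fun q => ∃ h : q ∈ Γ.kazhdanQ l k,
      grClass (Γ.kazhdanQ l) k ⟨q, h⟩ ∈ LinearMap.range (Γ.symbolMap l)) ?_ ?_ ?_ ?_ hq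
    · refine ⟨zero_mem _, ?_⟩
      rw [grClass_eq_zero _ _ (zero_mem _)]
      exact zero_mem _
    · rintro q q' ⟨h, h'⟩ ⟨h1, h1'⟩
      exact ⟨add_mem h h1, by
        have := add_mem h' h1'
        rwa [← grClass_add] at this⟩
    · rintro c q ⟨h, h'⟩
      exact ⟨Submodule.smul_mem _ c h, by
        have := Submodule.smul_mem _ c h'
        rwa [← grClass_smul] at this⟩
    · intro s hs hk
      obtain ⟨h, h'⟩ := key s hs _ rfl
      rcases hk.eq_or_lt with rfl | hlt
      · exact ⟨h, h'⟩
      · refine ⟨Γ.kazhdanQ_mono l hk h, ?_⟩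
        rw [grClass_eq_zero _ _ (Γ.kazhdanQ_mono l (by omega) h)]
        exact zero_mem _
  exact this.2

theorem proj_toU {a : g} (ha : a ∈ Γ.nilSub l) : Γ.actQ l a (Γ.proj l 1) = χ a • Γ.proj l 1 := by
  have h : L.toU a - algebraMap ℂ L.UEnv (χ a) ∈ Γ.whittakerIdeal l :=
    Submodule.subset_span ⟨a, ha, rfl⟩
  have h' := (Submodule.Quotient.mk_eq_zero _).mpr h
  rw [actQ_apply, ← algebraMap_smul L.UEnv (χ a), ← map_smul, ← map_smul, ← sub_eq_zero, ← map_sub,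
    smul_eq_mul, smul_eq_mul, mul_one, mul_one]
  exact h'

namespace Splitting

variable {Γ l} {l' : Submodule ℂ g} (T : Γ.Splitting l l')

/-- The functional is supported in degree `-2`, and `g_{-2}` lies in `m`. -/
theorem apply_eq_zero_of_pr {x : g} (hx : T.pr x = x) : χ x = 0 := by
  suffices H : ∀ x, χ (T.pr x) = 0 by rw [← hx]; exact H x
  refine mem_of_internal Γ.isInternal (LinearMap.ker (χ ∘ₗ T.pr)) fun j x hx => ?_
  rw [LinearMap.mem_ker, LinearMap.comp_apply]
  by_cases hj : j = -2
  · rw [(T.pr_eq_zero x).mpr (deg_le_nilSub hj.le hx), map_zero]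
  · exact Γ.apply_eq_zero j hj _ (T.pr_deg j x hx)

theorem pr_internalProj (j : ℤ) (x : g) :
    T.pr (internalProj Γ.isInternal j x) = internalProj Γ.isInternal j (T.pr x) :=
  (internalProj_comm Γ.isInternal T.pr T.pr_deg j x).symm

/-- The symbol map has a left inverse on `S(p ⊕ l')`. -/
theorem exists_leftInverse (T : Γ.Splitting l l') [FiniteDimensional ℂ g] (hχ : L.IsEvenFunctional χ)
    (hl : Γ.IsIsotropic l) (hl' : L.IsSubsuperspace l') :
    ∃ Ψ : Γ.GrQ l →ₗ[ℂ] SuperSym L.parity, ∀ X ∈ L.symSub (Γ.posSub l'),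
      Ψ (Γ.symbolMap l X) = X := by
  obtain ⟨ρ, h1, h2, h3⟩ := T.exists_rep hχ hl hl'
  let R := UEnv.lift L ρ h1
  have hR : ∀ x, R (L.toU x) = ρ x := UEnv.lift_toU ρ h1
  let ev0 : L.UEnv →ₗ[ℂ] SuperSym L.parity :=
    LinearMap.applyₗ (1 : SuperSym L.parity) ∘ₗ R.toLinearMap
  -- Since `ρ a 1 = χ(a)` for `a ∈ m`, evaluation at `1` descends to `U(g)/I_χ`.
  have hev0 : (Γ.whittakerIdeal l).restrictScalars ℂ ≤ LinearMap.ker ev0 := by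
    intro u hu
    rw [Submodule.restrictScalars_mem] at hu
    rw [LinearMap.mem_ker]
    change R u 1 = 0
    induction hu using Submodule.span_induction with
    | mem u hu =>
      obtain ⟨a, ha, rfl⟩ := hu
      rw [map_sub, hR, LinearMap.sub_apply, h3, (T.pr_eq_zero a).mpr ha, AlgHom.commutes]
      simp
    | zero => simp
    | add u v _ _ hu hv => rw [map_add, LinearMap.add_apply, hu, hv, add_zero]
    | smul r u _ hu => rw [smul_eq_mul, map_mul, Module.End.mul_apply, hu, map_zero]
  let ev : Γ.WhittakerModule l →ₗ[ℂ] SuperSym L.parity :=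
    ((Γ.whittakerIdeal l).restrictScalars ℂ).liftQ ev0 hev0 ∘ₗ
      (Submodule.Quotient.restrictScalarsEquiv ℂ (Γ.whittakerIdeal l)).symm.toLinearMap
  have hev : ∀ u, ev (Γ.proj l u) = R u 1 := fun u => rfl
  have hevx : ∀ x q, ev (Γ.actQ l x q) = ρ x (ev q) := by
    intro x q
    obtain ⟨u, rfl⟩ := (Γ.whittakerIdeal l).mkQ_surjective q
    change ev (Γ.actQ l x (Γ.proj l u)) = ρ x (ev (Γ.proj l u))
    rw [actQ_apply, ← map_smul, hev, hev, smul_eq_mul, map_mul, hR, Module.End.mul_apply]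
  have hρF : ∀ j, ∀ x ∈ Γ.deg j, ∀ k, ∀ f ∈ symFil Γ.kazhdanHom k,
      ρ x f ∈ symFil Γ.kazhdanHom (k + (j + 2)) := by
    intro j x hx k f hf
    have e1 := symFil_mono Γ.kazhdanHom (by omega)
      (h2 k (j + 2) x (by rwa [add_sub_cancel_right]) f hf) (k' := k + (j + 2))
    have e2 : SuperSym.ι L.parity (T.pr x) * f ∈ symFil Γ.kazhdanHom (k + (j + 2)) :=
      mul_mem_symFil_kazhdan (by rw [add_sub_cancel_right]; exact T.pr_deg j x hx) hf
    have e3 : χ x • f ∈ symFil Γ.kazhdanHom (k + (j + 2)) := by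
      by_cases hj : j = -2
      · subst hj; simpa using Submodule.smul_mem _ _ hf
      · rw [Γ.apply_eq_zero j hj x hx, zero_smul]; exact zero_mem _
    have := add_mem e1 (add_mem e2 e3)
    rwa [sub_add_cancel] at this
  have hevF : ∀ k, ∀ q ∈ Γ.kazhdanQ l k, ev q ∈ symFil Γ.kazhdanHom k := by
    intro k q hq
    refine Γ.kazhdanQ_induction l k (p := fun q => ev q ∈ symFil Γ.kazhdanHom k) ?_ ?_ ?_ ?_ hq
    · rw [map_zero]; exact zero_mem _
    · intro q q' h h'; rw [map_add]; exact add_mem h h'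
    · intro c q h; rw [map_smul]; exact Submodule.smul_mem _ _ h
    · intro s hs hk
      refine symFil_mono _ hk ?_
      clear hk hq
      induction s with
      | nil =>
        rw [hev]
        simpa using one_mem_symFil Γ.kazhdanHom
      | cons b s ih =>
        rw [proj_prod_cons, hevx, List.map_cons, List.sum_cons, add_comm]
        exact hρF _ _ (hs b List.mem_cons_self) _ _
          (ih fun c hc => hs c (List.mem_cons_of_mem _ hc))
  -- The symbol of the evaluation map: a class in degree `k` goes to the Kazhdan component of degree
  -- `k`, which vanishes on the previous filtration step.
  let Ψ : Γ.GrQ l →ₗ[ℂ] SuperSym L.parity := AssocGraded.toModule _ fun k =>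
    Submodule.liftQ _ (symComp Γ.kazhdanHom k ∘ₗ ev ∘ₗ (Γ.kazhdanQ l k).subtype) (by
      intro q hq
      exact mem_symFil.mp (hevF (k - 1) q hq) k (by omega))
  have hΨ : ∀ k q, Ψ (grClass (Γ.kazhdanQ l) k q) = symComp Γ.kazhdanHom k (ev q) := by
    intro k q
    simp only [Ψ, grClass, AssocGraded.toModule_of]
    rfl
  -- On `p ⊕ l'` the leading term of `ρ x` is plain multiplication, so `Ψ` carries the symbol action
  -- to multiplication.
  have hΨx : ∀ j, ∀ x ∈ Γ.deg j, T.pr x = x → ∀ Y,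
      Ψ (Γ.grAct l x Y) = SuperSym.ι L.parity x * Ψ Y := by
    intro j x hx hpr Y
    refine AssocGraded.mem_of_grClass (LinearMap.eqLocus (Ψ ∘ₗ Γ.grAct l x)
      (LinearMap.mulLeft ℂ (SuperSym.ι L.parity x) ∘ₗ Ψ)) (fun k q => ?_) Y
    rw [LinearMap.mem_eqLocus, LinearMap.comp_apply, LinearMap.comp_apply,
      LinearMap.mulLeft_apply, Γ.grAct_of_mem l hx, grOperator_grClass, hΨ, hΨ, hevx]
    have hx' : x ∈ Γ.deg (j + 2 - 2) := by rwa [add_sub_cancel_right]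
    have e1 := h2 k (j + 2) x hx' _ (hevF k q q.2)
    rw [hpr, T.apply_eq_zero_of_pr hpr, zero_smul, add_zero] at e1
    have e2 := mem_symFil.mp e1 (k + (j + 2)) (by omega)
    rw [map_sub, sub_eq_zero, symComp_mul (Γ.kazhdanHom_ι hx'), add_sub_cancel_right] at e2
    exact e2
  refine ⟨Ψ, fun X hX => ?_⟩
  refine adjoin_subset_of_mul_mem (LinearMap.eqLocus (Ψ ∘ₗ Γ.symbolMap l) LinearMap.id) ?_ ?_ hX
  · rw [LinearMap.mem_eqLocus, LinearMap.comp_apply, symbolMap_one, hΨ, hev, map_one R,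
      Module.End.one_apply, symComp_one, if_pos rfl, LinearMap.id_apply]
  · rintro _ ⟨x, hx, rfl⟩ u hu
    rw [LinearMap.mem_eqLocus, LinearMap.comp_apply, LinearMap.id_apply] at hu ⊢
    obtain ⟨s, hs⟩ := exists_internalProj_sum Γ.isInternal x
    rw [← hs, map_sum, Finset.sum_mul, map_sum, map_sum]
    refine Finset.sum_congr rfl fun j _ => ?_
    rw [symbolMap_mul, hΨx j _ (internalProj_mem _ _ _)
      (by rw [T.pr_internalProj, T.pr_eq_self x hx]), hu]

/-! ### The reduction `S(g) → S(p ⊕ l')` modulo `a - χ(a)`, `a ∈ m` -/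

/-- The algebra homomorphism `S(g) → S(g)` with `x ↦ x` on `p ⊕ l'` and `a ↦ χ(a)` on `m`. -/
theorem exists_reduction (hχ : L.IsEvenFunctional χ) :
    ∃ P : SuperSym L.parity →ₐ[ℂ] SuperSym L.parity, ∀ x,
      P (SuperSym.ι L.parity x) =
        SuperSym.ι L.parity (T.pr x) + algebraMap ℂ (SuperSym L.parity) (χ x) := by
  have hs : ∀ {i j : ZMod 2} {x : g}, x ∈ L.parity i → koszulSign i j * χ x = χ x := by
    intro i j x hx
    rcases zmod_two_cases i with rfl | rfl
    · simp
    · simp [hχ x hx]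
  refine ⟨SuperSym.lift (SuperSym.ι L.parity ∘ₗ T.pr +
    Algebra.linearMap ℂ (SuperSym L.parity) ∘ₗ χ) ?_, fun x => by
      rw [SuperSym.lift_ι]; rfl⟩
  intro i j x y hx hy
  have h1 := SuperSym.ι_comm L.parity (T.pr_parity i x hx) (T.pr_parity j y hy)
  have h2 := hs (j := j) hx
  have h3 := hs (j := i) hy
  rw [koszulSign_comm] at h3
  have h4 : koszulSign i j * (χ x * χ y) = χ x * χ y := by rw [← mul_assoc, h2]
  simp only [LinearMap.add_apply, LinearMap.comp_apply, Algebra.linearMap_apply,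
    Algebra.algebraMap_eq_smul_one, add_mul, mul_add, smul_mul_assoc, mul_smul_comm, one_mul,
    mul_one, smul_add, smul_smul, h1, h2, h3]
  rw [mul_comm (χ y), h4]
  abel

/-- On symbols `m` acts through `χ`: this holds at the class of `π(1)`, and supercommutativity of
the symbol action moves `a` past all other factors. -/
theorem grAct_eq (hχ : L.IsEvenFunctional χ) (x : g) (Y : Γ.GrQ l) :
    Γ.grAct l x Y = Γ.grAct l (T.pr x) Y + χ x • Y := by
  obtain ⟨u, rfl⟩ := Γ.symbolMap_surjective l Y
  have key : ∀ j i, ∀ a ∈ Γ.deg j, a ∈ L.parity i → a ∈ Γ.nilSub l → ∀ u,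
      Γ.grAct l a (Γ.symbolMap l u) = χ a • Γ.symbolMap l u := by
    intro j i a haj hai ha u
    refine SuperSym.mem_of_homogeneous_mul_mem L.isInternal.submodule_iSup_eq_top
      (LinearMap.eqLocus (Γ.grAct l a ∘ₗ Γ.symbolMap l) (χ a • Γ.symbolMap l)) ?_ ?_ u
    · rw [LinearMap.mem_eqLocus, LinearMap.comp_apply, LinearMap.smul_apply, symbolMap_one,
        Γ.grAct_of_mem l haj, grOperator_grClass]
      simp only [Γ.proj_toU l ha]
      -- Only for `j = -2` does the operator have degree zero, so that it can act by a nonzero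
      -- scalar; otherwise `χ a = 0`.
      by_cases hj : j = -2
      · subst hj
        rw [← grClass_smul]
        exact grClass_congr _ (by norm_num) _ _ _
      · have h0 := Γ.apply_eq_zero j hj a haj
        rw [show ∀ Y : Γ.GrQ l, χ a • Y = 0 from fun Y => by rw [h0, zero_smul]]
        refine grClass_eq_zero _ _ ?_
        change χ a • Γ.proj l 1 ∈ _
        rw [h0, zero_smul]
        exact zero_mem _
    · intro k x hx u hu
      rw [LinearMap.mem_eqLocus, LinearMap.comp_apply, LinearMap.smul_apply] at hu ⊢
      rw [symbolMap_mul, ← Module.End.mul_apply, Γ.grAct_comm l i k a x hai hx,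
        LinearMap.smul_apply, Module.End.mul_apply, hu, map_smul, smul_smul]
      rcases zmod_two_cases i with rfl | rfl
      · simp
      · simp [hχ a hai]
  refine Γ.mem_of_homogeneous (LinearMap.eqLocus
    (LinearMap.applyₗ (Γ.symbolMap l u) ∘ₗ Γ.grAct l)
    (LinearMap.applyₗ (Γ.symbolMap l u) ∘ₗ Γ.grAct l ∘ₗ T.pr + χ.smulRight (Γ.symbolMap l u))) ?_ x
  intro j i x hxj hxi
  have h := key j i (x - T.pr x) (sub_mem hxj (T.pr_deg j x hxj))
    (sub_mem hxi (T.pr_parity i x hxi)) ((T.pr_eq_zero _).mp (T.pr_sub x)) u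
  rw [map_sub χ, T.apply_eq_zero_of_pr (T.pr_pr x), sub_zero, map_sub, LinearMap.sub_apply,
    sub_eq_iff_eq_add'] at h
  exact h

theorem symbolMap_reduction (hχ : L.IsEvenFunctional χ)
    {P : SuperSym L.parity →ₐ[ℂ] SuperSym L.parity} (hP : ∀ x, P (SuperSym.ι L.parity x) =
        SuperSym.ι L.parity (T.pr x) + algebraMap ℂ (SuperSym L.parity) (χ x))
    (u : SuperSym L.parity) : Γ.symbolMap l (P u) = Γ.symbolMap l u := by
  refine SuperSym.mem_of_mul_mem
    (LinearMap.eqLocus (Γ.symbolMap l ∘ₗ P.toLinearMap) (Γ.symbolMap l)) (by simp) ?_ u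
  intro x u hu
  rw [LinearMap.mem_eqLocus, LinearMap.comp_apply, AlgHom.toLinearMap_apply] at hu ⊢
  rw [map_mul, hP, add_mul, map_add, symbolMap_mul, ← Algebra.smul_def, map_smul, hu,
    symbolMap_mul, ← T.grAct_eq hχ]

theorem reduction_mem {P : SuperSym L.parity →ₐ[ℂ] SuperSym L.parity}
    (hP : ∀ x, P (SuperSym.ι L.parity x) =
        SuperSym.ι L.parity (T.pr x) + algebraMap ℂ (SuperSym L.parity) (χ x))
    (u : SuperSym L.parity) : P u ∈ L.symSub (Γ.posSub l') := by
  refine SuperSym.mem_of_mul_mem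
    ((Subalgebra.toSubmodule (L.symSub (Γ.posSub l'))).comap P.toLinearMap) ?_ ?_ u
  · simp
  · intro x u hu
    simp only [Submodule.mem_comap, AlgHom.toLinearMap_apply, Subalgebra.mem_toSubmodule,
      map_mul, hP] at hu ⊢
    exact mul_mem (add_mem (Algebra.subset_adjoin ⟨_, T.pr_mem x, rfl⟩)
      (Subalgebra.algebraMap_mem _ _)) hu

/-- The identification of `S(p ⊕ l')` with `Gr_K (U(g) / I_χ)`. -/
theorem bijOn_symbolMap (T : Γ.Splitting l l') [FiniteDimensional ℂ g] (hχ : L.IsEvenFunctional χ)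
    (hl : Γ.IsIsotropic l) (hl' : L.IsSubsuperspace l') :
    Set.BijOn (Γ.symbolMap l) (L.symSub (Γ.posSub l')) Set.univ := by
  refine ⟨fun _ _ => Set.mem_univ _, ?_, ?_⟩
  · obtain ⟨Ψ, hΨ⟩ := T.exists_leftInverse hχ hl hl'
    intro X hX Y hY h
    rw [← hΨ X hX, ← hΨ Y hY, h]
  · intro Y _
    obtain ⟨u, rfl⟩ := Γ.symbolMap_surjective l Y
    obtain ⟨P, hP⟩ := T.exists_reduction hχ
    -- Any symbol comes from some `u ∈ S(g)`, and the reduction replaces `u` by an element of `S(p ⊕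
    -- l')` with the same symbol.
    exact ⟨P u, T.reduction_mem hP u, T.symbolMap_reduction hχ hP u⟩

end Splitting

end GoodGrading

end LieSuperalgebra

namespace LieSuperalgebra

variable {g : Type*} [AddCommGroup g] [Module ℂ g] {L : LieSuperalgebra g}
  {χ : Module.Dual ℂ g}

/-! ### Kernels of contractions -/

/-- An element of `S(N)` that is killed by the contraction with `ξ` lies in `S(N ∩ ker ξ)`. -/
theorem mem_symSub_inf_ker {N : Submodule ℂ g}
    (hN : ∀ i, ∀ x ∈ N, internalProj L.isInternal i x ∈ N) {p : ZMod 2} {ξ : Module.Dual ℂ g}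
    (hξ : ∀ j, ∀ x ∈ L.parity j, j ≠ p → ξ x = 0)
    {D : SuperSym L.parity →ₗ[ℂ] SuperSym L.parity} (hD1 : D 1 = 0)
    (hD : ∀ x u, D (SuperSym.ι L.parity x * u) =
      ξ x • u + SuperSym.ι L.parity (L.twist p x) * D u)
    {X : SuperSym L.parity} (hX : X ∈ L.symSub N) (hDX : D X = 0) :
    X ∈ L.symSub (N ⊓ LinearMap.ker ξ) := by
  by_cases hle : N ≤ LinearMap.ker ξ
  · rwa [inf_eq_left.mpr hle]
  -- If `ξ` does not vanish on `N`, a homogeneous `c` complements `N ∩ ker ξ` in `N`.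
  obtain ⟨c, hcN, hcp, hc1⟩ : ∃ c ∈ N, c ∈ L.parity p ∧ ξ c = 1 := by
    obtain ⟨c0, hc0, hc0'⟩ := SetLike.not_le_iff_exists.mp hle
    have h1 : ξ (internalProj L.isInternal p c0) = ξ c0 := by
      conv_rhs => rw [← L.sum_internalProj_parity c0, map_add]
      rcases zmod_two_cases p with rfl | rfl
      · rw [hξ 1 _ (internalProj_mem _ _ _) (by decide), add_zero]
      · rw [hξ 0 _ (internalProj_mem _ _ _) (by decide), zero_add]
    refine ⟨(ξ c0)⁻¹ • internalProj L.isInternal p c0, N.smul_mem _ (hN p c0 hc0),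
      Submodule.smul_mem _ _ (internalProj_mem _ _ _), ?_⟩
    rw [map_smul, h1, smul_eq_mul, inv_mul_cancel₀ hc0']
  -- This operator counts the factors `c`. Being an even derivation, it treats even and odd `c`
  -- alike.
  let E : Module.End ℂ (SuperSym L.parity) := LinearMap.mulLeft ℂ (SuperSym.ι L.parity c) ∘ₗ D
  have hE : ∀ u, E u = SuperSym.ι L.parity c * D u := fun u => rfl
  have hEm : ∀ x u, E (SuperSym.ι L.parity x * u) =
      ξ x • (SuperSym.ι L.parity c * u) + SuperSym.ι L.parity x * E u := by
    intro x u
    rw [hE, hE, hD, mul_add, mul_smul_comm, ← mul_assoc, ← mul_assoc]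
    congr 2
    refine L.mem_of_parity (LinearMap.eqLocus
      (LinearMap.mulLeft ℂ (SuperSym.ι L.parity c) ∘ₗ SuperSym.ι L.parity ∘ₗ L.twist p)
      (LinearMap.mulRight ℂ (SuperSym.ι L.parity c) ∘ₗ SuperSym.ι L.parity)) ?_ x
    intro j x hx
    simp only [LinearMap.mem_eqLocus, LinearMap.comp_apply, LinearMap.mulLeft_apply,
      LinearMap.mulRight_apply, L.twist_of_mem hx, map_smul, SuperSym.ι_comm L.parity hcp hx,
      smul_smul, koszulSign_mul_self, one_smul]
  set N' := N ⊓ LinearMap.ker ξ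
  have hE0 : ∀ u ∈ L.symSub N', E u = 0 := by
    intro u hu
    refine adjoin_subset_of_mul_mem (LinearMap.ker E) ?_ ?_ hu
    · rw [LinearMap.mem_ker, hE, hD1, mul_zero]
    · rintro _ ⟨x, hx, rfl⟩ u hu
      rw [LinearMap.mem_ker] at hu ⊢
      rw [hEm, hu, (LinearMap.mem_ker.mp hx.2 : ξ x = 0)]
      simp
  -- Zero factors `c`, or `n + 1` of them. The submodule is stable under multiplication by `N'` and
  -- by `c`, so it contains `S(N)`.
  let p' : Submodule ℂ (SuperSym L.parity) := Subalgebra.toSubmodule (L.symSub N') ⊔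
    ⨆ n : ℕ, E.eigenspace ((n : ℂ) + 1)
  have hk : ∀ x ∈ N', p' ≤ p'.comap (LinearMap.mulLeft ℂ (SuperSym.ι L.parity x)) := by
    intro x hx
    refine sup_le (fun u hu => le_sup_left (α := Submodule ℂ (SuperSym L.parity)) ?_)
      (iSup_le fun n u hu => le_sup_right (α := Submodule ℂ (SuperSym L.parity))
        (Submodule.mem_iSup_of_mem n ?_))
    · exact (L.symSub N').mul_mem (Algebra.subset_adjoin ⟨x, hx, rfl⟩) hu
    · rw [Module.End.mem_eigenspace_iff] at hu ⊢
      rw [LinearMap.mulLeft_apply, hEm, hu, (LinearMap.mem_ker.mp hx.2 : ξ x = 0), zero_smul,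
        zero_add, mul_smul_comm]
  have hc : p' ≤ p'.comap (LinearMap.mulLeft ℂ (SuperSym.ι L.parity c)) := by
    refine sup_le (fun u hu => le_sup_right (α := Submodule ℂ (SuperSym L.parity))
        (Submodule.mem_iSup_of_mem 0 ?_))
      (iSup_le fun n u hu => le_sup_right (α := Submodule ℂ (SuperSym L.parity))
        (Submodule.mem_iSup_of_mem (n + 1) ?_))
    · rw [Module.End.mem_eigenspace_iff, LinearMap.mulLeft_apply, hEm, hE0 u hu, hc1]
      simp
    · rw [Module.End.mem_eigenspace_iff] at hu ⊢
      rw [LinearMap.mulLeft_apply, hEm, hu, hc1, mul_smul_comm]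
      push_cast
      module
  have hXp : X ∈ p' := by
    refine adjoin_subset_of_mul_mem p' ?_ ?_ hX
    · exact Submodule.mem_sup_left (one_mem (L.symSub N'))
    · rintro _ ⟨x, hx, rfl⟩ u hu
      rw [← sub_add_cancel x (ξ x • c), map_add, add_mul, map_smul, smul_mul_assoc]
      refine add_mem (hk _ ⟨sub_mem hx (N.smul_mem _ hcN), ?_⟩ hu) (p'.smul_mem _ (hc hu))
      change ξ (x - ξ x • c) = 0
      rw [map_sub, map_smul, hc1, smul_eq_mul, mul_one, sub_self]
  obtain ⟨Y, hY, Z, hZ, rfl⟩ := Submodule.mem_sup.mp hXp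
  have hYE := hE0 Y hY
  have hEZ : E Z = 0 := by
    have : E (Y + Z) = 0 := by rw [hE, hDX, mul_zero]
    rwa [map_add, hYE, zero_add] at this
  -- In characteristic zero no eigenvalue `n + 1` is zero, so the part of `X` outside `S(N')`, being
  -- killed by `E`, vanishes.
  have hdisj := Module.End.eigenspaces_iSupIndep E 0
  have hZ' : Z ∈ ⨆ (μ : ℂ) (_ : μ ≠ 0), E.eigenspace μ := by
    refine (iSup_le fun n => ?_ : ⨆ n : ℕ, E.eigenspace ((n : ℂ) + 1) ≤ _) hZ
    exact le_iSup₂_of_le ((n : ℂ) + 1) (Nat.cast_add_one_ne_zero n) le_rfl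
  have hZ0 : Z = 0 := Submodule.disjoint_def.mp hdisj Z
    (by rw [Module.End.mem_eigenspace_iff, hEZ, zero_smul]) hZ'
  rw [hZ0, add_zero]
  exact hY

namespace GoodGrading

variable (Γ : L.GoodGrading χ)

/-! ### The form `χ([x, y])` -/

theorem apply_bracket_parity (hχ : L.IsEvenFunctional χ) {i j : ZMod 2} (hij : i ≠ j) {x y : g}
    (hx : x ∈ L.parity i) (hy : y ∈ L.parity j) : χ (L.bracket x y) = 0 := by
  refine hχ _ ?_
  have := L.bracket_mem i j x hx y hy
  rcases zmod_two_cases i with rfl | rfl <;> rcases zmod_two_cases j with rfl | rfl <;>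
    simp_all

theorem apply_bracket_swap (hχ : L.IsEvenFunctional χ) {i : ZMod 2} (x : g) {y : g}
    (hy : y ∈ L.parity i) : χ (L.bracket x y) = -(koszulSign i i * χ (L.bracket y x)) := by
  refine L.mem_of_parity (LinearMap.eqLocus (χ ∘ₗ L.bracket.flip y)
    (-(koszulSign i i • (χ ∘ₗ L.bracket y)))) ?_ x
  intro j x hx
  simp only [LinearMap.mem_eqLocus, LinearMap.comp_apply, LinearMap.flip_apply,
    LinearMap.neg_apply, LinearMap.smul_apply]
  by_cases h : j = i
  · subst h
    rw [L.skew j j x hx y hy, map_neg, map_smul]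
  · rw [apply_bracket_parity hχ h hx hy, apply_bracket_parity hχ (Ne.symm h) hy hx]
    simp

/-- The form is even, so the parity projections are self-adjoint for it. -/
theorem apply_bracket_internalProj_parity (hχ : L.IsEvenFunctional χ) (i : ZMod 2) (x y : g) :
    χ (L.bracket x (internalProj L.isInternal i y)) =
      χ (L.bracket (internalProj L.isInternal i x) y) := by
  refine L.mem_of_parity (LinearMap.eqLocus (χ ∘ₗ L.bracket.flip (internalProj L.isInternal i y))
    (χ ∘ₗ L.bracket.flip y ∘ₗ internalProj L.isInternal i)) ?_ x
  intro j x hx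
  refine L.mem_of_parity (LinearMap.eqLocus (χ ∘ₗ L.bracket x ∘ₗ internalProj L.isInternal i)
    (χ ∘ₗ L.bracket (internalProj L.isInternal i x))) ?_ y
  intro k y hy
  simp only [LinearMap.mem_eqLocus, LinearMap.comp_apply]
  by_cases h : j = i
  · subst h
    by_cases h' : k = j
    · subst h'
      rw [internalProj_same _ hx, internalProj_same _ hy]
    · rw [internalProj_same _ hx, internalProj_ne _ h' hy, map_zero, map_zero,
        apply_bracket_parity hχ (Ne.symm h') hx hy]
  · rw [internalProj_ne _ h hx]
    by_cases h' : k = i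
    · subst h'
      rw [internalProj_same _ hy, apply_bracket_parity hχ h hx hy]
      simp
    · rw [internalProj_ne _ h' hy]
      simp

theorem apply_bracket_deg {i j : ℤ} (hij : i + j ≠ -2) {x y : g} (hx : x ∈ Γ.deg i)
    (hy : y ∈ Γ.deg j) : χ (L.bracket x y) = 0 :=
  Γ.apply_eq_zero _ hij _ (Γ.bracket_mem i j x hx y hy)

theorem apply_bracket_internalProj {j : ℤ} {y : g} (hy : y ∈ Γ.deg j) (x : g) :
    χ (L.bracket (internalProj Γ.isInternal (-2 - j) x) y) = χ (L.bracket x y) := by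
  refine mem_of_internal Γ.isInternal (LinearMap.eqLocus
    (χ ∘ₗ L.bracket.flip y ∘ₗ internalProj Γ.isInternal (-2 - j)) (χ ∘ₗ L.bracket.flip y)) ?_ x
  intro k x hx
  simp only [LinearMap.mem_eqLocus, LinearMap.comp_apply, LinearMap.flip_apply]
  by_cases h : k = -2 - j
  · subst h
    rw [internalProj_same _ hx]
  · rw [internalProj_ne _ h hx, Γ.apply_bracket_deg (by omega) hx hy]
    simp

theorem apply_bracket_internalProj_right {j : ℤ} {y : g} (hy : y ∈ Γ.deg j) (x : g) :
    χ (L.bracket y (internalProj Γ.isInternal (-2 - j) x)) = χ (L.bracket y x) := by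
  refine mem_of_internal Γ.isInternal (LinearMap.eqLocus
    (χ ∘ₗ L.bracket y ∘ₗ internalProj Γ.isInternal (-2 - j)) (χ ∘ₗ L.bracket y)) ?_ x
  intro k x hx
  simp only [LinearMap.mem_eqLocus, LinearMap.comp_apply]
  by_cases h : k = -2 - j
  · subst h
    rw [internalProj_same _ hx]
  · rw [internalProj_ne _ h hx, Γ.apply_bracket_deg (by omega) hy hx]
    simp

section Orthogonal

variable {Γ} {l l' : Submodule ℂ g}

/-- The elements of `p ⊕ l'` that are orthogonal to `m`. -/
theorem sub_mem_annihilator (hχ : L.IsEvenFunctional χ) (hl' : l' ≤ Γ.deg (-1)) {x : g}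
    (hx : x ∈ Γ.posSub l') (hxm : ∀ j i a, a ∈ Γ.deg j → a ∈ L.parity i → a ∈ Γ.nilSub l →
      χ (L.bracket a x) = 0) :
    x - internalProj Γ.isInternal (-1) x ∈ L.annihilator χ := by
  intro y
  refine Γ.mem_of_homogeneous (LinearMap.ker
    (χ ∘ₗ L.bracket (x - internalProj Γ.isInternal (-1) x))) ?_ y
  intro k i y hyk hyi
  rw [LinearMap.mem_ker, LinearMap.comp_apply]
  have hv : internalProj Γ.isInternal (-1) x ∈ Γ.deg (-1) := internalProj_mem _ _ _
  -- In degrees below `-1` the element `y` lies in `m`. In degree `-1` it pairs only with the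
  -- component that was removed. Above, it would pair with a component of degree below `-1`, and `x`
  -- has none.
  rcases lt_trichotomy k (-1) with hk | hk | hk
  · rw [map_sub, LinearMap.sub_apply, map_sub, Γ.apply_bracket_deg (by omega) hv hyk, sub_zero,
      apply_bracket_swap hχ x hyi, hxm k i y hyk hyi (deg_le_nilSub (by omega) hyk)]
    simp
  · rw [← Γ.apply_bracket_internalProj hyk, hk, show (-2 - -1 : ℤ) = -1 by norm_num, map_sub,
      internalProj_same _ hv, sub_self]
    simp
  · have h1 := internalProj_posSub hl' (-2 - k) (by omega) hx
    rw [if_neg (by omega), Submodule.mem_bot] at h1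
    rw [← Γ.apply_bracket_internalProj hyk, map_sub, h1, internalProj_ne _ (by omega) hv]
    simp

/-- An element of `l` pairs only with the degree `-1` component of `x`, so orthogonality to `m`
passes to that component. -/
theorem orthogonal_of_posSub (hl : Γ.IsIsotropic l) {x : g}
    (hxm : ∀ j i a, a ∈ Γ.deg j → a ∈ L.parity i → a ∈ Γ.nilSub l →
      χ (L.bracket a x) = 0) {a : g} (ha : a ∈ l) :
    χ (L.bracket a (internalProj Γ.isInternal (-1) x)) = 0 := by
  have h1 : ∀ i, χ (L.bracket (internalProj L.isInternal i a)
      (internalProj Γ.isInternal (-1) x)) = 0 := by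
    intro i
    have hi : internalProj L.isInternal i a ∈ l := IsSubsuperspace.internalProj_mem L hl.2.1 i ha
    have := Γ.apply_bracket_internalProj_right (hl.1 hi) x
    rw [show (-2 - -1 : ℤ) = -1 by norm_num] at this
    rw [this]
    exact hxm (-1) i _ (hl.1 hi) (internalProj_mem _ _ _)
      (le_sup_right (a := ⨆ (j : ℤ) (_ : j ≤ -2), Γ.deg j) hi)
  rw [← L.sum_internalProj_parity a, map_add, LinearMap.add_apply, map_add, h1, h1, add_zero]

variable (hχ : L.IsEvenFunctional χ) (hl : Maximal Γ.IsIsotropic l)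
  (hl' : L.IsSubsuperspace l') (hsup : l ⊔ l' = Γ.deg (-1)) (hdisj : Disjoint l l')

include hχ hl hsup hdisj

/-- Isotropic elements of `l'` orthogonal to `l` vanish. -/
theorem eq_zero_of_orthogonal {i : ZMod 2} {v : g} (hv : v ∈ l') (hvi : v ∈ L.parity i)
    (hlv : ∀ a ∈ l, χ (L.bracket a v) = 0) (hvv : χ (L.bracket v v) = 0) : v = 0 := by
  have hl2 : l' ≤ Γ.deg (-1) := hsup ▸ le_sup_right
  have hvl : ∀ a ∈ l, χ (L.bracket v a) = 0 := by
    intro a ha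
    have h1 := apply_bracket_swap hχ a hvi
    rw [hlv a ha, eq_comm, neg_eq_zero] at h1
    have h2 : koszulSign i i ≠ 0 := fun h => by
      have := koszulSign_mul_self i i
      rw [h, mul_zero] at this
      exact zero_ne_one this
    exact (mul_eq_zero.mp h1).resolve_left h2
  -- Maximality then puts `v` into `l`, which meets `l'` trivially.
  have hiso : Γ.IsIsotropic (l ⊔ Submodule.span ℂ {v}) := by
    refine ⟨sup_le hl.1.1 ?_, isSubsuperspace_of_internalProj_mem L fun k x hx => ?_, ?_⟩
    · rw [Submodule.span_singleton_le_iff_mem]; exact hl2 hv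
    · obtain ⟨a, ha, b, hb, rfl⟩ := Submodule.mem_sup.mp hx
      obtain ⟨t, rfl⟩ := Submodule.mem_span_singleton.mp hb
      rw [map_add, map_smul]
      refine add_mem (Submodule.mem_sup_left
        (IsSubsuperspace.internalProj_mem L hl.1.2.1 k ha))
        (Submodule.smul_mem _ _ ?_)
      by_cases h : i = k
      · subst h
        rw [internalProj_same _ hvi]
        exact Submodule.mem_sup_right (Submodule.mem_span_singleton_self v)
      · rw [internalProj_ne _ h hvi]; exact zero_mem _
    · intro x hx y hy
      obtain ⟨a, ha, b, hb, rfl⟩ := Submodule.mem_sup.mp hx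
      obtain ⟨t, rfl⟩ := Submodule.mem_span_singleton.mp hb
      obtain ⟨c, hc, d, hd, rfl⟩ := Submodule.mem_sup.mp hy
      obtain ⟨s, rfl⟩ := Submodule.mem_span_singleton.mp hd
      simp only [map_add, map_smul, LinearMap.add_apply, LinearMap.smul_apply,
        hl.1.2.2 a ha c hc, hlv a ha, hvl c hc, hvv]
      simp
  have hle := hl.2 hiso le_sup_left
  exact Submodule.disjoint_def.mp hdisj v
    (hle (Submodule.mem_sup_right (Submodule.mem_span_singleton_self v))) hv

include hl'

/-- Elements of `l'` orthogonal to `l` are odd. -/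
theorem odd_of_orthogonal {v : g} (hv : v ∈ l') (hlv : ∀ a ∈ l, χ (L.bracket a v) = 0) :
    v ∈ L.parity 1 := by
  have h0 : internalProj L.isInternal 0 v = 0 := by
    have hm : internalProj L.isInternal 0 v ∈ L.parity 0 := internalProj_mem _ _ _
    refine eq_zero_of_orthogonal hχ hl hsup hdisj (i := 0)
      (IsSubsuperspace.internalProj_mem L hl' 0 hv) hm (fun a ha => ?_) ?_
    · rw [apply_bracket_internalProj_parity hχ]
      exact hlv _ (IsSubsuperspace.internalProj_mem L hl.1.2.1 0 ha)
    -- On the even part the form is alternating, so the even component of `v` is automatically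
    -- isotropic and must vanish.
    · have := apply_bracket_swap hχ (internalProj L.isInternal 0 v) hm
      rw [koszulSign_zero_left, one_mul] at this
      exact self_eq_neg.mp this
  have := L.sum_internalProj_parity v
  rw [h0, zero_add] at this
  rw [← this]
  exact internalProj_mem _ _ _

/-- The vectors of `l'` orthogonal to `l` are odd, carry a symmetric form, and contain no nonzero
isotropic vector. Over an algebraically closed field such a space is at most one-dimensional. Here
`u` is the part of `w` orthogonal to `v`. -/
theorem exists_smul_of_orthogonal {v w : g} (hv : v ∈ l') (hw : w ∈ l')
    (hlv : ∀ a ∈ l, χ (L.bracket a v) = 0) (hlw : ∀ a ∈ l, χ (L.bracket a w) = 0)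
    (hvv : χ (L.bracket v v) ≠ 0) : ∃ t : ℂ, w = t • v := by
  have hv1 := odd_of_orthogonal hχ hl hl' hsup hdisj hv hlv
  have hw1 := odd_of_orthogonal hχ hl hl' hsup hdisj hw hlw
  have hsymm : ∀ x, ∀ y ∈ L.parity 1, χ (L.bracket x y) = χ (L.bracket y x) := fun x y hy => by
    rw [apply_bracket_swap hχ x hy]; simp
  set t := χ (L.bracket v w) / χ (L.bracket v v) with ht
  refine ⟨t, ?_⟩
  set u := w - t • v with hu
  have hu1 : u ∈ L.parity 1 := sub_mem hw1 (Submodule.smul_mem _ _ hv1)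
  have hul : u ∈ l' := sub_mem hw (Submodule.smul_mem _ _ hv)
  have hlu : ∀ a ∈ l, χ (L.bracket a u) = 0 := fun a ha => by
    rw [hu, map_sub, map_smul, map_sub, map_smul, hlv a ha, hlw a ha]; simp
  have hvu : χ (L.bracket v u) = 0 := by
    rw [hu, map_sub, map_smul, map_sub, map_smul, smul_eq_mul, ht, div_mul_cancel₀ _ hvv, sub_self]
  have huv : χ (L.bracket u v) = 0 := by rw [hsymm u v hv1, hvu]
  suffices h : u = 0 from sub_eq_zero.mp h
  by_cases huu : χ (L.bracket u u) = 0
  · exact eq_zero_of_orthogonal hχ hl hsup hdisj hul hu1 hlu huu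
  · exfalso
    -- The square root makes `v + s u` isotropic, hence zero; pairing it with `v` contradicts `hvv`.
    obtain ⟨s, hs⟩ := IsAlgClosed.exists_pow_nat_eq
      (-(χ (L.bracket v v) / χ (L.bracket u u))) (n := 2) (by norm_num)
    have hz : v + s • u = 0 := by
      refine eq_zero_of_orthogonal hχ hl hsup hdisj (add_mem hv (Submodule.smul_mem _ s hul))
        (add_mem hv1 (Submodule.smul_mem _ s hu1)) (fun a ha => ?_) ?_
      · rw [map_add, map_smul, map_add, map_smul, hlv a ha, hlu a ha]; simp
      · simp only [map_add, map_smul, LinearMap.add_apply, LinearMap.smul_apply, hvu, huv,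
          smul_eq_mul]
        have : s * (s * χ (L.bracket u u)) = -χ (L.bracket v v) := by
          rw [← mul_assoc, ← sq, hs]
          field_simp
        linear_combination this
    have h1 : χ (L.bracket v (v + s • u)) = 0 := by rw [hz]; simp
    rw [map_add, map_smul, map_add, map_smul, hvu, smul_zero, add_zero] at h1
    exact hvv h1

/-- If `dim (g_{-1})_1` is even, `l` is Lagrangian. -/
theorem eq_zero_of_orthogonal_of_even [FiniteDimensional ℂ g]
    (heven : Even (Module.finrank ℂ ↥(Γ.deg (-1) ⊓ L.parity 1))) {v : g} (hv : v ∈ l')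
    (hlv : ∀ a ∈ l, χ (L.bracket a v) = 0) : v = 0 := by
  have hl2 : l' ≤ Γ.deg (-1) := hsup ▸ le_sup_right
  have hv1 := odd_of_orthogonal hχ hl hl' hsup hdisj hv hlv
  by_contra hv0
  have hvv : χ (L.bracket v v) ≠ 0 := fun h =>
    hv0 (eq_zero_of_orthogonal hχ hl hsup hdisj hv hv1 hlv h)
  set V := Γ.deg (-1) ⊓ L.parity 1 with hV
  let B : LinearMap.BilinForm ℂ V := (L.bracket.compr₂ χ).domRestrict₁₂ V V
  have hB : ∀ x y : V, B x y = χ (L.bracket x y) := fun x y => rfl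
  -- A vector in the radical lies in `g^χ`, hence in nonnegative degrees because the grading is
  -- good; but it has degree `-1`.
  have hnd : ∀ x : V, (∀ y, B x y = 0) → x = 0 := by
    intro x hx
    have h1 : (x : g) ∈ L.annihilator χ := by
      intro y
      refine Γ.mem_of_homogeneous (LinearMap.ker (χ ∘ₗ L.bracket (x : g))) ?_ y
      intro j i y hyj hyi
      rw [LinearMap.mem_ker, LinearMap.comp_apply]
      by_cases hj : j = -1
      · subst hj
        by_cases hi : i = 1
        · subst hi
          exact hx ⟨y, hyj, hyi⟩
        · exact apply_bracket_parity hχ (Ne.symm hi) x.2.2 hyi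
      · exact Γ.apply_bracket_deg (by omega) x.2.1 hyj
    have h2 := Γ.annihilator_le h1
    have h3 : (⨆ (j : ℤ) (_ : 0 ≤ j), Γ.deg j) ≤
        LinearMap.ker (internalProj Γ.isInternal (-1)) :=
      iSup_le fun j => iSup_le fun hj y hy => by
        rw [LinearMap.mem_ker, internalProj_ne _ (by omega) hy]
    have h4 := LinearMap.mem_ker.mp (h3 h2)
    rw [internalProj_same _ x.2.1] at h4
    exact Subtype.ext h4
  have hsymm : ∀ x y : V, B x y = B y x := fun x y => by
    rw [hB, hB, apply_bracket_swap hχ x y.2.2]; simp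
  have hnondeg : B.Nondegenerate :=
    ⟨hnd, fun y hy => hnd y fun x => by rw [hsymm]; exact hy x⟩
  let W : Submodule ℂ V := l.comap V.subtype
  let v' : V := ⟨v, hl2 hv, hv1⟩
  -- The complement of `W` exceeds `W` by one line. Nondegeneracy then gives `dim V = 2 dim W + 1`,
  -- against the assumed parity.
  have horth : B.orthogonal W = W ⊔ Submodule.span ℂ {v'} := by
    apply le_antisymm
    · intro y hy
      have hy' : ∀ a ∈ l, χ (L.bracket a y) = 0 := by
        intro a ha
        have h1 := IsSubsuperspace.internalProj_mem L hl.1.2.1 1 ha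
        have h2 : χ (L.bracket (internalProj L.isInternal 1 a) (y : g)) = 0 :=
          hy ⟨internalProj L.isInternal 1 a, hl.1.1 h1, internalProj_mem _ _ _⟩ h1
        rwa [← apply_bracket_internalProj_parity hχ, internalProj_same _ y.2.2] at h2
      have hy1 : (y : g) ∈ l ⊔ l' := hsup ▸ y.2.1
      obtain ⟨a, ha, b, hb, hab⟩ := Submodule.mem_sup.mp hy1
      have hb' : ∀ c ∈ l, χ (L.bracket c b) = 0 := by
        intro c hc
        have := hy' c hc
        rwa [← hab, map_add, map_add, hl.1.2.2 c hc a ha, zero_add] at this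
      obtain ⟨t, rfl⟩ := exists_smul_of_orthogonal hχ hl hl' hsup hdisj hv hb hlv hb' hvv
      have ha1 : a ∈ V := ⟨hl.1.1 ha, by
        rw [eq_sub_of_add_eq hab]
        exact sub_mem y.2.2 (Submodule.smul_mem _ t hv1)⟩
      refine Submodule.mem_sup.mpr ⟨⟨a, ha1⟩, ha, t • v',
        Submodule.smul_mem _ _ (Submodule.mem_span_singleton_self v'), Subtype.ext hab⟩
    · refine sup_le (fun y hy a ha => hl.1.2.2 _ ha _ hy) ?_
      rw [Submodule.span_singleton_le_iff_mem]
      exact fun a ha => hlv _ ha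
  have hv'0 : v' ≠ 0 := fun h => hv0 (congrArg Subtype.val h)
  have hinf : W ⊓ Submodule.span ℂ {v'} = ⊥ := by
    rw [eq_bot_iff]
    rintro y ⟨hy1, hy2⟩
    obtain ⟨t, rfl⟩ := Submodule.mem_span_singleton.mp hy2
    rw [Submodule.mem_bot]
    exact Subtype.ext (Submodule.disjoint_def.mp hdisj _ hy1 (l'.smul_mem t hv))
  have h1 := LinearMap.BilinForm.finrank_orthogonal hnondeg W
  have h2 := Submodule.finrank_sup_add_finrank_inf_eq W (Submodule.span ℂ {v'})
  rw [hinf, finrank_bot, add_zero, finrank_span_singleton hv'0, ← horth] at h2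
  -- Needed because the dimension of the orthogonal complement is a truncated difference of natural
  -- numbers.
  have h3 := Submodule.finrank_le W
  obtain ⟨m, hm⟩ := heven
  omega

end Orthogonal

end GoodGrading

end LieSuperalgebra

namespace LieSuperalgebra

variable {g : Type*} [AddCommGroup g] [Module ℂ g] {L : LieSuperalgebra g}
  {χ : Module.Dual ℂ g}

/-- Superderivations of `S(g)` that extend a homogeneous operator on `g`. -/
theorem exists_superDer_ι (L : LieSuperalgebra g) (p : ZMod 2) (f : g →ₗ[ℂ] g)
    (hf : ∀ i, ∀ x ∈ L.parity i, f x ∈ L.parity (i + p)) :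
    ∃ D : SuperSym L.parity →ₗ[ℂ] SuperSym L.parity, D 1 = 0 ∧ ∀ x u,
      D (SuperSym.ι L.parity x * u) =
        SuperSym.ι L.parity (f x) * u + SuperSym.ι L.parity (L.twist p x) * D u :=
  L.exists_superDer p (SuperSym.ι L.parity ∘ₗ f) fun i _ x _ hx hy =>
    SuperSym.ι_comm L.parity (hf i x hx) hy

namespace GoodGrading

variable (Γ : L.GoodGrading χ) (l : Submodule ℂ g)

/-! ### The operators `a - χ(a)` on `U(g) / I_χ` -/

/-- The operator `a - χ(a)` on `U(g) / I_χ`. -/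
def whittakerOp (a : g) : Γ.WhittakerModule l →ₗ[ℂ] Γ.WhittakerModule l :=
  Γ.actQ l a - χ a • LinearMap.id

theorem whittakerOp_apply (a : g) (q : Γ.WhittakerModule l) :
    Γ.whittakerOp l a q = Γ.actQ l a q - χ a • q := rfl

theorem whittakerOp_proj {a : g} (ha : a ∈ Γ.nilSub l) : Γ.whittakerOp l a (Γ.proj l 1) = 0 := by
  rw [whittakerOp_apply, Γ.proj_toU l ha, sub_self]

/-- The scalar `χ(a)` passes through the twist because it vanishes for odd `a`. So `a - χ(a)` obeys
the Leibniz rule of `ad a`. -/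
theorem whittakerOp_actQ (hχ : L.IsEvenFunctional χ) {i : ZMod 2} {a : g} (ha : a ∈ L.parity i)
    (x : g) (q : Γ.WhittakerModule l) :
    Γ.whittakerOp l a (Γ.actQ l x q) =
      Γ.actQ l (L.bracket a x) q + Γ.actQ l (L.twist i x) (Γ.whittakerOp l a q) := by
  have h : χ a • L.toU x = χ a • L.toU (L.twist i x) := by
    rcases zmod_two_cases i with rfl | rfl
    · rw [show L.twist 0 x = x by simp [twist, L.sum_internalProj_parity]]
    · rw [hχ a ha, zero_smul, zero_smul]
  rw [whittakerOp_apply, whittakerOp_apply, map_sub, map_smul]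
  simp only [actQ_apply]
  have h' : χ a • L.toU x • q = χ a • L.toU (L.twist i x) • q := by
    rw [← smul_assoc, h, smul_assoc]
  rw [h', ← mul_smul (L.toU a), ← mul_smul _ (L.toU a), toU_mul_toU ha, add_smul]
  abel

/-- The gain over the degree `j + 2` of `a` itself: the operator kills `π(1)`, so by the Leibniz
rule it only replaces single factors `x` by `[a, x]`, and this changes the Kazhdan degree by `j`. -/
theorem whittakerOp_mem (hχ : L.IsEvenFunctional χ) {i : ZMod 2} {j : ℤ} {a : g}
    (ha : a ∈ L.parity i) (haj : a ∈ Γ.deg j) (hal : a ∈ Γ.nilSub l) (k : ℤ) :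
    ∀ q ∈ Γ.kazhdanQ l k, Γ.whittakerOp l a q ∈ Γ.kazhdanQ l (k + j) := by
  intro q hq
  refine Γ.kazhdanQ_induction l k
    (p := fun q => Γ.whittakerOp l a q ∈ Γ.kazhdanQ l (k + j)) ?_ ?_ ?_ ?_ hq
  · rw [map_zero]; exact zero_mem _
  · intro q q' h h'; rw [map_add]; exact add_mem h h'
  · intro c q h; rw [map_smul]; exact Submodule.smul_mem _ _ h
  · intro s hs hk
    refine Γ.kazhdanQ_mono l (add_le_add_left hk j) ?_
    clear hk hq
    suffices H : Γ.proj l (s.map fun b => L.toU b.2).prod ∈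
          Γ.kazhdanQ l (s.map fun b => b.1 + 2).sum ∧
        Γ.whittakerOp l a (Γ.proj l (s.map fun b => L.toU b.2).prod) ∈
          Γ.kazhdanQ l ((s.map fun b => b.1 + 2).sum + j) from H.2
    induction s with
    | nil =>
      refine ⟨⟨1, Γ.one_mem_kazhdanU, rfl⟩, ?_⟩
      have h0 := Γ.whittakerOp_proj l hal
      rw [← List.prod_nil] at h0
      exact h0 ▸ zero_mem _
    | cons b s ih =>
      obtain ⟨h1, h2⟩ := ih fun c hc => hs c (List.mem_cons_of_mem _ hc)
      have hb := hs b List.mem_cons_self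
      rw [proj_prod_cons, Γ.whittakerOp_actQ l hχ ha, List.map_cons, List.sum_cons]
      refine ⟨?_, add_mem ?_ ?_⟩
      · rw [add_comm]; exact Γ.actQ_mem l hb _ _ h1
      · convert Γ.actQ_mem l (Γ.bracket_mem _ _ _ haj _ hb) _ _ h1 using 2
        ring
      · convert Γ.actQ_mem l (L.twist_mem (fun i _ => Γ.deg_parity b.1 i) i hb) _ _ h2 using 2
        ring

variable {i : ZMod 2} {j : ℤ} {a : g} (hχ : L.IsEvenFunctional χ) (ha : a ∈ L.parity i)
  (haj : a ∈ Γ.deg j) (hal : a ∈ Γ.nilSub l)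

theorem grOperator_whittakerOp_grAct (x : g) (Y : Γ.GrQ l) :
    grOperator (Γ.whittakerOp l a) j (Γ.whittakerOp_mem l hχ ha haj hal) (Γ.grAct l x Y) =
      Γ.grAct l (L.bracket a x) Y + Γ.grAct l (L.twist i x)
        (grOperator (Γ.whittakerOp l a) j (Γ.whittakerOp_mem l hχ ha haj hal) Y) := by
  set E := grOperator (Γ.whittakerOp l a) j (Γ.whittakerOp_mem l hχ ha haj hal) with hE
  refine AssocGraded.mem_of_grClass (LinearMap.eqLocus (E ∘ₗ Γ.grAct l x)
    (Γ.grAct l (L.bracket a x) + Γ.grAct l (L.twist i x) ∘ₗ E)) (fun k q => ?_) Y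
  refine mem_of_internal Γ.isInternal (LinearMap.eqLocus
    (E ∘ₗ LinearMap.applyₗ (grClass (Γ.kazhdanQ l) k q) ∘ₗ Γ.grAct l)
    (LinearMap.applyₗ (grClass (Γ.kazhdanQ l) k q) ∘ₗ Γ.grAct l ∘ₗ L.bracket a +
      LinearMap.applyₗ (E (grClass (Γ.kazhdanQ l) k q)) ∘ₗ Γ.grAct l ∘ₗ L.twist i))
    (fun w x hx => ?_) x
  have hb := Γ.bracket_mem _ _ _ haj _ hx
  have ht := L.twist_mem (fun i _ => Γ.deg_parity w i) i hx
  change E (Γ.grAct l x (grClass (Γ.kazhdanQ l) k q)) =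
    Γ.grAct l (L.bracket a x) (grClass (Γ.kazhdanQ l) k q) +
      Γ.grAct l (L.twist i x) (E (grClass (Γ.kazhdanQ l) k q))
  rw [hE, Γ.grAct_of_mem l hx, Γ.grAct_of_mem l hb, Γ.grAct_of_mem l ht, grOperator_grClass,
    grOperator_grClass, grOperator_grClass, grOperator_grClass, grOperator_grClass]
  have e1 : k + (j + w + 2) = k + (w + 2) + j := by ring
  have e2 : k + j + (w + 2) = k + (w + 2) + j := by ring
  have m1 := e1 ▸ Γ.actQ_mem l hb k q q.2
  have m2 := e2 ▸ Γ.actQ_mem l ht _ _ (Γ.whittakerOp_mem l hχ ha haj hal k q q.2)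
  rw [grClass_congr (Γ.kazhdanQ l) e1 _ _ m1, grClass_congr (Γ.kazhdanQ l) e2 _ _ m2,
    ← grClass_add]
  congr 1
  exact Subtype.ext (Γ.whittakerOp_actQ l hχ ha x q)

/-- Both sides vanish on `1` and obey the same Leibniz rule; the operator on the graded module is
therefore the superderivation `ad a` of `S(g)`. -/
theorem grOperator_whittakerOp_symbolMap {D : SuperSym L.parity →ₗ[ℂ] SuperSym L.parity}
    (hD1 : D 1 = 0) (hD : ∀ x u, D (SuperSym.ι L.parity x * u) =
      SuperSym.ι L.parity (L.bracket a x) * u + SuperSym.ι L.parity (L.twist i x) * D u)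
    (u : SuperSym L.parity) :
    grOperator (Γ.whittakerOp l a) j (Γ.whittakerOp_mem l hχ ha haj hal) (Γ.symbolMap l u) =
      Γ.symbolMap l (D u) := by
  refine SuperSym.mem_of_mul_mem (LinearMap.eqLocus
    (grOperator (Γ.whittakerOp l a) j (Γ.whittakerOp_mem l hχ ha haj hal) ∘ₗ Γ.symbolMap l)
    (Γ.symbolMap l ∘ₗ D)) ?_ ?_ u
  · rw [LinearMap.mem_eqLocus, LinearMap.comp_apply, LinearMap.comp_apply, hD1, map_zero,
      symbolMap_one, grOperator_grClass]
    refine grClass_eq_zero _ _ ?_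
    change Γ.whittakerOp l a (Γ.proj l 1) ∈ _
    rw [Γ.whittakerOp_proj l hal]
    exact zero_mem _
  · intro x u hu
    rw [LinearMap.mem_eqLocus, LinearMap.comp_apply, LinearMap.comp_apply] at hu ⊢
    rw [symbolMap_mul, Γ.grOperator_whittakerOp_grAct l hχ ha haj hal, hu, hD, map_add, symbolMap_mul, symbolMap_mul]

/-- The symbols of elements of `W_χ` are killed by the operators `a - χ(a)`. -/
theorem grOperator_whittakerOp_eq_zero {Y : Γ.GrQ l} (hY : Y ∈ Γ.grW l) :
    grOperator (Γ.whittakerOp l a) j (Γ.whittakerOp_mem l hχ ha haj hal) Y = 0 := by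
  refine AssocGraded.toModule_eq_zero _ Y fun k => ?_
  obtain ⟨w, hw, h⟩ := hY k
  -- The endomorphism `w` commutes with `a - χ(a)`, which kills `π(1)`.
  have h0 : Γ.whittakerOp l a (Γ.toQ l w) = 0 := by
    have h1 := congrArg w.unop (Γ.whittakerOp_proj l hal)
    rw [whittakerOp_apply, map_sub, map_zero, actQ_apply, map_smul,
      ← algebraMap_smul L.UEnv (χ a), map_smul, algebraMap_smul] at h1
    exact h1
  rw [h]
  have h2 := grClass_eq_zero (Γ.kazhdanQ l)
    ⟨_, Γ.whittakerOp_mem l hχ ha haj hal k _ hw⟩ (h0.symm ▸ zero_mem _ : Γ.whittakerOp l a (Γ.toQ l w) ∈ _)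
  exact h2

/-! ### The highest component -/

theorem exists_topComponent_eq (X : SuperSym L.parity) :
    ∃ d, Γ.topComponent X = symComp Γ.gradeHom d X ∧ ∀ e, d < e → symComp Γ.gradeHom e X = 0 := by
  classical
  unfold topComponent
  split
  · next h =>
    refine ⟨_, rfl, fun e he => ?_⟩
    by_contra h0
    exact absurd (Finset.le_max' _ e (Finsupp.mem_support_iff.mpr h0)) (not_le.mpr he)
  · next h =>
    have h0 : ∀ e, symComp Γ.gradeHom e X = 0 := fun e => by
      by_contra h1
      exact h ⟨e, Finsupp.mem_support_iff.mpr h1⟩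
    exact ⟨0, (h0 0).symm, fun e _ => h0 e⟩

theorem topComponent_mem {l' : Submodule ℂ g} (hl' : l' ≤ Γ.deg (-1)) {X : SuperSym L.parity}
    (hX : X ∈ L.symSub (Γ.posSub l')) : Γ.topComponent X ∈ L.symSub (Γ.posSub l') := by
  obtain ⟨d, hd, -⟩ := Γ.exists_topComponent_eq X
  rw [hd]
  exact symComp_mem_symSub Γ.gradeHom Γ.isInternal (fun w x hx => Γ.gradeHom_ι hx)
    (fun w x hx => posSub_deg hl' w hx) hX d

namespace Splitting

variable {Γ l} {l' : Submodule ℂ g} (T : Γ.Splitting l l')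

include T hχ ha haj hal

/-- The highest components of symbols of elements of `W_χ` are killed by contractions. -/
theorem contraction_topComponent [FiniteDimensional ℂ g] (hl : Γ.IsIsotropic l)
    (hl' : L.IsSubsuperspace l') {D : SuperSym L.parity →ₗ[ℂ] SuperSym L.parity} (hD1 : D 1 = 0)
    (hD : ∀ x u, D (SuperSym.ι L.parity x * u) =
      χ (L.bracket a x) • u + SuperSym.ι L.parity (L.twist i x) * D u)
    {X : SuperSym L.parity} (hX : X ∈ L.symSub (Γ.posSub l'))
    (hXW : Γ.symbolMap l X ∈ Γ.grW l) : D (Γ.topComponent X) = 0 := by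
  have hbr : ∀ k, ∀ x ∈ L.parity k, L.bracket a x ∈ L.parity (k + i) := fun k x hx => by
    rw [add_comm]; exact L.bracket_mem i k a ha x hx
  obtain ⟨A, hA1, hA⟩ := exists_superDer_ι L i (L.bracket a) hbr
  obtain ⟨B, hB1, hB⟩ := exists_superDer_ι L i (T.pr ∘ₗ L.bracket a)
    fun k x hx => T.pr_parity _ _ (hbr k x hx)
  obtain ⟨P, hP⟩ := T.exists_reduction hχ
  -- The symbol of `ad a (X)` is zero; injectivity on `S(p ⊕ l')` lifts this to its reduction.
  have hPA : P (A X) = 0 := by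
    have h0 : Γ.symbolMap l (P (A X)) = Γ.symbolMap l 0 := by
      rw [T.symbolMap_reduction hχ hP, ← Γ.grOperator_whittakerOp_symbolMap l hχ ha haj hal hA1 hA,
        Γ.grOperator_whittakerOp_eq_zero l hχ ha haj hal hXW, map_zero]
    exact (T.bijOn_symbolMap hχ hl hl').injOn (T.reduction_mem hP _)
      (zero_mem (L.symSub (Γ.posSub l'))) h0
  -- Reducing a bracket `[a, x]` leaves the scalar `χ([a, x])`, which gives the contraction, and `pr
  -- [a, x]`, which gives the derivation `B`. On `S(p ⊕ l')` itself `P` is the identity.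
  have hPX : P (A X) = D X + B X := by
    refine (adjoin_subset_of_mul_mem (LinearMap.eqLocus P.toLinearMap LinearMap.id ⊓
      LinearMap.eqLocus (P.toLinearMap ∘ₗ A) (D + B)) ?_ ?_ hX).2
    · constructor
      · simp
      · simp [hA1, hB1, hD1]
    · rintro _ ⟨x, hx, rfl⟩ u ⟨hu1, hu2⟩
      simp only [SetLike.mem_coe, LinearMap.mem_eqLocus, AlgHom.toLinearMap_apply,
        LinearMap.id_apply, LinearMap.comp_apply, LinearMap.add_apply] at hu1 hu2
      have hPι : ∀ x ∈ Γ.posSub l', P (SuperSym.ι L.parity x) = SuperSym.ι L.parity x := by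
        intro x hx
        have h := T.pr_eq_self x hx
        rw [hP, h, T.apply_eq_zero_of_pr h, map_zero, add_zero]
      constructor
      · simp only [SetLike.mem_coe, LinearMap.mem_eqLocus, AlgHom.toLinearMap_apply,
          LinearMap.id_apply]
        rw [map_mul, hPι x hx, hu1]
      · simp only [SetLike.mem_coe, LinearMap.mem_eqLocus, AlgHom.toLinearMap_apply,
          LinearMap.comp_apply, LinearMap.add_apply]
        rw [hA, map_add, map_mul, map_mul, hu1, hu2, hP,
          hPι _ (L.twist_mem (fun i _ => posSub_parity hl' i) i hx), hD, hB, add_mul,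
          ← Algebra.smul_def, mul_add, LinearMap.comp_apply]
        abel
  obtain ⟨d, hd, hd'⟩ := Γ.exists_topComponent_eq X
  have hsD := symComp_superDer (p := i) (s := j + 2) (d := (χ ∘ₗ L.bracket a).smulRight 1)
    Γ.gradeHom Γ.iSup_deg (fun w x hx => Γ.gradeHom_ι hx) (fun w i x hx => Γ.deg_parity w i hx) hD1
    (fun x u => by rw [hD]; simp) (by
      intro w x hx k u
      by_cases h : j + w = -2
      · rw [show k - w - (j + 2) = k by omega]; simp
      · simp [Γ.apply_bracket_deg h haj hx]) (d + (j + 2)) X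
  have hsB := symComp_superDer (p := i) (s := j) (d := SuperSym.ι L.parity ∘ₗ T.pr ∘ₗ L.bracket a)
    Γ.gradeHom Γ.iSup_deg (fun w x hx => Γ.gradeHom_ι hx) (fun w i x hx => Γ.deg_parity w i hx) hB1
    hB (by
      intro w x hx k u
      rw [LinearMap.comp_apply, LinearMap.comp_apply, symComp_mul
        (Γ.gradeHom_ι (T.pr_deg _ _ (Γ.bracket_mem j w a haj x hx))),
        show k - (j + w) = k - w - j by ring]) (d + (j + 2)) X
  rw [add_sub_cancel_right, ← hd] at hsD
  -- In degree `d + j + 2` the derivation `B` only sees the component of `X` of degree `d + 2`,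
  -- which is above the top.
  rw [hd' _ (by omega), map_zero] at hsB
  have h0 := congrArg (symComp Γ.gradeHom (d + (j + 2))) (hPX.symm.trans hPA)
  rwa [map_add, map_zero, hsB, add_zero, hsD] at h0

omit ha haj hal in
/-- The highest components of symbols of elements of `W_χ` lie in `S(N)` for some `N ⊆ p ⊕ l'`
that is orthogonal to `m`. -/
theorem exists_topComponent_mem [FiniteDimensional ℂ g] (hl : Γ.IsIsotropic l)
    (hl' : L.IsSubsuperspace l') (hl2 : l' ≤ Γ.deg (-1)) {X : SuperSym L.parity}
    (hX : X ∈ L.symSub (Γ.posSub l')) (hXW : Γ.symbolMap l X ∈ Γ.grW l) :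
    ∃ N ≤ Γ.posSub l', Γ.topComponent X ∈ L.symSub N ∧ ∀ x ∈ N,
      ∀ j i a, a ∈ Γ.deg j → a ∈ L.parity i → a ∈ Γ.nilSub l → χ (L.bracket a x) = 0 := by
  -- A minimal `N` replaces the successive intersection with kernels: each contraction would shrink
  -- `N` further unless its functional already vanishes on `N`.
  obtain ⟨N, ⟨hN1, hN2, hN3⟩, hmin⟩ := WellFounded.has_min
    (wellFounded_lt (α := Submodule ℂ g)) {N | N ≤ Γ.posSub l' ∧
      (∀ i, ∀ x ∈ N, internalProj L.isInternal i x ∈ N) ∧ Γ.topComponent X ∈ L.symSub N}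
    ⟨Γ.posSub l', le_rfl, fun i x hx => posSub_parity hl' i hx, Γ.topComponent_mem hl2 hX⟩
  refine ⟨N, hN1, hN3, fun x hx j i a haj hai hal => ?_⟩
  have hξ : ∀ k, ∀ x ∈ L.parity k, k ≠ i → (χ ∘ₗ L.bracket a) x = 0 := fun k x hx hk =>
    apply_bracket_parity hχ (Ne.symm hk) hai hx
  obtain ⟨D, hD1, hD⟩ := exists_contraction L i (χ ∘ₗ L.bracket a) hξ
  have hmem := mem_symSub_inf_ker hN2 hξ hD1 hD hN3
    (T.contraction_topComponent hχ hai haj hal hl hl' hD1 hD hX hXW)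
  have hstab : ∀ k, ∀ x ∈ N ⊓ LinearMap.ker (χ ∘ₗ L.bracket a),
      internalProj L.isInternal k x ∈ N ⊓ LinearMap.ker (χ ∘ₗ L.bracket a) := by
    rintro k x ⟨hx1, hx2⟩
    refine ⟨hN2 k x hx1, ?_⟩
    change χ (L.bracket a (internalProj L.isInternal k x)) = 0
    rw [apply_bracket_internalProj_parity hχ]
    by_cases hk : i = k
    · subst hk; rw [internalProj_same _ hai]; exact hx2
    · rw [internalProj_ne _ hk hai]; simp
  have hnot := hmin (N ⊓ LinearMap.ker (χ ∘ₗ L.bracket a)) ⟨inf_le_left.trans hN1, hstab, hmem⟩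
  have heq : N ⊓ LinearMap.ker (χ ∘ₗ L.bracket a) = N := by
    by_contra h
    exact hnot (lt_of_le_of_ne inf_le_left h)
  have hx' : x ∈ N ⊓ LinearMap.ker (χ ∘ₗ L.bracket a) := heq.symm ▸ hx
  exact hx'.2

end Splitting

end GoodGrading

theorem symSub_mono {N N' : Submodule ℂ g} (h : N ≤ N') : L.symSub N ≤ L.symSub N' :=
  Algebra.adjoin_mono (Set.image_mono h)

end LieSuperalgebra

end

/-! ### Conclusion: the two parity cases -/

theorem mainTheorem9 {g : Type*} [AddCommGroup g] [Module ℂ g] [FiniteDimensional ℂ g]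
    (L : LieSuperalgebra g) (hred : L.IsEvenReductive)
    (χ : Module.Dual ℂ g) (hχ : L.IsEvenFunctional χ) (hnil : L.IsNilpotentFunctional χ)
    (Γ : L.GoodGrading χ)
    (l l' : Submodule ℂ g) (hl : Maximal Γ.IsIsotropic l)
    (hl' : L.IsSubsuperspace l') (hsup : l ⊔ l' = Γ.deg (-1)) (hdisj : Disjoint l l')
    (hmax : ∃ l'' ≤ l', Maximal Γ.IsIsotropic l'') :
    -- the identification of `S(p ⊕ l')` with `Gr_K (U(g) / I_χ)`
    Set.BijOn (Γ.symbolMap l) (L.symSub (Γ.posSub l')) Set.univ ∧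
    (Even (Module.finrank ℂ ↥(Γ.deg (-1) ⊓ L.parity 1)) →
      ∀ X ∈ L.symSub (Γ.posSub l'), Γ.symbolMap l X ∈ Γ.grW l →
        Γ.topComponent X ∈ L.symSub (L.annihilator χ)) ∧
    (Odd (Module.finrank ℂ ↥(Γ.deg (-1) ⊓ L.parity 1)) →
      ∀ θ ∈ l', (∀ x ∈ l, χ (L.bracket x θ) = 0) → χ (L.bracket θ θ) = 2 →
      ∀ X ∈ L.symSub (Γ.posSub l'), Γ.symbolMap l X ∈ Γ.grW l →
        Γ.topComponent X ∈ L.symSub (L.annihilator χ ⊔ Submodule.span ℂ {θ})) := by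
  have hl2 : l' ≤ Γ.deg (-1) := hsup ▸ le_sup_right
  obtain ⟨T⟩ := LieSuperalgebra.GoodGrading.exists_splitting hl.1.2.1 hl' hsup hdisj
  have hproj : ∀ x ∈ Γ.posSub l', internalProj Γ.isInternal (-1) x ∈ l' := fun x hx => by
    have := LieSuperalgebra.GoodGrading.internalProj_posSub hl2 (-1) le_rfl hx
    rwa [if_pos rfl] at this
  refine ⟨T.bijOn_symbolMap hχ hl.1 hl', fun heven X hX hXW => ?_,
    fun _ θ hθ hlθ hθθ X hX hXW => ?_⟩
  · obtain ⟨N, hN, hXN, hNm⟩ := T.exists_topComponent_mem hχ hl.1 hl' hl2 hX hXW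
    refine LieSuperalgebra.symSub_mono (fun x hx => ?_) hXN
    have h1 := LieSuperalgebra.GoodGrading.sub_mem_annihilator hχ hl2 (hN hx) (hNm x hx)
    -- The degree `-1` component of `x` is a vector of `l'` orthogonal to `l`, so it vanishes and
    -- `x` itself lies in `g^χ`.
    rwa [LieSuperalgebra.GoodGrading.eq_zero_of_orthogonal_of_even hχ hl hl' hsup
      hdisj heven (hproj x (hN hx))
      (fun a ha => LieSuperalgebra.GoodGrading.orthogonal_of_posSub hl.1 (hNm x hx) ha), sub_zero] at h1
  · obtain ⟨N, hN, hXN, hNm⟩ := T.exists_topComponent_mem hχ hl.1 hl' hl2 hX hXW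
    refine LieSuperalgebra.symSub_mono (fun x hx => ?_) hXN
    have h1 := LieSuperalgebra.GoodGrading.sub_mem_annihilator hχ hl2 (hN hx) (hNm x hx)
    obtain ⟨t, ht⟩ := LieSuperalgebra.GoodGrading.exists_smul_of_orthogonal hχ hl hl' hsup
      hdisj hθ (hproj x (hN hx)) hlθ
      (fun a ha => LieSuperalgebra.GoodGrading.orthogonal_of_posSub hl.1 (hNm x hx) ha) (by rw [hθθ]; exact two_ne_zero)
    -- Here the degree `-1` component survives, but only as a multiple of `θ`, which is not
    -- isotropic.
    rw [← sub_add_cancel x (internalProj Γ.isInternal (-1) x), ht]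
    rw [ht] at h1
    exact add_mem (Submodule.mem_sup_left h1) (Submodule.mem_sup_right
      (Submodule.smul_mem _ t (Submodule.mem_span_singleton_self θ)))
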